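/- **Conventions.** A binary linear code $C\subseteq\mathbb F_2^n$ is *self-dual* if it equals its Euclidean dual, *doubly-even* (Type II) if moreover all weights are divisible by $4$, and *singly-even* (Type I) if it is self-dual but not doubly-even. A self-dual code of length $n$ is *extremal* if its minimum distance is $4\lfloor n/24\rfloor+4$ (or $4\lfloor n/24\rfloor+6$ when $n\equiv 22 \pmod{24}$); for $n=64$ this means $d=12$. We say that a code of length $64$ has weight enumerator $W_{64,1}$, respectively $W_{64,2}$, with parameter $\beta$ if its weight enumerator is $$W_{64,1}=1+(1312+16\beta)y^{12}+(22016-64\beta)y^{14}+\cdots,\qquad 14\le\beta\le 284,$$ $$W_{64,2}=1+(1312+16\beta)y^{12}+(23040-64\beta)y^{14}+\cdots,\qquad 0\le\beta\le 277,$$ where the dots stand for terms of degree at least $16$. Let $R_2=\mathbb F_2[u,v]/(u^2,v^2)$, let $\varphi:R_2^n\to\mathbb F_2^{4n}$, $\varphi(\bar a+u\bar b+v\bar c+uv\bar d)=(\bar d,\bar c+\bar d,\bar b+\bar d,\bar a+\bar b+\bar c+\bar d)$, be the Gray map, and let $\pi:R_2^n\to\mathbb F_2^n$, $\pi(\bar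 a+u\bar b+v\bar c+uv\bar d)=\bar a$. A code $L$ over $R_2$ is a *lift* of a binary code $D$ if $\pi(L)=D$. Let $G_1$ be the octagonal prism: vertices $1,\dots,16$, two $8$-cycles $1,2,\dots,8$ and $9,10,\dots,16$, and the edges $\{i,i+8\}$, $1\le i\le 8$. Let $G_2$ be the graph on $1,\dots,16$ with edges $\{1,2\},\{2,3\},\{3,4\},\{4,5\},\{5,6\},\{5,8\},\{6,1\},\{7,8\},\{7,9\},\{7,6\},\{1,9\},\{9,10\},\{2,10\},\{10,11\},\{11,12\},\{12,13\},\{13,3\},\{13,14\},\{4,14\},\{11,16\},\{15,16\},\{12,15\},\{14,15\},\{8,16\}$. Embed $G_1$ in the plane with the faces two octagons $1\cdots8$ and $9\cdots16$ and the eight squares $i,i+1,i+9,i+8$ (cyclically), and $G_2$ with the faces $\{1,2,10,9\}$, $\{1,2,3,4,5,6\}$, $\{2,3,13,12,11,10\}$, $\{3,4,14,13\}$, $\{4,5,8,16,15,14\}$, $\{5,6,7,8\}$, $\{1,6,7,9\}$, $\{7,8,16,11,10,9\}$, $\{11,12,15,16\}$, $\{12,13,14,15\}$. Let $C_1$ and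 $C_2$ be the binary codes of length $16$ generated by the rows of the face-vertex incidence matrices of these embedded graphs. **Theorem.** 1. There is an extremal singly-even self-dual binary $[64,32,12]$ code with weight enumerator $W_{64,1}$ for each of the $23$ parameters $\beta\in\{14,16,18,20,22,24,25,26,28,29,30,32,34,36,38,39,44,46,53,59,60,64,74\}$, and one with weight enumerator $W_{64,2}$ for each of the $56$ parameters $\beta\in\{0,\dots,18\}\cup\{20,\dots,30\}\cup\{32,33,35,36,37,38,40,41,44,48,51,52,56,58,64,72,80,88,96,104,108,112,114,118,120,184\}$. 2. $G_1$ and $G_2$ are connected bicubic (bipartite and $3$-regular) planar graphs; $C_1$ is a Type II self-dual $[16,8,4]$ code and $C_2$ is a Type I self-dual $[16,8,4]$ code. 3. For each of the fifteen parameters $\beta=16,20,24,26,28,30,34,38$ in $W_{64,1}$ and $\beta=3,7,11,15,26,27,35$ in $W_{64,2}$ there is a self-dual code $L$ of length $16$ over $R_2$ that is a lift of $C_2$ and whose Gray image $\varphi(L)$ is an extremal singly-even self-dual $[64,32,12]$ code with that weight enumerator. 4. For each of the five parameters $\beta=20,24,26,30$ in $W_{64,1}$ and $\beta=26$ in $W_{64,2}$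 there is also a self-dual lift of $C_1$ to $R_2$ whose Gray image is such a code. -/

import Mathlib

open scoped Polynomial

noncomputable section

namespace GraphCodes

/-! ### Linear codes and self-duality -/

/-- A linear code of length `n` over `R`. -/
abbrev LinearCode (R : Type*) [CommRing R] (n : ℕ) := Submodule R (Fin n → R)

/-- A binary linear code of length `n`. -/
abbrev BinaryCode (n : ℕ) := LinearCode (ZMod 2) n

/-- The Euclidean dual of a code. -/
def dual {R : Type*} [CommRing R] {n : ℕ} (C : LinearCode R n) : LinearCode R n where
  carrier := {b | ∀ a ∈ C, ∑ i, a i * b i = 0}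
  zero_mem' := by
    intro a _
    simp
  add_mem' := by
    intro x y hx hy a ha
    simp [mul_add, Finset.sum_add_distrib, hx a ha, hy a ha]
  smul_mem' := by
    intro r x hx a ha
    have h : ∑ i, a i * (r • x) i = r * ∑ i, a i * x i := by
      rw [Finset.mul_sum]
      refine Finset.sum_congr rfl fun i _ => ?_
      simp only [Pi.smul_apply, smul_eq_mul]
      ring
    rw [h, hx a ha, mul_zero]

def IsSelfDual {R : Type*} [CommRing R] {n : ℕ} (C : LinearCode R n) : Prop :=
  C = dual C

/-- The minimum distance of a binary linear code: the least Hamming weight of a nonzero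
codeword (`0` for the zero code). -/
def minDist {n : ℕ} (C : BinaryCode n) : ℕ :=
  sInf {w | ∃ c ∈ C, c ≠ 0 ∧ hammingNorm c = w}

/-- `C` is an `[n, k, d]` binary code. -/
def HasParameters {n : ℕ} (C : BinaryCode n) (k d : ℕ) : Prop :=
  Module.finrank (ZMod 2) C = k ∧ minDist C = d

/-- Type II: every weight is divisible by `4`. -/
def IsDoublyEven {n : ℕ} (C : BinaryCode n) : Prop :=
  ∀ c ∈ C, 4 ∣ hammingNorm c

/-- A Type I code is a self-dual code that is not doubly-even. -/
def IsTypeI {n : ℕ} (C : BinaryCode n) : Prop :=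
  IsSelfDual C ∧ ¬ IsDoublyEven C

/-- A Type II code is a self-dual code that is doubly-even. -/
def IsTypeII {n : ℕ} (C : BinaryCode n) : Prop :=
  IsSelfDual C ∧ IsDoublyEven C

/-- The upper bound for the minimum distance of a binary self-dual code of length `n`. -/
def extremalBound (n : ℕ) : ℕ :=
  if n % 24 = 22 then 4 * (n / 24) + 6 else 4 * (n / 24) + 4

/-- A self-dual code is extremal if its minimum distance meets the bound. -/
def IsExtremal {n : ℕ} (C : BinaryCode n) : Prop :=
  IsSelfDual C ∧ minDist C = extremalBound n

/-! ### Weight enumerators -/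

/-- The number of codewords of weight `i`. -/
def weightCount {n : ℕ} (C : BinaryCode n) (i : ℕ) : ℕ :=
  {c : Fin n → ZMod 2 | c ∈ C ∧ hammingNorm c = i}.ncard

/-- The weight enumerator `∑ᵢ Aᵢ yⁱ`. -/
def weightEnumerator {n : ℕ} (C : BinaryCode n) : ℤ[X] :=
  ∑ i ∈ Finset.range (n + 1), Polynomial.monomial i (weightCount C i : ℤ)

/-- The weight enumerator of `C` is
`1 + (1312 + 16β) y¹² + (22016 - 64β) y¹⁴ + ⋯` with `14 ≤ β ≤ 284`,
where the dots stand for terms of degree at least `16`. -/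
def HasW641 {n : ℕ} (C : BinaryCode n) (β : ℕ) : Prop :=
  14 ≤ β ∧ β ≤ 284 ∧
    ∀ i < 16, (weightEnumerator C).coeff i =
      (1 + Polynomial.monomial 12 (1312 + 16 * (β : ℤ))
        + Polynomial.monomial 14 (22016 - 64 * (β : ℤ)) : ℤ[X]).coeff i

/-- The weight enumerator of `C` is
`1 + (1312 + 16β) y¹² + (23040 - 64β) y¹⁴ + ⋯` with `0 ≤ β ≤ 277`,
where the dots stand for terms of degree at least `16`. -/
def HasW642 {n : ℕ} (C : BinaryCode n) (β : ℕ) : Prop :=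
  β ≤ 277 ∧
    ∀ i < 16, (weightEnumerator C).coeff i =
      (1 + Polynomial.monomial 12 (1312 + 16 * (β : ℤ))
        + Polynomial.monomial 14 (23040 - 64 * (β : ℤ)) : ℤ[X]).coeff i

/-- Extremal singly-even self-dual `[64, 32, 12]` code. -/
def IsExtremalTypeI64 (C : BinaryCode 64) : Prop :=
  IsTypeI C ∧ IsExtremal C ∧ HasParameters C 32 12

/-! ### The ring `R₂` and the Gray map -/

/-- `R₂ = 𝔽₂[u, v] / (u², v²)`, built as the dual numbers (in `v`) over the dual numbers
(in `u`) over `𝔽₂`: the element `a + u b + v c + u v d` is `((a, b), (c, d))`. -/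
abbrev R₂ := DualNumber (DualNumber (ZMod 2))

namespace R₂

def u : R₂ := TrivSqZeroExt.inl DualNumber.eps

def v : R₂ := DualNumber.eps

/-- The coefficient of `1`. -/
def coeffOne (x : R₂) : ZMod 2 := x.fst.fst

/-- The coefficient of `u`. -/
def coeffU (x : R₂) : ZMod 2 := x.fst.snd

/-- The coefficient of `v`. -/
def coeffV (x : R₂) : ZMod 2 := x.snd.fst

/-- The coefficient of `u v`. -/
def coeffUV (x : R₂) : ZMod 2 := x.snd.snd

theorem u_sq : u * u = 0 := by
  ext <;> simp [u]

theorem v_sq : v * v = 0 := by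
  simp [v]

theorem eq_coeff (x : R₂) :
    x = algebraMap (ZMod 2) R₂ (coeffOne x) + u * algebraMap (ZMod 2) R₂ (coeffU x)
      + v * algebraMap (ZMod 2) R₂ (coeffV x)
      + u * v * algebraMap (ZMod 2) R₂ (coeffUV x) := by
  ext <;> simp [u, v, coeffOne, coeffU, coeffV, coeffUV, TrivSqZeroExt.algebraMap_eq_inl']

end R₂

/-- The Gray map `φ(a + u b + v c + u v d) = (d, c + d, b + d, a + b + c + d)`
from `R₂ⁿ` to `𝔽₂⁴ⁿ`; the entry `i + n k` of the image is entry `i` of block `k`. -/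
def gray (n : ℕ) : (Fin n → R₂) →ₗ[ZMod 2] (Fin (4 * n) → ZMod 2) where
  toFun x := fun j =>
    let k := (finProdFinEquiv.symm j).1
    let y := x (finProdFinEquiv.symm j).2
    ![R₂.coeffUV y,
      R₂.coeffV y + R₂.coeffUV y,
      R₂.coeffU y + R₂.coeffUV y,
      R₂.coeffOne y + R₂.coeffU y + R₂.coeffV y + R₂.coeffUV y] k
  map_add' x y := by
    funext j
    simp only [Pi.add_apply]
    generalize (finProdFinEquiv.symm j).1 = k
    fin_cases k <;> simp [R₂.coeffOne, R₂.coeffU, R₂.coeffV, R₂.coeffUV] <;> abel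
  map_smul' r x := by
    funext j
    simp only [Pi.smul_apply, RingHom.id_apply]
    generalize (finProdFinEquiv.symm j).1 = k
    fin_cases k <;> simp [R₂.coeffOne, R₂.coeffU, R₂.coeffV, R₂.coeffUV] <;> ring

/-- The projection `π(a + u b + v c + u v d) = a`. -/
def proj (n : ℕ) : (Fin n → R₂) →ₗ[ZMod 2] (Fin n → ZMod 2) where
  toFun x := fun i => R₂.coeffOne (x i)
  map_add' x y := by
    funext i
    simp [R₂.coeffOne]
  map_smul' r x := by
    funext i
    simp [R₂.coeffOne]

/-- The Gray image `φ(C)` of a code over `R₂`. -/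
def grayImage {n : ℕ} (C : LinearCode R₂ n) : BinaryCode (4 * n) :=
  (C.restrictScalars (ZMod 2)).map (gray n)

/-- `C` is a lift of the binary code `D` if `π(C) = D`. -/
def IsLift {n : ℕ} (C : LinearCode R₂ n) (D : BinaryCode n) : Prop :=
  (C.restrictScalars (ZMod 2)).map (proj n) = D

/-! ### Planar embeddings and face-vertex incidence -/

/-- A rotation system on a graph: a cyclic ordering of the darts leaving each vertex.
This is the combinatorial description of an embedding in an oriented closed surface. -/
structure RotationSystem {V : Type*} (G : SimpleGraph V) where
  rot : Equiv.Perm G.Dart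
  fst_rot : ∀ d, (rot d).fst = d.fst
  sameCycle : ∀ d e : G.Dart, d.fst = e.fst → rot.SameCycle d e

namespace RotationSystem

variable {V : Type*} {G : SimpleGraph V}

/-- The face permutation: reverse the dart, then turn to the next dart at its vertex. -/
def facePerm (M : RotationSystem G) : Equiv.Perm G.Dart :=
  (Equiv.mk SimpleGraph.Dart.symm SimpleGraph.Dart.symm
    SimpleGraph.Dart.symm_symm SimpleGraph.Dart.symm_symm).trans M.rot

/-- The faces are the cycles of the face permutation. -/
def Face (M : RotationSystem G) : Type _ :=
  Quotient (Equiv.Perm.SameCycle.setoid M.facePerm)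

/-- The face to which a dart belongs. -/
def faceOf (M : RotationSystem G) (d : G.Dart) : M.Face :=
  Quotient.mk _ d

/-- The vertex `w` lies on the boundary of the face `f`. -/
def Incident (M : RotationSystem G) (f : M.Face) (w : V) : Prop :=
  ∃ d : G.Dart, d.fst = w ∧ M.faceOf d = f

/-- The surface of the embedding of a connected graph is a sphere: Euler's formula
`|V| + |F| = |E| + 2`. -/
def IsPlanar (M : RotationSystem G) : Prop :=
  G.Connected ∧ Nat.card V + Nat.card M.Face = Nat.card G.edgeSet + 2

open Classical in
/-- The face-vertex incidence matrix over `𝔽₂`. -/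
def incidenceMatrix (M : RotationSystem G) : Matrix M.Face V (ZMod 2) :=
  fun f w => if M.Incident f w then 1 else 0

end RotationSystem

/-- The binary code generated by the rows of the face-vertex incidence matrix. -/
def faceCode {n : ℕ} {G : SimpleGraph (Fin n)} (M : RotationSystem G) : BinaryCode n :=
  Submodule.span (ZMod 2) (Set.range M.incidenceMatrix)

/-- The neighbour after `w` in the cyclic list `l 0, l 1, l 2`. -/
def nextOf {V : Type*} [DecidableEq V] (l : Fin 3 → V) (w : V) : V :=
  if w = l 0 then l 1 else if w = l 1 then l 2 else l 0

/-- The rotation system of a cubic graph in which the neighbours of `w` appear in the cyclic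
order `nb w 0, nb w 1, nb w 2`. -/
def cubicRotation {V : Type*} [DecidableEq V] (G : SimpleGraph V) (nb : V → Fin 3 → V)
    (hadj : ∀ x y, G.Adj x y ↔ y = nb x 0 ∨ y = nb x 1 ∨ y = nb x 2)
    (hne : ∀ x, nb x 0 ≠ nb x 1 ∧ nb x 0 ≠ nb x 2 ∧ nb x 1 ≠ nb x 2) :
    RotationSystem G :=
  have hnext : ∀ x y, G.Adj x (nextOf (nb x) y) := by
    intro x y
    rw [hadj]
    unfold nextOf
    split_ifs <;> simp
  have hthree : ∀ x y, G.Adj x y →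
      nextOf (nb x) (nextOf (nb x) (nextOf (nb x) y)) = y := by
    intro x y h
    obtain ⟨h1, h2, h3⟩ := hne x
    rcases (hadj x y).1 h with rfl | rfl | rfl <;>
      simp [nextOf, h1.symm, h2.symm, h3.symm]
  have hdart : ∀ d e : G.Dart, d.fst = e.fst → d.snd = e.snd → d = e := by
    intro d e h1 h2
    exact SimpleGraph.Dart.ext _ _ (Prod.ext h1 h2)
  let step : G.Dart → G.Dart := fun d => ⟨(d.fst, nextOf (nb d.fst) d.snd), hnext _ _⟩
  have hstep : ∀ d, step (step (step d)) = d := fun d =>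
    hdart _ _ rfl (hthree d.fst d.snd d.adj)
  { rot := ⟨step, fun d => step (step d), hstep, hstep⟩
    fst_rot := fun _ => rfl
    sameCycle := by
      intro d e h
      have key : e = d ∨ e = step d ∨ e = step (step d) := by
        obtain ⟨h1, h2, h3⟩ := hne d.fst
        have hd := (hadj _ _).1 d.adj
        have he := (hadj _ _).1 e.adj
        rw [← h] at he
        have he' : e.snd = d.snd ∨ e.snd = nextOf (nb d.fst) d.snd ∨
            e.snd = nextOf (nb d.fst) (nextOf (nb d.fst) d.snd) := by
          rcases hd with hd | hd | hd <;> rcases he with he | he | he <;>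
            simp [hd, he, nextOf, h1.symm, h2.symm, h3.symm]
        rcases he' with he' | he' | he'
        · exact Or.inl (hdart _ _ h.symm he')
        · exact Or.inr (Or.inl (hdart _ _ h.symm he'))
        · exact Or.inr (Or.inr (hdart _ _ h.symm he'))
      rcases key with rfl | rfl | rfl
      · exact ⟨0, rfl⟩
      · exact ⟨1, rfl⟩
      · exact ⟨2, rfl⟩ }

/-! ### The two graphs on `16` vertices

The vertex `v_{i+1}` of a drawing is `i : Fin 16`. -/

/-- The simple graph with the given list of (loopless) edges. -/
def graphOf (l : List (Fin 16 × Fin 16)) : SimpleGraph (Fin 16) where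
  Adj x y := x ≠ y ∧ ((x, y) ∈ l ∨ (y, x) ∈ l)
  symm := ⟨fun _ _ h => ⟨h.1.symm, h.2.symm⟩⟩
  loopless := ⟨fun _ h => h.1 rfl⟩

instance (l : List (Fin 16 × Fin 16)) : DecidableRel (graphOf l).Adj :=
  fun x y => inferInstanceAs (Decidable (x ≠ y ∧ ((x, y) ∈ l ∨ (y, x) ∈ l)))

/-- Two nested cycles of length `8` joined by spokes (the octagonal prism). -/
def G₁ : SimpleGraph (Fin 16) := graphOf
  [(0, 1), (1, 2), (2, 3), (3, 4), (4, 5), (5, 6), (6, 7), (7, 0),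
   (8, 9), (9, 10), (10, 11), (11, 12), (12, 13), (13, 14), (14, 15), (15, 8),
   (0, 8), (1, 9), (2, 10), (3, 11), (4, 12), (5, 13), (6, 14), (7, 15)]

/-- Counterclockwise order of the neighbours of each vertex in the planar drawing of `G₁`. -/
def nb₁ : Fin 16 → Fin 3 → Fin 16 :=
  ![![1, 8, 7], ![2, 9, 0], ![3, 10, 1], ![4, 11, 2],
    ![5, 12, 3], ![4, 6, 13], ![5, 7, 14], ![15, 6, 0],
    ![9, 15, 0], ![10, 8, 1], ![11, 9, 2], ![3, 12, 10],
    ![4, 13, 11], ![12, 5, 14], ![13, 6, 15], ![14, 7, 8]]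

def G₂ : SimpleGraph (Fin 16) := graphOf
  [(0, 1), (1, 2), (2, 3), (3, 4), (4, 5), (4, 7), (5, 0), (6, 7),
   (6, 8), (6, 5), (0, 8), (8, 9), (1, 9), (9, 10), (10, 11), (11, 12),
   (12, 2), (12, 13), (3, 13), (10, 15), (14, 15), (11, 14), (13, 14), (7, 15)]

/-- Counterclockwise order of the neighbours of each vertex in the planar drawing of `G₂`. -/
def nb₂ : Fin 16 → Fin 3 → Fin 16 :=
  ![![1, 5, 8], ![2, 0, 9], ![12, 3, 1], ![13, 4, 2],
    ![3, 7, 5], ![4, 6, 0], ![5, 7, 8], ![15, 6, 4],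
    ![9, 0, 6], ![10, 1, 8], ![15, 11, 9], ![14, 12, 10],
    ![13, 2, 11], ![3, 12, 14], ![13, 11, 15], ![7, 14, 10]]

instance : DecidableRel G₁.Adj := inferInstanceAs (DecidableRel (graphOf _).Adj)

instance : DecidableRel G₂.Adj := inferInstanceAs (DecidableRel (graphOf _).Adj)

set_option maxRecDepth 4000 in
/-- The planar drawing of `G₁`. -/
def M₁ : RotationSystem G₁ := cubicRotation G₁ nb₁ (by decide) (by decide)

set_option maxRecDepth 4000 in
/-- The planar drawing of `G₂`. -/
def M₂ : RotationSystem G₂ := cubicRotation G₂ nb₂ (by decide) (by decide)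

/-- A connected bicubic planar graph, with its planar embedding `M`. -/
def IsBicubicPlanar {n : ℕ} {G : SimpleGraph (Fin n)} [DecidableRel G.Adj]
    (M : RotationSystem G) : Prop :=
  G.Connected ∧ G.IsRegularOfDegree 3 ∧ G.IsBipartite ∧ M.IsPlanar

/-! ### The parameters -/

/-- The new values of `β` in the first family. -/
def newBeta₁ : Finset ℕ := {16, 20, 24, 26, 28, 30, 34, 38}

/-- The new values of `β` in the second family. -/
def newBeta₂ : Finset ℕ := {3, 7, 11, 15, 26, 27, 35}

/-- The values of `β` in the first family for which codes were known before. -/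
def oldBeta₁ : Finset ℕ :=
  {14, 18, 22, 25, 29, 32, 36, 39, 44, 46, 53, 59, 60, 64, 74}

/-- The values of `β` in the second family for which codes were known before. -/
def oldBeta₂ : Finset ℕ :=
  {0, 1, 2, 4, 5, 6, 8, 9, 10, 12, 13, 14, 16, 17, 18, 20, 21, 22, 23, 24, 25, 28, 29, 30,
   32, 33, 36, 37, 38, 40, 41, 44, 48, 51, 52, 56, 58, 64, 72, 80, 88, 96, 104, 108, 112,
   114, 118, 120, 184}

/-- All values of `β` in the first family. -/
def allBeta₁ : Finset ℕ := oldBeta₁ ∪ newBeta₁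

/-- All values of `β` in the second family. -/
def allBeta₂ : Finset ℕ := oldBeta₂ ∪ newBeta₂

end GraphCodes

end

open GraphCodes

/-! All existence claims are settled by explicit codes, so the substance is a way to certify the low
weights of a code with 2^32 words.

Every code of length 64 is given in systematic form: its words are the pairs (x, xB), placed on two
complementary sets of 32 coordinates, for an orthogonal 32 × 32 matrix B over 𝔽₂. Orthogonality
makes the code self-dual (`isSelfDual_sysCode`), and it also makes the two halves play symmetric
roles, since y = xB gives x = yBᵀ. A word of weight w ≤ 14 has weight at most 7 on the left half or
at most 6 on the right half. Hence the counts up to weight 14 only involve sums of at most 7 rows of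
B and of at most 6 rows of Bᵀ, some 5.7 million sums (`weightCount_eq_sum`). Odd weights cannot
occur in a self-dual code. If no word has weight 2, 4, ..., 10 and there are words of weights 12 and
14, then the minimum distance is 12, the code is not doubly-even, and the prescribed coefficients
below degree 16 are known (`isExtremalTypeI64_of_checkCode`, `coeff_of_checkCode`).

The sums are handled all at once by bit slicing. For fixed k each k-element sum of rows owns one
lane, and bit j of all these sums is packed into a single natural number, a plane. Pascal's
recursion builds the planes (`plane_cons_succ`), binary counters made of planes add up the columns
to give the weight in every lane (`counters_represents`), and the lanes showing a given weight are
masked and counted by repeated halving (`laneSum_eq`). Thus a few thousand operations on very long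
numbers replace millions of separate weights.

For the lifts, R₂ is the group algebra over 𝔽₂ of the Klein four-group {1, 1+u, 1+v, (1+u)(1+v)},
and the Gray map lists the coordinates in this group basis. Multiplication by 1+u and 1+v permutes
the four blocks of the Gray image, so the Gray images of R₂-codes are exactly the binary codes
invariant under these permutations (`grayImage_grayPreimage`). The dot product of Gray images is the
coefficient of 1 in the R₂-product, a nondegenerate form, so the Gray map commutes with duality
(`gray_mem_dual_iff`). The projection π is the augmentation, that is, the sum of the four blocks. A
matrix B made of 4 × 4 blocks invariant under the group therefore yields a self-dual R₂-code that
lifts the systematic code whose matrix consists of the block row sums (`isLift_sysLift`).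

For the two graphs a numbering of the darts by faces, checked against the face permutation,
identifies the faces. Planarity is then Euler's formula, and the face code is brought to systematic
form (`span_eq_sysCode`), where its 256 words can be examined. -/

namespace BitSlice

/-! ### Forcing kernel evaluation

The kernel evaluates lazily; `force x k` is `k x`, but reducing it first evaluates `x` to a
literal. -/

noncomputable def force {α : Type} (x : ℕ) (k : ℕ → α) : α :=
  -- The recursor needs its argument as a numeral before it can choose a branch. Adding one makes
  -- this the successor branch always, which hands back `x` itself; the value `k 0` is never
  -- reached.
  Nat.rec (k 0) (fun n _ => k n) (Nat.add x 1)

noncomputable def forceList {α : Type} (l : List ℕ) : (List ℕ → α) → α :=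
  List.rec (fun k => k []) (fun a _ ih k => force a fun a' => ih fun as => k (a' :: as)) l

theorem forceList_eq {α : Type} (l : List ℕ) (k : List ℕ → α) : forceList l k = k l := by
  induction l generalizing k with
  | nil => rfl
  | cons a l ih => exact ih fun as => k (a :: as)

noncomputable def forceLists {α : Type} (l : List (List ℕ)) : (List (List ℕ) → α) → α :=
  List.rec (fun k => k [])
    (fun a _ ih k => forceList a fun a' => ih fun as => k (a' :: as)) l

theorem forceLists_eq {α : Type} (l : List (List ℕ)) (k : List (List ℕ) → α) :
    forceLists l k = k l := by
  induction l generalizing k with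
  | nil => rfl
  | cons a l ih =>
    change forceList a _ = _
    rw [forceList_eq]
    exact ih fun as => k (a :: as)

/-! ### Bit vectors packed into natural numbers -/

/-- The natural number whose binary digits, lowest first, are the given bits. -/
def pack : List Bool → ℕ
  | [] => 0
  | b :: l => Nat.bit b (pack l)

theorem testBit_pack (l : List Bool) (i : ℕ) : (pack l).testBit i = l.getD i false := by
  induction l generalizing i with
  | nil => simp [pack]
  | cons b l ih =>
    cases i with
    | zero => simp [pack]
    | succ i => simp [pack, Nat.testBit_bit_succ, ih]

theorem pack_append (l m : List Bool) : pack (l ++ m) = pack l + pack m <<< l.length := by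
  induction l with
  | nil => simp [pack]
  | cons b l ih =>
    simp only [List.cons_append, pack, ih, List.length_cons, Nat.shiftLeft_eq, Nat.bit_val,
      pow_succ]
    ring

/-- The packed values of a predicate along a list of lanes. -/
def lanes {σ : Type} (S : List σ) (f : σ → Bool) : ℕ := pack (S.map f)

theorem testBit_lanes {σ : Type} (S : List σ) (f : σ → Bool) (i : ℕ) :
    (lanes S f).testBit i = (S[i]?.map f).getD false := by
  simp [lanes, testBit_pack, List.getD_eq_getElem?_getD]

theorem lanes_xor {σ : Type} (S : List σ) (f g : σ → Bool) :
    lanes S f ^^^ lanes S g = lanes S fun s => f s ^^ g s := by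
  refine Nat.eq_of_testBit_eq fun i => ?_
  rw [Nat.testBit_xor, testBit_lanes, testBit_lanes, testBit_lanes]
  cases S[i]? <;> simp

theorem lanes_and {σ : Type} (S : List σ) (f g : σ → Bool) :
    lanes S f &&& lanes S g = lanes S fun s => f s && g s := by
  refine Nat.eq_of_testBit_eq fun i => ?_
  rw [Nat.testBit_and, testBit_lanes, testBit_lanes, testBit_lanes]
  cases S[i]? <;> simp

theorem lanes_true {σ : Type} (S : List σ) : lanes S (fun _ => true) = 2 ^ S.length - 1 := by
  refine Nat.eq_of_testBit_eq fun i => ?_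
  rw [Nat.testBit_two_pow_sub_one, testBit_lanes]
  by_cases h : i < S.length <;> simp [h]

theorem lanes_false {σ : Type} (S : List σ) : lanes S (fun _ => false) = 0 := by
  refine Nat.eq_of_testBit_eq fun i => ?_
  rw [testBit_lanes]
  cases S[i]? <;> simp

theorem lanes_eq_zero {σ : Type} {S : List σ} {f : σ → Bool} (h : lanes S f = 0) :
    ∀ s ∈ S, f s = false := by
  intro s hs
  obtain ⟨i, hi, rfl⟩ := List.mem_iff_getElem.1 hs
  have := testBit_lanes S f i
  rw [h] at this
  simpa [hi] using this.symm

theorem lanes_congr {σ : Type} {S : List σ} {f g : σ → Bool} (h : ∀ s ∈ S, f s = g s) :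
    lanes S f = lanes S g := by
  rw [lanes, lanes, List.map_congr_left h]

/-- Appending lists of lanes is a shift and an addition. This is what turns the recursion for
sublists into arithmetic on planes. -/
theorem lanes_append_map {σ : Type} (S T : List σ) (c : σ → σ) (f : σ → Bool) :
    lanes (S ++ T.map c) f = lanes S f + lanes T (f ∘ c) <<< S.length := by
  simp [lanes, pack_append]

/-! ### The planes of all `k`-element sums of a list of rows -/

/-- The bitwise sum of a list of rows. -/
def xorSum (s : List ℕ) : ℕ := s.foldr (· ^^^ ·) 0

theorem xorSum_cons (r : ℕ) (s : List ℕ) : xorSum (r :: s) = r ^^^ xorSum s := rfl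

/-- The plane of bit `j` of the sums of all `k`-element sublists of `rows`. -/
def plane (rows : List ℕ) (j k : ℕ) : ℕ :=
  lanes (rows.sublistsLen k) fun s => (xorSum s).testBit j

/-- `N` is the number of lanes of `V`. It has to be supplied because a number does not record its
leading zeros, which complementation turns into ones. -/
noncomputable def flipIf (b N V : ℕ) : ℕ :=
  Bool.rec (Nat.xor V (Nat.sub (Nat.pow 2 N) 1)) V (Nat.beq b 0)

/-- One step of Pascal's recursion for all sizes at once. `b` is the bit of the new row, `Ns` and
`Vs` hold the lane numbers and planes of the sums without it for the sizes still to be treated, and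
`Np`, `Vp` are the lane number and plane of the size just below. -/
noncomputable def extend (b : ℕ) (Ns : List ℕ) : List ℕ → ℕ → ℕ → List ℕ :=
  List.rec (fun _ _ _ => [])
    (fun N _ ih Vs Np Vp =>
      List.rec []
        (fun V Vs' _ =>
          force (Nat.add V (Nat.shiftLeft (flipIf b Np Vp) N)) fun W => W :: ih Vs' N V) Vs) Ns

/-- From the bits of a column, the planes of all `k`-element sums, for `1 ≤ k ≤ start.length`. -/
noncomputable def planeTable (start : List ℕ) (layers : List (List ℕ)) : List ℕ → List ℕ :=
  List.rec (fun _ => start)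
    (fun Ns _ ih bs => List.rec [] (fun b bs' _ => extend b Ns (ih bs') 1 0) bs) layers

noncomputable def bitsAt (rows : List ℕ) (j : ℕ) : List ℕ :=
  List.rec [] (fun r _ ih => Nat.land (Nat.shiftRight r j) 1 :: ih) rows

/-- The binomial coefficients `choose m k`, `1 ≤ k ≤ K`, for `m = n - 1, …, 0`. -/
def binomials (K : ℕ) : ℕ → List (List ℕ)
  | 0 => []
  | n + 1 => (List.range' 1 K).map (Nat.choose n) :: binomials K n

theorem land_shiftRight_one_beq (r j : ℕ) :
    Nat.beq (Nat.land (Nat.shiftRight r j) 1) 0 = !r.testBit j := by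
  have : Nat.land (Nat.shiftRight r j) 1 = (r.testBit j).toNat := by
    change (r >>> j) &&& 1 = _
    rw [Nat.and_one_is_mod, Nat.toNat_testBit, Nat.shiftRight_eq_div_pow]
  rw [this]
  cases r.testBit j <;> rfl

theorem flipIf_plane (r j k : ℕ) (rows : List ℕ) :
    flipIf (Nat.land (Nat.shiftRight r j) 1) (rows.length.choose k) (plane rows j k) =
      lanes (rows.sublistsLen k) ((fun s => (xorSum s).testBit j) ∘ List.cons r) := by
  unfold flipIf
  rw [land_shiftRight_one_beq]
  cases h : r.testBit j
  · refine lanes_congr fun s _ => ?_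
    simp [xorSum_cons, h]
  · change plane rows j k ^^^ (2 ^ (rows.length.choose k) - 1) = _
    rw [← List.length_sublistsLen, ← lanes_true, plane, lanes_xor]
    refine lanes_congr fun s _ => ?_
    simp [xorSum_cons, h]

/-- A (k+1)-element sublist of `r :: rows` either omits `r` or consists of `r` and a k-element
sublist of `rows`. In the second case adding `r` flips bit j in all lanes or in none. -/
theorem plane_cons_succ (r j k : ℕ) (rows : List ℕ) :
    plane (r :: rows) j (k + 1) = plane rows j (k + 1) +
      (flipIf (Nat.land (Nat.shiftRight r j) 1) (rows.length.choose k) (plane rows j k)) <<<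
        rows.length.choose (k + 1) := by
  rw [flipIf_plane, plane, List.sublistsLen_succ_cons, lanes_append_map, List.length_sublistsLen]
  rfl

/-- The surplus `d` lets the list of binomial coefficients be longer than the list of planes, so
that one table serves the sums of at most 7 rows and those of at most 6. -/
theorem extend_plane (r j : ℕ) (rows : List ℕ) (m d k : ℕ) :
    extend (Nat.land (Nat.shiftRight r j) 1)
      ((List.range' (k + 1) (m + d)).map (Nat.choose rows.length))
      ((List.range' (k + 1) m).map (plane rows j)) (rows.length.choose k) (plane rows j k) =
      (List.range' (k + 1) m).map (plane (r :: rows) j) := by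
  induction m generalizing k with
  | zero => cases d <;> rfl
  | succ m ih =>
    rw [show m + 1 + d = (m + d) + 1 by omega]
    simp only [List.range'_succ, List.map_cons]
    rw [plane_cons_succ, ← ih (k + 1)]
    rfl

theorem plane_zero (rows : List ℕ) (j : ℕ) : plane rows j 0 = 0 := by
  simp [plane, lanes, pack, xorSum]

theorem planeTable_eq (K d j : ℕ) (rows : List ℕ) :
    planeTable (List.replicate K 0) (binomials (K + d) rows.length) (bitsAt rows j) =
      (List.range' 1 K).map (plane rows j) := by
  induction rows with
  | nil =>
    change List.replicate K 0 = _
    symm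
    rw [List.eq_replicate_iff]
    refine ⟨by simp, fun b hb => ?_⟩
    obtain ⟨k, hk, rfl⟩ := List.mem_map.1 hb
    obtain ⟨k, rfl⟩ : ∃ m, k = m + 1 := ⟨k - 1, by have := List.mem_range'_1.1 hk; omega⟩
    simp [plane, lanes, pack]
  | cons r rows ih =>
    have := extend_plane r j rows K d 0
    -- Size zero has one lane, the empty sum, whose plane is 0. These are the initial arguments `1`
    -- and `0` of `extend` in `planeTable`.
    rw [Nat.choose_zero_right, plane_zero, ← ih] at this
    exact this

/-! ### Bit-sliced counters -/

/-- The number represented in lane `s` by the planes `fs`. -/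
def value {σ : Type} : List (σ → Bool) → σ → ℕ
  | [], _ => 0
  | f :: fs, s => (f s).toNat + 2 * value fs s

/-- The planes `cs` hold the number `w s` in each lane `s`. -/
def Represents {σ : Type} (S : List σ) (cs : List ℕ) (w : σ → ℕ) : Prop :=
  ∃ fs : List (σ → Bool), cs = fs.map (lanes S) ∧ ∀ s ∈ S, value fs s = w s

/-- Add a plane to a bit-sliced counter. -/
noncomputable def incr (cs : List ℕ) : ℕ → List ℕ :=
  -- A carry out of the top plane opens a new plane, unless it vanishes in every lane. Counters
  -- therefore start as empty lists and grow only when needed.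
  List.rec (fun x => Bool.rec [x] [] (Nat.beq x 0))
    (fun c _ ih x => Nat.xor c x :: force (Nat.land c x) ih) cs

/-- A half adder in every lane: f + x = (f xor x) + 2 (f and x), where the conjunction is passed on
as the carry. -/
theorem incr_represents {σ : Type} (S : List σ) (fs : List (σ → Bool)) (x : σ → Bool) :
    Represents S (incr (fs.map (lanes S)) (lanes S x)) fun s => value fs s + (x s).toNat := by
  induction fs generalizing x with
  | nil =>
    change Represents S (Bool.rec [lanes S x] [] (Nat.beq (lanes S x) 0)) _
    cases h : Nat.beq (lanes S x) 0
    · exact ⟨[x], rfl, fun s _ => by simp [value]⟩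
    · refine ⟨[], rfl, fun s hs => ?_⟩
      simp [value, lanes_eq_zero (Nat.eq_of_beq_eq_true h) s hs]
  | cons f fs ih =>
    obtain ⟨gs, hgs, hv⟩ := ih fun s => f s && x s
    refine ⟨(fun s => f s ^^ x s) :: gs, ?_, fun s hs => ?_⟩
    · rw [List.map_cons, List.map_cons, ← hgs, ← lanes_xor, ← lanes_and]
      rfl
    · simp only [value, hv s hs]
      cases f s <;> cases x s <;> simp <;> ring

theorem Represents.incr {σ : Type} {S : List σ} {cs : List ℕ} {w : σ → ℕ}
    (h : Represents S cs w) (x : σ → Bool) :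
    Represents S (BitSlice.incr cs (lanes S x)) fun s => w s + (x s).toNat := by
  obtain ⟨fs, rfl, hv⟩ := h
  obtain ⟨gs, hgs, hw⟩ := incr_represents S fs x
  exact ⟨gs, hgs, fun s hs => by simp only [hw s hs, hv s hs]⟩

noncomputable def incrAll (css : List (List ℕ)) : List ℕ → List (List ℕ) :=
  List.rec (fun _ => [])
    (fun cs _ ih vs => List.rec [] (fun v vs' _ => incr cs v :: ih vs') vs) css

theorem incrAll_eq (css : List (List ℕ)) (vs : List ℕ) :
    incrAll css vs = List.zipWith incr css vs := by
  induction css generalizing vs with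
  | nil => cases vs <;> rfl
  | cons cs css ih =>
    cases vs with
    | nil => rfl
    | cons v vs => exact congrArg (incr cs v :: ·) (ih vs)

/-- Add the planes of the columns `js` to the counters. -/
noncomputable def counters (start : List ℕ) (layers : List (List ℕ)) (rows js : List ℕ) :
    List (List ℕ) → List (List ℕ) :=
  List.rec (fun css => css)
    (fun j _ ih css => forceLists (incrAll css (planeTable start layers (bitsAt rows j))) ih) js

/-- The number of ones of `x` among the bits `js`. -/
def bitCount (js : List ℕ) (x : ℕ) : ℕ := (js.map fun j => (x.testBit j).toNat).sum

/-- The weight of a sum is the number of columns in which it has a one, and each column contributes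
one plane per size k. The initial counters and their values `w` are arbitrary so that the induction
on the columns can move them. -/
theorem counters_represents (K d : ℕ) (rows js : List ℕ) (cs : ℕ → List ℕ) (w : ℕ → List ℕ → ℕ)
    (h : ∀ k, Represents (rows.sublistsLen k) (cs k) (w k)) :
    ∃ cs' : ℕ → List ℕ,
      counters (List.replicate K 0) (binomials (K + d) rows.length) rows js
        ((List.range' 1 K).map cs) = (List.range' 1 K).map cs' ∧
      ∀ k, Represents (rows.sublistsLen k) (cs' k) fun s => w k s + bitCount js (xorSum s) := by
  induction js generalizing cs w with
  | nil => exact ⟨cs, rfl, by simpa [bitCount] using h⟩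
  | cons j js ih =>
    obtain ⟨cs', h1, h2⟩ := ih (fun k => incr (cs k) (plane rows j k)) _ fun k =>
      (h k).incr fun s => (xorSum s).testBit j
    refine ⟨cs', ?_, fun k => ?_⟩
    · rw [← h1]
      change forceLists _ _ = _
      rw [forceLists_eq, planeTable_eq, incrAll_eq, List.zipWith_map, List.zipWith_self]
      rfl
    · simpa [bitCount, add_assoc] using h2 k

/-- The lanes of `acc` in which the counter `cs` shows `t`. -/
noncomputable def mask (cs : List ℕ) : ℕ → ℕ → ℕ :=
  -- When the planes are exhausted, lanes survive only if no bits of the target remain: a target too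
  -- large for the counter occurs in no lane.
  List.rec (fun t acc => Bool.rec 0 acc (Nat.beq t 0))
    (fun c _ ih t acc =>
      force (Bool.rec (Nat.land acc c) (Nat.xor acc (Nat.land acc c))
        (Nat.beq (Nat.land t 1) 0)) (ih (Nat.shiftRight t 1))) cs

/-- The target is compared bit by bit from the lowest: a one in `t` keeps the lanes set in the
plane, a zero keeps the others. Two numbers agree exactly when their lowest bits and their halves
agree. -/
theorem mask_eq {σ : Type} (S : List σ) (fs : List (σ → Bool)) (t : ℕ) (a : σ → Bool) :
    mask (fs.map (lanes S)) t (lanes S a) =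
      lanes S fun s => a s && decide (value fs s = t) := by
  induction fs generalizing t a with
  | nil =>
    change (Bool.rec 0 (lanes S a) (Nat.beq t 0) : ℕ) = _
    cases h : Nat.beq t 0
    · have ht : 0 ≠ t := fun h0 => by subst h0; simp at h
      simp [value, ht, lanes_false]
    · simp [value, Nat.eq_of_beq_eq_true h]
  | cons f fs ih =>
    change mask (fs.map (lanes S)) (t >>> 1) (Bool.rec (lanes S a &&& lanes S f)
      (lanes S a ^^^ (lanes S a &&& lanes S f)) (Nat.beq (Nat.land (Nat.shiftRight t 0) 1) 0)) = _
    rw [land_shiftRight_one_beq, lanes_and, lanes_xor]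
    have ht : t = (t.testBit 0).toNat + 2 * (t >>> 1) := by
      rw [Nat.toNat_testBit, Nat.shiftRight_eq_div_pow]
      omega
    cases h : t.testBit 0
    · change mask _ _ (lanes S _) = _
      rw [ih]
      refine lanes_congr fun s _ => ?_
      rw [value]
      rw [h] at ht
      have : (f s).toNat + 2 * value fs s = t ↔ f s = false ∧ value fs s = t >>> 1 := by
        cases f s <;> simp at ht ⊢ <;> omega
      simp only [this]
      cases a s <;> cases f s <;> simp
    · change mask _ _ (lanes S _) = _
      rw [ih]
      refine lanes_congr fun s _ => ?_
      rw [value]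
      rw [h] at ht
      have : (f s).toNat + 2 * value fs s = t ↔ f s = true ∧ value fs s = t >>> 1 := by
        cases f s <;> simp at ht ⊢ <;> omega
      simp only [this]
      cases a s <;> cases f s <;> simp

/-! ### Counting ones -/

/-- The number represented by the planes `ps` in lane `i`. -/
def laneValue : List ℕ → ℕ → ℕ
  | [], _ => 0
  | p :: ps, i => (p.testBit i).toNat + 2 * laneValue ps i

/-- Lanewise addition of two numbers given by planes, where `c` is the plane of incoming carries.
The list of planes grows by one only if the last carry is nonzero in some lane. -/
noncomputable def rippleAdd (as : List ℕ) : List ℕ → ℕ → List ℕ :=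
  List.rec (fun _ c => Bool.rec [c] [] (Nat.beq c 0))
    (fun a _ ih bs c =>
      List.rec []
        (fun b bs' _ =>
          force (Nat.xor a b) fun x =>
            -- The outgoing carry is the majority of `a`, `b`, `c`, written as ab + c(a + b) modulo
            -- 2.
            force (Nat.xor (Nat.land a b) (Nat.land c x)) fun c' => Nat.xor x c :: ih bs' c')
        bs) as

theorem laneValue_rippleAdd (as bs : List ℕ) (c i : ℕ) (h : as.length = bs.length) :
    laneValue (rippleAdd as bs c) i =
      laneValue as i + laneValue bs i + (c.testBit i).toNat := by
  induction as generalizing bs c with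
  | nil =>
    cases bs with
    | cons b bs => simp at h
    | nil =>
      change laneValue (Bool.rec [c] [] (Nat.beq c 0)) i = _
      cases hc : Nat.beq c 0
      · simp [laneValue]
      · simp [laneValue, Nat.eq_of_beq_eq_true hc]
  | cons a as ih =>
    cases bs with
    | nil => simp at h
    | cons b bs =>
      change laneValue (((a ^^^ b) ^^^ c) ::
        rippleAdd as bs ((a &&& b) ^^^ (c &&& (a ^^^ b)))) i = _
      simp only [laneValue]
      rw [ih bs _ (by simpa using h)]
      simp only [Nat.testBit_xor, Nat.testBit_and]
      cases a.testBit i <;> cases b.testBit i <;> cases c.testBit i <;> simp <;> ring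

noncomputable def mapNat (f : ℕ → ℕ) (l : List ℕ) : List ℕ :=
  List.rec [] (fun a _ ih => f a :: ih) l

theorem mapNat_eq (f : ℕ → ℕ) (l : List ℕ) : mapNat f l = l.map f := by
  induction l with
  | nil => rfl
  | cons a l ih => exact congrArg (f a :: ·) ih

/-- The sum of the numbers represented by the planes `ps` in the lanes below `2 ^ L`. -/
noncomputable def laneSum (L : ℕ) : List ℕ → ℕ :=
  Nat.rec (fun ps => List.rec 0 (fun p _ ih => Nat.add (Nat.land p 1) (Nat.mul 2 ih)) ps)
    (fun L ih ps => forceList ps fun ps =>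
      forceList (mapNat (fun p => Nat.land p (Nat.sub (Nat.pow 2 (Nat.pow 2 L)) 1)) ps) fun lo =>
        forceList (mapNat (fun p => Nat.shiftRight p (Nat.pow 2 L)) ps) fun hi =>
          ih (rippleAdd lo hi 0)) L

/-- The upper half of the lanes is shifted down and added to the lower half lane by lane, which
preserves the total. After `L` such folds a single lane holds the sum. -/
theorem laneSum_eq (L : ℕ) (ps : List ℕ) :
    laneSum L ps = ∑ i ∈ Finset.range (2 ^ L), laneValue ps i := by
  induction L generalizing ps with
  | zero =>
    simp only [pow_zero, Finset.range_one, Finset.sum_singleton]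
    induction ps with
    | nil => rfl
    | cons p ps ih =>
      rw [laneValue, ← ih, Nat.toNat_testBit, pow_zero, Nat.div_one, ← Nat.and_one_is_mod]
      rfl
  | succ L ih =>
    change forceList ps (fun ps => forceList _ fun lo => forceList _ fun hi => _) = _
    rw [forceList_eq, forceList_eq, forceList_eq]
    change laneSum L _ = _
    rw [ih, pow_succ, mul_two, Finset.sum_range_add, ← Finset.sum_add_distrib]
    refine Finset.sum_congr rfl fun i hi => ?_
    rw [laneValue_rippleAdd _ _ _ _ (by simp [mapNat_eq])]
    have hlo : ∀ ps : List ℕ, laneValue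
        (mapNat (fun p => Nat.land p (Nat.sub (Nat.pow 2 (Nat.pow 2 L)) 1)) ps) i =
        laneValue ps i := by
      intro ps
      rw [mapNat_eq]
      induction ps with
      | nil => rfl
      | cons p ps ih' =>
        rw [List.map_cons, laneValue, laneValue, ih']
        congr 2
        change (p &&& (2 ^ 2 ^ L - 1)).testBit i = _
        rw [Nat.testBit_and, Nat.testBit_two_pow_sub_one]
        simp [Finset.mem_range.1 hi]
    have hhi : ∀ ps : List ℕ, laneValue
        (mapNat (fun p => Nat.shiftRight p (Nat.pow 2 L)) ps) i = laneValue ps (2 ^ L + i) := by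
      intro ps
      rw [mapNat_eq]
      induction ps with
      | nil => rfl
      | cons p ps ih' =>
        rw [List.map_cons, laneValue, laneValue, ih']
        congr 2
        exact Nat.testBit_shiftRight ..
    rw [hlo, hhi]
    simp

/-- The number of ones of `x` among the bits below `2 ^ L`. -/
noncomputable def popCount (L x : ℕ) : ℕ := force x fun x => laneSum L [x]

/-- The lanes from `S.length` up to `2 ^ L` are zero and contribute nothing, so any power of two
above the length will do. -/
theorem popCount_lanes {σ : Type} (L : ℕ) (S : List σ) (f : σ → Bool) (h : S.length ≤ 2 ^ L) :
    popCount L (lanes S f) = S.countP f := by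
  have key : ∀ (S : List σ) (n : ℕ), S.length ≤ n →
      ∑ i ∈ Finset.range n, ((S[i]?.map f).getD false).toNat = S.countP f := by
    intro S
    induction S with
    | nil => simp
    | cons a S ih =>
      intro n hn
      obtain ⟨n, rfl⟩ : ∃ m, n = m + 1 := ⟨n - 1, by simp at hn; omega⟩
      rw [Finset.sum_range_succ', List.countP_cons]
      simp only [List.getElem?_cons_succ, List.getElem?_cons_zero, Option.map_some,
        Option.getD_some]
      rw [ih n (by simpa using hn)]
      cases f a <;> simp
  change laneSum L [lanes S f] = _
  rw [laneSum_eq, ← key S _ h]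
  refine Finset.sum_congr rfl fun i _ => ?_
  simp [laneValue, testBit_lanes]

/-! ### The weight histogram of sums of few rows -/

/-- For each counter, with its number `N` of lanes, a bound `2 ^ L` for `N` and a list of
targets `ts`, the numbers of lanes showing the targets. -/
noncomputable def histogram (css : List (List ℕ)) : List (ℕ × ℕ × List ℕ) → List (List ℕ) :=
  List.rec (fun _ => [])
    (fun cs _ ih cfgs => List.rec []
      (fun cfg cfgs' _ =>
        mapNat (fun t => popCount cfg.2.1 (mask cs t (Nat.sub (Nat.pow 2 cfg.1) 1))) cfg.2.2 ::
          ih cfgs') cfgs) css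

/-- The number of `k`-element sublists of `rows` whose sum has weight `t` on the bits `js`. -/
def sumCount (rows js : List ℕ) (k t : ℕ) : ℕ :=
  (rows.sublistsLen k).countP fun s => bitCount js (xorSum s) = t

theorem popCount_mask (rows js : List ℕ) (cs : List ℕ) (k t L : ℕ)
    (h : Represents (rows.sublistsLen k) cs fun s => bitCount js (xorSum s))
    (hL : rows.length.choose k ≤ 2 ^ L) :
    popCount L (mask cs t (Nat.sub (Nat.pow 2 (rows.length.choose k)) 1)) =
      sumCount rows js k t := by
  obtain ⟨fs, rfl, hv⟩ := h
  -- The initial mask has ones in exactly the binomially many lanes in use. Without this bound, a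
  -- search for the value 0 would also report the unused lanes.
  have h2 : Nat.sub (Nat.pow 2 (rows.length.choose k)) 1 =
      lanes (rows.sublistsLen k) fun _ => true := by
    rw [lanes_true, List.length_sublistsLen]
    rfl
  rw [h2, mask_eq, popCount_lanes _ _ _ (by rwa [List.length_sublistsLen])]
  refine List.countP_congr fun s hs => ?_
  simp [hv s hs]

theorem histogram_eq (rows js : List ℕ) (cs : ℕ → List ℕ) (N L : ℕ → ℕ) (ts : ℕ → List ℕ)
    (h : ∀ k, Represents (rows.sublistsLen k) (cs k) fun s => bitCount js (xorSum s))
    (ks : List ℕ) (hN : ∀ k ∈ ks, rows.length.choose k = N k)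
    (hL : ∀ k ∈ ks, N k ≤ 2 ^ L k) :
    histogram (ks.map cs) (ks.map fun k => (N k, L k, ts k)) =
      ks.map fun k => (ts k).map (sumCount rows js k) := by
  induction ks with
  | nil => rfl
  | cons k ks ih =>
    rw [List.map_cons, List.map_cons, List.map_cons,
      ← ih (fun k hk => hN k (by simp [hk])) (fun k hk => hL k (by simp [hk]))]
    change mapNat _ _ :: _ = _
    rw [mapNat_eq]
    congr 1
    refine List.map_congr_left fun t _ => ?_
    have hk := hN k (by simp)
    simp only [← hk]
    exact popCount_mask rows js _ k t _ (h k) (hk ▸ hL k (by simp))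

end BitSlice

namespace GraphCodes

/-! ### Systematic codes -/

section Systematic

variable {n m : ℕ}

/-- The code of all words `c` whose part on the coordinates `r` is the product of the part on
the coordinates `l` with the matrix `B`. -/
def sysCode (l r : Fin m → Fin n) (B : Matrix (Fin m) (Fin m) (ZMod 2)) : BinaryCode n where
  carrier := {c | ∀ j, c (r j) = ∑ i, c (l i) * B i j}
  zero_mem' := by
    intro j
    simp
  add_mem' := by
    intro x y hx hy j
    simp [hx j, hy j, add_mul, Finset.sum_add_distrib]
  smul_mem' := by
    intro a x hx j
    simp [hx j, Finset.mul_sum, mul_assoc]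

theorem mem_sysCode {l r : Fin m → Fin n} {B : Matrix (Fin m) (Fin m) (ZMod 2)}
    {c : Fin n → ZMod 2} : c ∈ sysCode l r B ↔ ∀ j, c (r j) = ∑ i, c (l i) * B i j := Iff.rfl

theorem sum_split {M : Type*} [AddCommMonoid M] {l r : Fin m → Fin n}
    (he : Function.Bijective (Sum.elim l r)) (f : Fin n → M) :
    ∑ t, f t = ∑ i, f (l i) + ∑ j, f (r j) := by
  rw [← Equiv.sum_comp (Equiv.ofBijective _ he) f, Fintype.sum_sum_type]
  rfl

theorem hammingNorm_eq_sum {k : ℕ} (c : Fin k → ZMod 2) :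
    hammingNorm c = ∑ i, if c i ≠ 0 then 1 else 0 := by
  rw [hammingNorm, Finset.card_filter]

theorem hammingNorm_split {l r : Fin m → Fin n} (he : Function.Bijective (Sum.elim l r))
    (c : Fin n → ZMod 2) :
    hammingNorm c = hammingNorm (fun i => c (l i)) + hammingNorm (fun j => c (r j)) := by
  simp only [hammingNorm_eq_sum, sum_split he]

/-- The codeword with information symbols `x`. -/
noncomputable def encode {l r : Fin m → Fin n} (he : Function.Bijective (Sum.elim l r))
    (B : Matrix (Fin m) (Fin m) (ZMod 2)) (x : Fin m → ZMod 2) : Fin n → ZMod 2 :=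
  fun t => Sum.elim x (Matrix.vecMul x B) ((Equiv.ofBijective _ he).symm t)

section Encode

variable {l r : Fin m → Fin n}

theorem encode_left (he : Function.Bijective (Sum.elim l r))
    (B : Matrix (Fin m) (Fin m) (ZMod 2)) (x : Fin m → ZMod 2) (i : Fin m) :
    encode he B x (l i) = x i := by
  have : (Equiv.ofBijective _ he).symm (l i) = Sum.inl i := by
    rw [Equiv.symm_apply_eq]
    rfl
  simp [encode, this]

theorem encode_right (he : Function.Bijective (Sum.elim l r))
    (B : Matrix (Fin m) (Fin m) (ZMod 2)) (x : Fin m → ZMod 2) (j : Fin m) :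
    encode he B x (r j) = Matrix.vecMul x B j := by
  have : (Equiv.ofBijective _ he).symm (r j) = Sum.inr j := by
    rw [Equiv.symm_apply_eq]
    rfl
  simp [encode, this]

theorem encode_mem (he : Function.Bijective (Sum.elim l r))
    (B : Matrix (Fin m) (Fin m) (ZMod 2)) (x : Fin m → ZMod 2) : encode he B x ∈ sysCode l r B := by
  intro j
  simp only [encode_left, encode_right]
  rfl

theorem ext_split {M : Type*} (he : Function.Bijective (Sum.elim l r))
    {c d : Fin n → M} (h1 : ∀ i, c (l i) = d (l i))
    (h2 : ∀ j, c (r j) = d (r j)) : c = d := by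
  funext t
  obtain ⟨s, rfl⟩ := he.2 t
  cases s with
  | inl i => exact h1 i
  | inr j => exact h2 j

theorem eq_encode (he : Function.Bijective (Sum.elim l r))
    (B : Matrix (Fin m) (Fin m) (ZMod 2)) {c : Fin n → ZMod 2} (hc : c ∈ sysCode l r B) :
    c = encode he B fun i => c (l i) := by
  refine ext_split he (fun i => (encode_left he B (fun i => c (l i)) i).symm) fun j => ?_
  rw [encode_right, hc j]
  rfl

theorem finrank_sysCode (he : Function.Bijective (Sum.elim l r))
    (B : Matrix (Fin m) (Fin m) (ZMod 2)) : Module.finrank (ZMod 2) (sysCode l r B) = m := by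
  let f : sysCode l r B ≃ₗ[ZMod 2] (Fin m → ZMod 2) :=
    { toFun := fun c i => c.1 (l i)
      map_add' := fun _ _ => rfl
      map_smul' := fun _ _ => rfl
      invFun := fun x => ⟨encode he B x, encode_mem he B x⟩
      left_inv := fun c => Subtype.ext (eq_encode he B c.2).symm
      right_inv := fun x => funext fun i => encode_left he B x i }
  rw [f.finrank_eq]
  simp

theorem hammingNorm_encode (he : Function.Bijective (Sum.elim l r))
    (B : Matrix (Fin m) (Fin m) (ZMod 2)) (x : Fin m → ZMod 2) :
    hammingNorm (encode he B x) = hammingNorm x + hammingNorm (Matrix.vecMul x B) := by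
  rw [hammingNorm_split he]
  simp only [encode_left, encode_right]

/-- For words (x, xB) and (y, yB) the two halves of the inner product are both x·y, because B
preserves the dot product, and they cancel in characteristic two. Conversely, a dual word is
determined by its right half through orthogonality to the encoded unit vectors, and BᵀB = 1 turns
this into the defining equation of the code. -/
theorem isSelfDual_sysCode (he : Function.Bijective (Sum.elim l r))
    (B : Matrix (Fin m) (Fin m) (ZMod 2)) (hB : B * B.transpose = 1) :
    IsSelfDual (sysCode l r B) := by
  have hB' : B.transpose * B = 1 := mul_eq_one_comm.1 hB
  have h2 : ∀ x : ZMod 2, x + x = 0 := by decide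
  ext c
  constructor
  · intro hc a ha
    rw [sum_split he]
    have h1 : ∑ j, a (r j) * c (r j) = ∑ i, a (l i) * c (l i) := by
      have ha' : (fun j => a (r j)) = Matrix.vecMul (fun i => a (l i)) B := funext ha
      have hc' : (fun j => c (r j)) = Matrix.vecMul (fun i => c (l i)) B := funext hc
      change (fun j => a (r j)) ⬝ᵥ (fun j => c (r j)) = _
      rw [ha', hc', ← Matrix.mulVec_transpose B fun i => c (l i),
        Matrix.dotProduct_mulVec, Matrix.vecMul_vecMul, hB, Matrix.vecMul_one]
      rfl
    rw [h1, h2]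
  · intro hc
    -- Testing `c` against the codeword of the i-th unit vector gives c(l i) + (row i of B)·(right
    -- half) = 0, and signs do not matter.
    have key : (fun i => c (l i)) = Matrix.mulVec B fun j => c (r j) := by
      funext i
      have h := hc _ (encode_mem he B (Pi.single i 1))
      rw [sum_split he] at h
      simp only [encode_left, encode_right] at h
      have e1 : ∑ k, (Pi.single i 1 : Fin m → ZMod 2) k * c (l k) = c (l i) := by
        simp [Pi.single_apply]
      have e2 : ∑ j, Matrix.vecMul (Pi.single i 1) B j * c (r j) =
          Matrix.mulVec B (fun j => c (r j)) i := by
        simp [Matrix.mulVec, dotProduct]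
      rw [e1, e2] at h
      have := congrArg (· + Matrix.mulVec B (fun j => c (r j)) i) h
      simpa [add_assoc, h2] using this
    intro j
    have : (fun j => c (r j)) = Matrix.mulVec B.transpose fun i => c (l i) := by
      rw [key, Matrix.mulVec_mulVec, hB', Matrix.one_mulVec]
    rw [congrFun this j, Matrix.mulVec_transpose]
    rfl

/-! ### Counting codewords by their weight on the information symbols -/

/-- The number of words `x` of weight `k` such that `x B` has weight `t`. -/
def pairCount (B : Matrix (Fin m) (Fin m) (ZMod 2)) (k t : ℕ) : ℕ :=
  (Finset.univ.filter fun x : Fin m → ZMod 2 =>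
    hammingNorm x = k ∧ hammingNorm (Matrix.vecMul x B) = t).card

theorem weightCount_sysCode (he : Function.Bijective (Sum.elim l r))
    (B : Matrix (Fin m) (Fin m) (ZMod 2)) (w : ℕ) :
    weightCount (sysCode l r B) w = (Finset.univ.filter fun x : Fin m → ZMod 2 =>
      hammingNorm x + hammingNorm (Matrix.vecMul x B) = w).card := by
  have hinj : Function.Injective (encode he B) := fun x y h => by
    funext i
    rw [← encode_left he B x, h, encode_left]
  have : {c : Fin n → ZMod 2 | c ∈ sysCode l r B ∧ hammingNorm c = w} =
      Set.image (encode he B) ↑(Finset.univ.filter fun x : Fin m → ZMod 2 =>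
        hammingNorm x + hammingNorm (Matrix.vecMul x B) = w) := by
    ext c
    constructor
    · rintro ⟨hc, hw⟩
      refine ⟨fun i => c (l i), ?_, (eq_encode he B hc).symm⟩
      simp only [Finset.coe_filter, Finset.mem_univ, true_and, Set.mem_ofPred_eq]
      rw [← hammingNorm_encode he, ← eq_encode he B hc, hw]
    · rintro ⟨x, hx, rfl⟩
      refine ⟨encode_mem he B x, ?_⟩
      simpa [hammingNorm_encode] using hx
  rw [weightCount, this, Set.ncard_image_of_injective _ hinj, Set.ncard_coe_finset]

/-- The words are sorted by their left weight k. The bound on `a` forces k ≤ w, so that `w - k` is a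
genuine difference. -/
theorem card_filter_eq_sum_pairCount (B : Matrix (Fin m) (Fin m) (ZMod 2)) (w a : ℕ)
    (ha : a ≤ w + 1) :
    (Finset.univ.filter fun x : Fin m → ZMod 2 =>
      hammingNorm x + hammingNorm (Matrix.vecMul x B) = w ∧ hammingNorm x < a).card =
      ∑ k ∈ Finset.range a, pairCount B k (w - k) := by
  rw [Finset.card_eq_sum_card_fiberwise (f := fun x => hammingNorm x) (t := Finset.range a)]
  · refine Finset.sum_congr rfl fun k hk => ?_
    rw [Finset.mem_range] at hk
    rw [pairCount, Finset.filter_filter]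
    congr 1
    ext x
    simp only [Finset.mem_filter, Finset.mem_univ, true_and]
    omega
  · intro x hx
    simp only [Finset.coe_filter, Finset.mem_univ, true_and, Set.mem_ofPred_eq] at hx
    simpa using hx.2

/-- Words with left weight at most w/2 are counted by that weight. The others have right weight less
than w/2, and x ↦ xB with inverse y ↦ yBᵀ exchanges the halves, so they are counted by their right
weight with Bᵀ in place of B. For even w the balanced words fall in the first sum only; the rounding
in the two ranges sees to this. -/
theorem weightCount_eq_sum (he : Function.Bijective (Sum.elim l r))
    (B : Matrix (Fin m) (Fin m) (ZMod 2)) (hB : B * B.transpose = 1) (w : ℕ) :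
    weightCount (sysCode l r B) w =
      ∑ k ∈ Finset.range (w / 2 + 1), pairCount B k (w - k) +
        ∑ k ∈ Finset.range ((w + 1) / 2), pairCount B.transpose k (w - k) := by
  have hB' : B.transpose * B = 1 := mul_eq_one_comm.1 hB
  rw [weightCount_sysCode he, ← card_filter_eq_sum_pairCount B w _ (by omega),
    ← card_filter_eq_sum_pairCount B.transpose w _ (by omega)]
  have h1 : ∀ x : Fin m → ZMod 2, Matrix.vecMul (Matrix.vecMul x B) B.transpose = x := by
    intro x
    rw [Matrix.vecMul_vecMul, hB, Matrix.vecMul_one]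
  have h2 : ∀ x : Fin m → ZMod 2, Matrix.vecMul (Matrix.vecMul x B.transpose) B = x := by
    intro x
    rw [Matrix.vecMul_vecMul, hB', Matrix.vecMul_one]
  rw [← Finset.card_filter_add_card_filter_not (fun x => hammingNorm x < w / 2 + 1),
    Finset.filter_filter, Finset.filter_filter]
  congr 1
  refine Finset.card_nbij' (fun x => Matrix.vecMul x B) (fun y => Matrix.vecMul y B.transpose)
    ?_ ?_ (fun x _ => h1 x) (fun y _ => h2 y)
  · intro x hx
    simp only [Finset.coe_filter, Finset.mem_univ, true_and, Set.mem_ofPred_eq] at hx ⊢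
    rw [h1]
    omega
  · intro y hy
    simp only [Finset.coe_filter, Finset.mem_univ, true_and, Set.mem_ofPred_eq] at hy ⊢
    rw [h2]
    omega

end Encode

/-- The histograms start at k = 1. This supplies the missing terms with k = 0, which come from the
zero word alone. -/
theorem pairCount_zero_left (B : Matrix (Fin m) (Fin m) (ZMod 2)) {t : ℕ} (ht : t ≠ 0) :
    pairCount B 0 t = 0 := by
  rw [pairCount, Finset.card_eq_zero, Finset.filter_eq_empty_iff]
  rintro x - ⟨h1, h2⟩
  rw [hammingNorm_eq_zero] at h1
  subst h1
  simp at h2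
  omega

end Systematic

/-! ### Matrices given by their rows as binary numbers -/

/-- Bit `i` of `x` as an element of `𝔽₂`. -/
def bitVal (x i : ℕ) : ZMod 2 := if x.testBit i then 1 else 0

theorem bitVal_xor (x y i : ℕ) : bitVal (x ^^^ y) i = bitVal x i + bitVal y i := by
  rw [bitVal, bitVal, bitVal, Nat.testBit_xor]
  cases x.testBit i <;> cases y.testBit i <;> simp
  decide

theorem bitVal_zero (i : ℕ) : bitVal 0 i = 0 := by simp [bitVal]

theorem bitVal_ne_zero (x i : ℕ) : bitVal x i ≠ 0 ↔ x.testBit i = true := by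
  rw [bitVal]
  cases x.testBit i <;> simp

/-- The square matrix whose rows are the binary numbers `rows`. -/
def rowMatrix (m : ℕ) (rows : List ℕ) : Matrix (Fin m) (Fin m) (ZMod 2) :=
  fun i j => bitVal (rows.getD i 0) j

theorem bitVal_xorSum (s : List ℕ) (j : ℕ) :
    bitVal (BitSlice.xorSum s) j = (s.map fun r => bitVal r j).sum := by
  induction s with
  | nil => simp [BitSlice.xorSum, bitVal_zero]
  | cons r s ih => rw [BitSlice.xorSum_cons, bitVal_xor, ih, List.map_cons, List.sum_cons]

theorem bitCount_eq_hammingNorm (m x : ℕ) :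
    BitSlice.bitCount (List.range m) x = hammingNorm fun j : Fin m => bitVal x j := by
  rw [hammingNorm_eq_sum, Fin.sum_univ_eq_sum_range (fun j => if bitVal x j ≠ 0 then 1 else 0) m,
    BitSlice.bitCount]
  change _ = ((List.range m).map _).sum
  congr 1
  refine List.map_congr_left fun j _ => ?_
  simp only [bitVal_ne_zero]
  cases x.testBit j <;> rfl

theorem sublistsLen_map {α β : Type*} (f : α → β) (k : ℕ) (s : List α) :
    (s.map f).sublistsLen k = (s.sublistsLen k).map (List.map f) := by
  induction s generalizing k with
  | nil => cases k <;> simp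
  | cons a s ih =>
    cases k with
    | zero => simp
    | succ k => simp [List.sublistsLen_succ_cons, ih, Function.comp_def]

theorem eq_map_finRange {m : ℕ} {rows : List ℕ} (h : rows.length = m) :
    rows = (List.finRange m).map fun i : Fin m => rows.getD i 0 := by
  subst h
  refine List.ext_getElem (by simp) fun i h1 h2 => ?_
  simp

/-- The indicator of a set of coordinates. -/
def indicator {m : ℕ} (T : Finset (Fin m)) : Fin m → ZMod 2 := fun i => if i ∈ T then 1 else 0

theorem hammingNorm_indicator {m : ℕ} (T : Finset (Fin m)) :
    hammingNorm (indicator T) = T.card := by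
  rw [hammingNorm]
  congr 1
  ext i
  simp [indicator]

theorem indicator_support {m : ℕ} (x : Fin m → ZMod 2) :
    indicator (Finset.univ.filter fun i => x i ≠ 0) = x := by
  have : ∀ a : ZMod 2, (if a ≠ 0 then 1 else 0) = a := by decide
  funext i
  simpa [indicator] using this (x i)

/-- A binary word of weight k is the indicator of a k-element set of row indices, and xB is the sum
of the rows so chosen. Sublists of positions and finite subsets are matched through the k-element
submultisets of the full index set; working with positions keeps equal rows apart. -/
theorem pairCount_rowMatrix {m : ℕ} {rows : List ℕ} (h : rows.length = m) (k t : ℕ) :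
    pairCount (rowMatrix m rows) k t = BitSlice.sumCount rows (List.range m) k t := by
  classical
  let q : Multiset (Fin m) → Prop := fun M =>
    hammingNorm (fun j : Fin m => (M.map fun i => rowMatrix m rows i j).sum) = t
  have h1 : BitSlice.sumCount rows (List.range m) k t =
      Multiset.countP q (Multiset.powersetCard k (Finset.univ : Finset (Fin m)).val) := by
    have hu : (Finset.univ : Finset (Fin m)).val =
        ((List.finRange m : List (Fin m)) : Multiset _) :=
      rfl
    rw [hu, Multiset.powersetCard_coe, Multiset.coe_countP, BitSlice.sumCount]
    conv_lhs => rw [eq_map_finRange h]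
    rw [sublistsLen_map, List.countP_map, List.countP_map]
    refine List.countP_congr fun s _ => ?_
    simp only [Function.comp_apply, decide_eq_true_eq, q]
    rw [bitCount_eq_hammingNorm]
    simp only [bitVal_xorSum, Multiset.map_coe, Multiset.sum_coe, List.map_map]
    rfl
  rw [h1, ← Finset.map_val_val_powersetCard, Multiset.countP_map, pairCount, Finset.card]
  change _ = ((Finset.powersetCard k Finset.univ).filter fun T : Finset (Fin m) => q T.val).card
  refine Finset.card_nbij' (fun x => Finset.univ.filter fun i => x i ≠ 0) indicator ?_ ?_
    (fun x _ => indicator_support x) ?_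
  · intro x hx
    simp only [Finset.coe_filter, Finset.mem_univ, true_and, Set.mem_ofPred_eq] at hx
    simp only [Finset.coe_filter, Finset.mem_powersetCard, Set.mem_ofPred_eq]
    refine ⟨⟨Finset.subset_univ _, hx.1⟩, ?_⟩
    refine Eq.trans ?_ hx.2
    congr 1
    funext j
    change ∑ i ∈ Finset.univ.filter (fun i => x i ≠ 0), rowMatrix m rows i j = _
    conv_rhs => rw [← indicator_support x]
    simp [Matrix.vecMul, dotProduct, indicator, Finset.sum_filter]
  · intro T hT
    simp only [Finset.coe_filter, Finset.mem_powersetCard, Set.mem_ofPred_eq] at hT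
    simp only [Finset.coe_filter, Finset.mem_univ, true_and, Set.mem_ofPred_eq]
    refine ⟨by rw [hammingNorm_indicator, hT.1.2], ?_⟩
    rw [← hT.2]
    congr 1
    funext j
    change _ = ∑ i ∈ T, rowMatrix m rows i j
    simp [Matrix.vecMul, dotProduct, indicator]
  · intro T _
    ext i
    simp [indicator]

section WeightCheck

open BitSlice

/-! ### Orthogonality of a matrix given by its rows -/

/-- Column `j` of the matrix with the given rows, as a binary number. -/
noncomputable def columnOf (rows : List ℕ) (j : ℕ) : ℕ :=
  List.rec 0 (fun r _ ih => Nat.add (Nat.land (Nat.shiftRight r j) 1) (Nat.mul 2 ih)) rows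

theorem testBit_columnOf (rows : List ℕ) (j i : ℕ) :
    (columnOf rows j).testBit i = (rows.getD i 0).testBit j := by
  induction rows generalizing i with
  | nil => simp [columnOf]
  | cons r rows ih =>
    have h : columnOf (r :: rows) j = Nat.bit (r.testBit j) (columnOf rows j) := by
      rw [Nat.bit_val, Nat.toNat_testBit, ← Nat.shiftRight_eq_div_pow, ← Nat.and_one_is_mod,
        add_comm]
      rfl
    cases i with
    | zero => simp [h]
    | succ i => simpa [h, Nat.testBit_bit_succ] using ih i

/-- The sum of those numbers in `cols` that are selected by the bits of `x`. -/
noncomputable def selectSum (cols : List ℕ) : ℕ → ℕ :=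
  List.rec (fun _ => 0)
    (fun c _ ih x => Nat.xor (Nat.mul (Nat.land x 1) c) (ih (Nat.shiftRight x 1))) cols

/-- Summing the members of `cols` selected by the bits of `x` is multiplying the row vector `x` by
the matrix with rows `cols`. -/
theorem bitVal_selectSum (cols : List ℕ) (x i : ℕ) :
    bitVal (selectSum cols x) i =
      ∑ k ∈ Finset.range cols.length, bitVal x k * bitVal (cols.getD k 0) i := by
  induction cols generalizing x with
  | nil => simp [selectSum, bitVal_zero]
  | cons c cols ih =>
    change bitVal (((x &&& 1) * c) ^^^ selectSum cols (x >>> 1)) i = _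
    rw [bitVal_xor, ih, List.length_cons, Finset.sum_range_succ', add_comm]
    congr 1
    · refine Finset.sum_congr rfl fun k _ => ?_
      simp [bitVal, Nat.testBit_shiftRight, add_comm 1 k]
    · rw [Nat.and_one_is_mod]
      have h : x.testBit 0 = decide (x % 2 = 1) := Nat.testBit_zero x
      rcases Nat.mod_two_eq_zero_or_one x with h0 | h0 <;> simp [h0, h, bitVal]

/-- The rows are selected by the columns to the unit vectors `p`, `2 p`, `4 p`, … -/
noncomputable def unitRows (cols rows : List ℕ) : ℕ → Bool :=
  List.rec (fun _ => true)
    (fun r _ ih p => Bool.rec false (force (Nat.mul 2 p) ih) (Nat.beq (selectSum cols r) p)) rows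

theorem selectSum_of_unitRows (cols rows : List ℕ) (p : ℕ) (h : unitRows cols rows p = true)
    (i : ℕ) (hi : i < rows.length) : selectSum cols (rows.getD i 0) = 2 ^ i * p := by
  induction rows generalizing p i with
  | nil => simp at hi
  | cons r rows ih =>
    change (Bool.rec false (unitRows cols rows (2 * p)) (Nat.beq (selectSum cols r) p) : Bool) =
      true at h
    cases hb : Nat.beq (selectSum cols r) p
    · rw [hb] at h
      simp at h
    · rw [hb] at h
      cases i with
      | zero => simpa using Nat.eq_of_beq_eq_true hb
      | succ i =>
        have := ih (2 * p) h i (by simpa using hi)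
        simp only [List.getD_cons_succ, this]
        ring

theorem rowMatrix_columns (m : ℕ) (rows : List ℕ) :
    rowMatrix m ((List.range m).map (columnOf rows)) = (rowMatrix m rows).transpose := by
  ext i j
  simp [rowMatrix, bitVal, Matrix.transpose_apply, testBit_columnOf]

/-- The columns of B are the rows of Bᵀ, so selecting columns by row i of B gives row i of BBᵀ. The
test demands that this be 2^i, the i-th unit vector. -/
theorem mul_transpose_of_unitRows {m : ℕ} {rows : List ℕ} (hm : rows.length = m)
    (h : unitRows ((List.range m).map (columnOf rows)) rows 1 = true) :
    rowMatrix m rows * (rowMatrix m rows).transpose = 1 := by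
  ext i i'
  have h1 := bitVal_selectSum ((List.range m).map (columnOf rows)) (rows.getD i 0) i'
  rw [selectSum_of_unitRows _ _ _ h i (by omega), List.length_map, List.length_range,
    ← Fin.sum_univ_eq_sum_range
      (fun k => bitVal (rows.getD i 0) k *
        bitVal (((List.range m).map (columnOf rows)).getD k 0) i') m] at h1
  rw [Matrix.mul_apply, Matrix.one_apply]
  refine Eq.trans (Finset.sum_congr rfl fun k _ => ?_) (h1.symm.trans ?_)
  · rw [← rowMatrix_columns]
    rfl
  · simp only [mul_one, bitVal, Nat.testBit_two_pow]
    simp [Fin.ext_iff]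

/-! ### Weight enumerators of systematic codes of length `64` -/

/-- This list and the following table are spelled out so that the evaluation of the checks meets
numerals instead of recomputing them for every code. -/
def bitIndices : List ℕ :=
  [0, 1, 2, 3, 4, 5, 6, 7, 8, 9, 10, 11, 12, 13, 14, 15, 16, 17, 18, 19, 20, 21, 22, 23, 24, 25,
    26, 27, 28, 29, 30, 31]

theorem bitIndices_eq : bitIndices = List.range 32 := by decide

def binomialTable : List (List ℕ) :=
  [[31, 465, 4495, 31465, 169911, 736281, 2629575],
    [30, 435, 4060, 27405, 142506, 593775, 2035800],
    [29, 406, 3654, 23751, 118755, 475020, 1560780],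
    [28, 378, 3276, 20475, 98280, 376740, 1184040],
    [27, 351, 2925, 17550, 80730, 296010, 888030],
    [26, 325, 2600, 14950, 65780, 230230, 657800],
    [25, 300, 2300, 12650, 53130, 177100, 480700],
    [24, 276, 2024, 10626, 42504, 134596, 346104],
    [23, 253, 1771, 8855, 33649, 100947, 245157],
    [22, 231, 1540, 7315, 26334, 74613, 170544],
    [21, 210, 1330, 5985, 20349, 54264, 116280],
    [20, 190, 1140, 4845, 15504, 38760, 77520],
    [19, 171, 969, 3876, 11628, 27132, 50388],
    [18, 153, 816, 3060, 8568, 18564, 31824],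
    [17, 136, 680, 2380, 6188, 12376, 19448],
    [16, 120, 560, 1820, 4368, 8008, 11440],
    [15, 105, 455, 1365, 3003, 5005, 6435],
    [14, 91, 364, 1001, 2002, 3003, 3432],
    [13, 78, 286, 715, 1287, 1716, 1716],
    [12, 66, 220, 495, 792, 924, 792],
    [11, 55, 165, 330, 462, 462, 330],
    [10, 45, 120, 210, 252, 210, 120],
    [9, 36, 84, 126, 126, 84, 36],
    [8, 28, 56, 70, 56, 28, 8],
    [7, 21, 35, 35, 21, 7, 1],
    [6, 15, 20, 15, 6, 1, 0],
    [5, 10, 10, 5, 1, 0, 0],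
    [4, 6, 4, 1, 0, 0, 0],
    [3, 3, 1, 0, 0, 0, 0],
    [2, 1, 0, 0, 0, 0, 0],
    [1, 0, 0, 0, 0, 0, 0],
    [0, 0, 0, 0, 0, 0, 0]]

theorem binomialTable_eq : binomialTable = binomials 7 32 := by decide +kernel

/-- For `k = 1, …, 7`: the number of words of weight `k` and length `32`, the binary logarithm
of a bound for it, and the weights completing `k` to `14, 12, …, 2 k`. -/
def leftTargets : List (ℕ × ℕ × List ℕ) :=
  [(32, 5, [13, 11, 9, 7, 5, 3, 1]), (496, 9, [12, 10, 8, 6, 4, 2]), (4960, 13, [11, 9, 7, 5, 3]),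
    (35960, 16, [10, 8, 6, 4]), (201376, 18, [9, 7, 5]), (906192, 20, [8, 6]), (3365856, 22, [7])]

/-- For `k = 1, …, 6`: the number of words of weight `k` and length `32`, the binary logarithm
of a bound for it, and the weights completing `k` to `14, 12, …, 2 k + 2`. -/
def rightTargets : List (ℕ × ℕ × List ℕ) :=
  [(32, 5, [13, 11, 9, 7, 5, 3]), (496, 9, [12, 10, 8, 6, 4]), (4960, 13, [11, 9, 7, 5]),
    (35960, 16, [10, 8, 6]), (201376, 18, [9, 7]), (906192, 20, [8])]

theorem leftTargets_eq : leftTargets = (List.range' 1 7).map fun k =>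
    ([1, 32, 496, 4960, 35960, 201376, 906192, 3365856].getD k 0,
      [0, 5, 9, 13, 16, 18, 20, 22].getD k 0,
      (List.range (8 - k)).map fun i => 14 - 2 * i - k) := by decide

noncomputable def leftHistogram (rows : List ℕ) : List (List ℕ) :=
  histogram (counters [0, 0, 0, 0, 0, 0, 0] binomialTable rows bitIndices
    [[], [], [], [], [], [], []]) leftTargets

theorem rightTargets_eq : rightTargets = (List.range' 1 6).map fun k =>
    ([1, 32, 496, 4960, 35960, 201376, 906192, 3365856].getD k 0,
      [0, 5, 9, 13, 16, 18, 20, 22].getD k 0,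
      (List.range (7 - k)).map fun i => 14 - 2 * i - k) := by decide

noncomputable def rightHistogram (rows : List ℕ) : List (List ℕ) :=
  histogram (counters [0, 0, 0, 0, 0, 0] binomialTable rows bitIndices
    [[], [], [], [], [], []]) rightTargets

theorem targets_spec (ks : List ℕ) (hks : ∀ k ∈ ks, k ≤ 7) :
    (∀ k ∈ ks, Nat.choose 32 k = [1, 32, 496, 4960, 35960, 201376, 906192, 3365856].getD k 0) ∧
    (∀ k ∈ ks, [1, 32, 496, 4960, 35960, 201376, 906192, 3365856].getD k 0 ≤
      2 ^ [0, 5, 9, 13, 16, 18, 20, 22].getD k 0) := by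
  have h : ∀ k ≤ 7, Nat.choose 32 k =
      [1, 32, 496, 4960, 35960, 201376, 906192, 3365856].getD k 0 ∧
      [1, 32, 496, 4960, 35960, 201376, 906192, 3365856].getD k 0 ≤
      2 ^ [0, 5, 9, 13, 16, 18, 20, 22].getD k 0 := by decide +kernel
  exact ⟨fun k hk => (h k (hks k hk)).1, fun k hk => (h k (hks k hk)).2⟩

/-- `K = 7, d = 0` serves the rows and `K = 6, d = 1` the columns; both draw on the same table of
binomial coefficients. The counters start empty, representing 0 in every lane. -/
theorem histogram_counters {rows : List ℕ} (h : rows.length = 32) (K d : ℕ) (hd : K + d = 7)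
    (ts : ℕ → List ℕ) :
    histogram (counters (List.replicate K 0) binomialTable rows bitIndices
      ((List.range' 1 K).map fun _ => []))
      ((List.range' 1 K).map fun k =>
        ([1, 32, 496, 4960, 35960, 201376, 906192, 3365856].getD k 0,
          [0, 5, 9, 13, 16, 18, 20, 22].getD k 0, ts k)) =
      (List.range' 1 K).map fun k => (ts k).map (sumCount rows (List.range 32) k) := by
  obtain ⟨cs, h1, h2⟩ := counters_represents K d rows (List.range 32) (fun _ => []) (fun _ _ => 0)
    fun k => ⟨[], rfl, fun _ _ => rfl⟩
  rw [h] at h1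
  rw [binomialTable_eq, bitIndices_eq, ← hd, h1]
  have hks : ∀ k ∈ List.range' 1 K, k ≤ 7 := fun k hk => by
    have := List.mem_range'_1.1 hk
    omega
  refine histogram_eq rows (List.range 32) cs _ _ ts (by simpa using h2) _ ?_ ?_
  · rw [h]
    exact (targets_spec _ hks).1
  · exact (targets_spec _ hks).2

theorem leftHistogram_eq {rows : List ℕ} (h : rows.length = 32) :
    leftHistogram rows = (List.range' 1 7).map fun k =>
      ((List.range (8 - k)).map fun i => 14 - 2 * i - k).map (sumCount rows (List.range 32) k) := by
  rw [leftHistogram, leftTargets_eq]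
  exact histogram_counters h 7 0 rfl fun k => (List.range (8 - k)).map fun i => 14 - 2 * i - k

theorem rightHistogram_eq {rows : List ℕ} (h : rows.length = 32) :
    rightHistogram rows = (List.range' 1 6).map fun k =>
      ((List.range (7 - k)).map fun i => 14 - 2 * i - k).map (sumCount rows (List.range 32) k) := by
  rw [rightHistogram, rightTargets_eq]
  exact histogram_counters h 6 1 rfl fun k => (List.range (7 - k)).map fun i => 14 - 2 * i - k

/-- The rows `rows` form an orthogonal matrix, and the systematic code defined by them has no
nonzero words of even weight at most `10`, `a₁₂` words of weight `12` and `a₁₄` words of weight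
`14`. -/
noncomputable def checkCode (rows : List ℕ) (a₁₂ a₁₄ : ℕ) : Bool :=
  Nat.beq rows.length 32 && forceList (mapNat (columnOf rows) bitIndices) fun cols =>
    unitRows cols rows 1 && forceLists (leftHistogram rows) fun hl =>
      forceLists (rightHistogram cols) fun hr =>
        -- Index `i` stands for total weight 14 - 2i. In the list for size k this entry is present
        -- only while k is at most 7 - i on the left, or less than 7 - i on the right; the default 0
        -- stands for the sizes that must not contribute.
        ((List.range 7).map fun i =>
          (hl.map fun x => x.getD i 0).sum + (hr.map fun x => x.getD i 0).sum) ==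
            [a₁₄, a₁₂, 0, 0, 0, 0, 0]

variable {rows : List ℕ} {a₁₂ a₁₄ : ℕ}

theorem checkCode_spec (h : checkCode rows a₁₂ a₁₄ = true) :
    rows.length = 32 ∧ rowMatrix 32 rows * (rowMatrix 32 rows).transpose = 1 ∧
    ∀ i < 7, ∑ k ∈ Finset.range (7 - i + 1), pairCount (rowMatrix 32 rows) k (14 - 2 * i - k) +
      ∑ k ∈ Finset.range (7 - i), pairCount (rowMatrix 32 rows).transpose k (14 - 2 * i - k) =
        [a₁₄, a₁₂, 0, 0, 0, 0, 0].getD i 0 := by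
  rw [checkCode, forceList_eq, forceLists_eq, forceLists_eq, mapNat_eq, bitIndices_eq] at h
  simp only [Bool.and_eq_true, beq_iff_eq] at h
  obtain ⟨h1, h2, h3⟩ := h
  have hlen := Nat.eq_of_beq_eq_true h1
  refine ⟨hlen, mul_transpose_of_unitRows hlen h2, fun i hi => ?_⟩
  rw [← h3, leftHistogram_eq hlen, rightHistogram_eq (by simp)]
  have hl : ∀ k, sumCount rows (List.range 32) k = pairCount (rowMatrix 32 rows) k :=
    fun k => funext fun t => (pairCount_rowMatrix hlen k t).symm
  have hr : ∀ k, sumCount ((List.range 32).map (columnOf rows)) (List.range 32) k =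
      pairCount (rowMatrix 32 rows).transpose k := fun k => funext fun t => by
    rw [← rowMatrix_columns, pairCount_rowMatrix (by simp)]
  simp only [hl, hr]
  -- For i < 7 the total weight is positive, so the terms with k = 0, absent from the histograms,
  -- vanish.
  have hz : ∀ B : Matrix (Fin 32) (Fin 32) (ZMod 2), pairCount B 0 (14 - 2 * i - 0) = 0 :=
    fun B => pairCount_zero_left B (by omega)
  interval_cases i <;>
    simp [List.range_succ, List.range'_succ, Finset.sum_range_succ, hz, add_assoc]

theorem weightCount_of_checkCode {l r : Fin 32 → Fin 64} (he : Function.Bijective (Sum.elim l r))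
    (h : checkCode rows a₁₂ a₁₄ = true) (i : ℕ) (hi : i < 7) :
    weightCount (sysCode l r (rowMatrix 32 rows)) (14 - 2 * i) =
      [a₁₄, a₁₂, 0, 0, 0, 0, 0].getD i 0 := by
  obtain ⟨-, h2, h3⟩ := checkCode_spec h
  rw [weightCount_eq_sum he _ h2, ← h3 i hi, show (14 - 2 * i) / 2 = 7 - i by omega,
    show (14 - 2 * i + 1) / 2 = 7 - i by omega]

/-! ### Low weights and extremality of self-dual codes -/

theorem weightCount_zero {n : ℕ} (C : BinaryCode n) : weightCount C 0 = 1 := by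
  have : {c : Fin n → ZMod 2 | c ∈ C ∧ hammingNorm c = 0} = {0} := by
    ext c
    simp only [hammingNorm_eq_zero, Set.mem_ofPred_eq, Set.mem_singleton_iff]
    exact ⟨fun h => h.2, fun h => ⟨h ▸ C.zero_mem, h⟩⟩
  rw [weightCount, this, Set.ncard_singleton]

/-- A word of a self-dual code is orthogonal to itself, and c·c is the weight of c modulo 2. -/
theorem IsSelfDual.even_hammingNorm {n : ℕ} {C : BinaryCode n} (hC : IsSelfDual C)
    {c : Fin n → ZMod 2} (hc : c ∈ C) : Even (hammingNorm c) := by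
  have h1 : c ∈ dual C := hC ▸ hc
  have h2 : ∑ i, c i * c i = 0 := h1 c hc
  have h3 : ∀ a : ZMod 2, a * a = if a ≠ 0 then 1 else 0 := by decide
  simp only [h3, Finset.sum_boole] at h2
  exact ZMod.natCast_eq_zero_iff_even.1 h2

theorem IsSelfDual.weightCount_odd {n : ℕ} {C : BinaryCode n} (hC : IsSelfDual C) {i : ℕ}
    (hi : ¬ Even i) : weightCount C i = 0 := by
  rw [weightCount, Set.ncard_eq_zero]
  ext c
  simp only [Set.mem_ofPred_eq, Set.mem_empty_iff_false, iff_false]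
  rintro ⟨hc, rfl⟩
  exact hi (hC.even_hammingNorm hc)

theorem exists_of_weightCount_ne_zero {n : ℕ} {C : BinaryCode n} {i : ℕ}
    (h : weightCount C i ≠ 0) : ∃ c ∈ C, hammingNorm c = i := by
  obtain ⟨c, hc⟩ := Set.nonempty_of_ncard_ne_zero h
  exact ⟨c, hc⟩

theorem weightCount_ne_zero {n : ℕ} {C : BinaryCode n} {c : Fin n → ZMod 2} (hc : c ∈ C) :
    weightCount C (hammingNorm c) ≠ 0 :=
  Set.ncard_ne_zero_of_mem (a := c) ⟨hc, rfl⟩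

theorem coeff_weightEnumerator {n : ℕ} (C : BinaryCode n) {i : ℕ} (hi : i ≤ n) :
    (weightEnumerator C).coeff i = weightCount C i := by
  simp [weightEnumerator, Polynomial.coeff_monomial, hi]

theorem weightCount_lt_sixteen {l r : Fin 32 → Fin 64}
    (he : Function.Bijective (Sum.elim l r)) (h : checkCode rows a₁₂ a₁₄ = true) {i : ℕ}
    (hi : i < 16) : weightCount (sysCode l r (rowMatrix 32 rows)) i =
      if i = 0 then 1 else if i = 12 then a₁₂ else if i = 14 then a₁₄ else 0 := by
  have hsd : IsSelfDual (sysCode l r (rowMatrix 32 rows)) :=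
    isSelfDual_sysCode he _ (checkCode_spec h).2.1
  have hw := weightCount_of_checkCode he h
  by_cases h0 : i = 0
  · rw [h0, weightCount_zero]
    rfl
  by_cases hev : Even i
  · obtain ⟨j, rfl⟩ := hev
    -- The weights are indexed downwards from 14, so the even weight 2j has index 7 - j.
    have hj := hw (7 - j) (by omega)
    rw [show 14 - 2 * (7 - j) = j + j by omega] at hj
    rw [hj]
    have hj1 : 1 ≤ j := by omega
    have hj2 : j < 8 := by omega
    interval_cases j <;> simp
  · rw [hsd.weightCount_odd hev, if_neg h0, if_neg, if_neg] <;> rintro rfl <;> exact hev (by decide)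

/-- A word of weight 12 exists and no nonzero word is lighter, so the distance is 12. A word of
weight 14 rules out doubly-evenness. -/
theorem isExtremalTypeI64_of_checkCode {l r : Fin 32 → Fin 64}
    (he : Function.Bijective (Sum.elim l r)) (h : checkCode rows a₁₂ a₁₄ = true)
    (h12 : a₁₂ ≠ 0) (h14 : a₁₄ ≠ 0) :
    IsExtremalTypeI64 (sysCode l r (rowMatrix 32 rows)) := by
  have hsd : IsSelfDual (sysCode l r (rowMatrix 32 rows)) :=
    isSelfDual_sysCode he _ (checkCode_spec h).2.1
  have hw := fun i (hi : i < 16) => weightCount_lt_sixteen he h hi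
  have hmin : minDist (sysCode l r (rowMatrix 32 rows)) = 12 := by
    refine le_antisymm (Nat.sInf_le ?_) (le_csInf ?_ ?_)
    · obtain ⟨c, hc, hc'⟩ := exists_of_weightCount_ne_zero (i := 12)
        (C := sysCode l r (rowMatrix 32 rows)) (by simpa [hw] using h12)
      refine ⟨c, hc, fun h0 => ?_, hc'⟩
      simp [h0] at hc'
    · obtain ⟨c, hc, hc'⟩ := exists_of_weightCount_ne_zero (i := 12)
        (C := sysCode l r (rowMatrix 32 rows)) (by simpa [hw] using h12)
      refine ⟨12, c, hc, fun h0 => ?_, hc'⟩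
      simp [h0] at hc'
    · rintro _ ⟨c, hc, hc0, rfl⟩
      by_contra! hlt
      have h1 := weightCount_ne_zero hc
      rw [hw _ (by omega), if_neg (by rwa [hammingNorm_eq_zero]), if_neg (by omega),
        if_neg (by omega)] at h1
      exact h1 rfl
  refine ⟨⟨hsd, fun hde => ?_⟩, ⟨hsd, hmin⟩, finrank_sysCode he _, hmin⟩
  obtain ⟨c, hc, hc'⟩ := exists_of_weightCount_ne_zero (i := 14)
    (C := sysCode l r (rowMatrix 32 rows)) (by simpa [hw] using h14)
  have := hde c hc
  rw [hc'] at this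
  revert this
  decide

theorem coeff_of_checkCode {l r : Fin 32 → Fin 64} (he : Function.Bijective (Sum.elim l r))
    (h : checkCode rows a₁₂ a₁₄ = true) {i : ℕ} (hi : i < 16) :
    (weightEnumerator (sysCode l r (rowMatrix 32 rows))).coeff i =
      (1 + Polynomial.monomial 12 (a₁₂ : ℤ) + Polynomial.monomial 14 (a₁₄ : ℤ) : ℤ[X]).coeff i := by
  rw [coeff_weightEnumerator _ (by omega), weightCount_lt_sixteen he h hi]
  interval_cases i <;> simp [Polynomial.coeff_monomial, Polynomial.coeff_one]

theorem hasW641_of_checkCode {l r : Fin 32 → Fin 64} (he : Function.Bijective (Sum.elim l r))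
    {β : ℕ} (h₁ : 14 ≤ β) (h₂ : β ≤ 284)
    (h : checkCode rows (1312 + 16 * β) (22016 - 64 * β) = true) :
    IsExtremalTypeI64 (sysCode l r (rowMatrix 32 rows)) ∧
      HasW641 (sysCode l r (rowMatrix 32 rows)) β := by
  refine ⟨isExtremalTypeI64_of_checkCode he h (by omega) (by omega), h₁, h₂, fun i hi => ?_⟩
  rw [coeff_of_checkCode he h hi]
  -- The check uses natural subtraction, the enumerator integer subtraction; they agree because β ≤
  -- 284 keeps the difference positive.
  push_cast [show 64 * β ≤ 22016 by omega]
  rfl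

theorem hasW642_of_checkCode {l r : Fin 32 → Fin 64} (he : Function.Bijective (Sum.elim l r))
    {β : ℕ} (h₂ : β ≤ 277) (h : checkCode rows (1312 + 16 * β) (23040 - 64 * β) = true) :
    IsExtremalTypeI64 (sysCode l r (rowMatrix 32 rows)) ∧
      HasW642 (sysCode l r (rowMatrix 32 rows)) β := by
  refine ⟨isExtremalTypeI64_of_checkCode he h (by omega) (by omega), h₂, fun i hi => ?_⟩
  rw [coeff_of_checkCode he h hi]
  push_cast [show 64 * β ≤ 23040 by omega]
  rfl

end WeightCheck

/-! ### The Gray map -/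

theorem gray_apply {n : ℕ} (x : Fin n → R₂) (k : Fin 4) (i : Fin n) :
    gray n x (finProdFinEquiv (k, i)) =
      ![R₂.coeffUV (x i), R₂.coeffV (x i) + R₂.coeffUV (x i), R₂.coeffU (x i) + R₂.coeffUV (x i),
        R₂.coeffOne (x i) + R₂.coeffU (x i) + R₂.coeffV (x i) + R₂.coeffUV (x i)] k := by
  simp only [gray, LinearMap.coe_mk, AddHom.coe_mk, Equiv.symm_apply_apply]

/-- The element of `R₂` with given coefficients. -/
def R₂.mk (a b c d : ZMod 2) : R₂ := ((a, b), (c, d))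

theorem R₂.coeff_mk (a b c d : ZMod 2) : coeffOne (mk a b c d) = a ∧ coeffU (mk a b c d) = b ∧
    coeffV (mk a b c d) = c ∧ coeffUV (mk a b c d) = d := ⟨rfl, rfl, rfl, rfl⟩

theorem gray_surjective (n : ℕ) : Function.Surjective (gray n) := by
  intro y
  -- The four Gray coordinates are solved for a, b, c, d: d is block 0, then c and b come from
  -- blocks 1 and 2, and a is the sum of all four.
  refine ⟨fun i => R₂.mk
    (y (finProdFinEquiv (0, i)) + y (finProdFinEquiv (1, i)) + y (finProdFinEquiv (2, i)) +
      y (finProdFinEquiv (3, i)))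
    (y (finProdFinEquiv (2, i)) + y (finProdFinEquiv (0, i)))
    (y (finProdFinEquiv (1, i)) + y (finProdFinEquiv (0, i)))
    (y (finProdFinEquiv (0, i))), ?_⟩
  funext j
  obtain ⟨⟨k, i⟩, rfl⟩ := finProdFinEquiv.surjective j
  have h1 : ∀ a b : ZMod 2, a + b + b = a := by decide
  have h2 : ∀ a b c d : ZMod 2, a + b + c + d + (c + a) + (b + a) + a = d := by decide
  rw [gray_apply]
  fin_cases k
  · rfl
  · exact h1 _ _
  · exact h1 _ _
  · exact h2 _ _ _ _

theorem gray_injective (n : ℕ) : Function.Injective (gray n) := by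
  rw [← LinearMap.ker_eq_bot, LinearMap.ker_eq_bot']
  intro x hx
  have h : ∀ k i, gray n x (finProdFinEquiv (k, i)) = 0 := fun k i => by rw [hx]; rfl
  funext i
  have h0 := h 0 i
  have h1 := h 1 i
  have h2 := h 2 i
  have h3 := h 3 i
  rw [gray_apply] at h0 h1 h2 h3
  have key : ∀ a b c d : ZMod 2, d = 0 → c + d = 0 → b + d = 0 → a + b + c + d = 0 →
      a = 0 ∧ b = 0 ∧ c = 0 ∧ d = 0 := by decide
  obtain ⟨e1, e2, e3, e4⟩ := key (R₂.coeffOne (x i)) (R₂.coeffU (x i)) (R₂.coeffV (x i))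
    (R₂.coeffUV (x i)) h0 h1 h2 h3
  rw [R₂.eq_coeff (x i), e1, e2, e3, e4]
  simp

/-- The sum of the coordinates in the group basis `(1 + u)^i (1 + v)^j`. -/
def trace (x : R₂) : ZMod 2 := R₂.coeffOne x + R₂.coeffU x + R₂.coeffV x + R₂.coeffUV x

theorem trace_add (x y : R₂) : trace (x + y) = trace x + trace y := by
  simp only [trace, R₂.coeffOne, R₂.coeffU, R₂.coeffV, R₂.coeffUV, TrivSqZeroExt.fst_add,
    TrivSqZeroExt.snd_add]
  ring

theorem trace_sum {ι : Type*} (s : Finset ι) (f : ι → R₂) :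
    trace (∑ i ∈ s, f i) = ∑ i ∈ s, trace (f i) := by
  classical
  induction s using Finset.induction_on with
  | empty => simp [trace, R₂.coeffOne, R₂.coeffU, R₂.coeffV, R₂.coeffUV]
  | insert a s ha ih => rw [Finset.sum_insert ha, Finset.sum_insert ha, trace_add, ih]

theorem coeff_mul (x y : R₂) :
    R₂.coeffOne (x * y) = R₂.coeffOne x * R₂.coeffOne y ∧
    R₂.coeffU (x * y) = R₂.coeffOne x * R₂.coeffU y + R₂.coeffU x * R₂.coeffOne y ∧
    R₂.coeffV (x * y) = R₂.coeffOne x * R₂.coeffV y + R₂.coeffV x * R₂.coeffOne y ∧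
    R₂.coeffUV (x * y) = R₂.coeffOne x * R₂.coeffUV y + R₂.coeffU x * R₂.coeffV y +
      R₂.coeffV x * R₂.coeffU y + R₂.coeffUV x * R₂.coeffOne y := by
  simp only [R₂.coeffOne, R₂.coeffU, R₂.coeffV, R₂.coeffUV]
  refine ⟨by simp, by simp, by simp, ?_⟩
  simp
  ring

/-- The Gray coordinates are the coordinates in the group basis, and `trace` reads off the
coefficient of the group element 1, which sits in block 3. Every group element is its own inverse,
so that coefficient of xy is the sum of the products of equal coordinates. -/
theorem gray_inner {n : ℕ} (x y : Fin n → R₂) :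
    ∑ j, gray n x j * gray n y j = trace (∑ i, x i * y i) := by
  rw [trace_sum, ← Equiv.sum_comp finProdFinEquiv, Fintype.sum_prod_type, Finset.sum_comm]
  refine Finset.sum_congr rfl fun i _ => ?_
  obtain ⟨h1, h2, h3, h4⟩ := coeff_mul (x i) (y i)
  rw [trace, h1, h2, h3, h4]
  have key : ∀ a b c d a' b' c' d' : ZMod 2,
      d * d' + (c + d) * (c' + d') + (b + d) * (b' + d') +
        (a + b + c + d) * (a' + b' + c' + d') =
      a * a' + (a * b' + b * a') + (a * c' + c * a') +
        (a * d' + b * c' + c * b' + d * a') := by decide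
  simp only [gray_apply, Fin.sum_univ_four]
  exact key _ _ _ _ _ _ _ _

/-- Nondegeneracy of the trace form. Testing with 1, u, v, uv gives a triangular system for the
coefficients of z. -/
theorem eq_zero_of_trace (z : R₂) (h : ∀ r : R₂, trace (r * z) = 0) : z = 0 := by
  have h1 := h (R₂.mk 1 0 0 0)
  have h2 := h (R₂.mk 0 1 0 0)
  have h3 := h (R₂.mk 0 0 1 0)
  have h4 := h (R₂.mk 0 0 0 1)
  simp only [trace, coeff_mul, R₂.coeff_mk, zero_mul, one_mul, zero_add, add_zero] at h1 h2 h3 h4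
  have key : ∀ a b c d : ZMod 2, a + b + c + d = 0 → a + c = 0 → a + b = 0 → a = 0 →
      a = 0 ∧ b = 0 ∧ c = 0 ∧ d = 0 := by decide
  obtain ⟨e1, e2, e3, e4⟩ := key _ _ _ _ h1 h2 h3 h4
  rw [R₂.eq_coeff z, e1, e2, e3, e4]
  simp

/-- The Gray map commutes with duality. -/
theorem gray_mem_dual_iff {n : ℕ} (L : LinearCode R₂ n) (y : Fin n → R₂) :
    gray n y ∈ dual (grayImage L) ↔ y ∈ dual L := by
  constructor
  · intro hy x hx
    refine eq_zero_of_trace _ fun r => ?_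
    -- Binary orthogonality only controls the trace of the R₂-product. Since `L` is an R₂-module,
    -- all multiples of x may be tested as well, and nondegeneracy then kills the whole product.
    have h := hy (gray n (r • x)) ⟨r • x, L.smul_mem r hx, rfl⟩
    rw [gray_inner] at h
    rw [← h, Finset.mul_sum]
    simp [mul_assoc]
  · rintro hy _ ⟨x, hx, rfl⟩
    rw [gray_inner, hy x hx]
    simp [trace, R₂.coeffOne, R₂.coeffU, R₂.coeffV, R₂.coeffUV]

theorem gray_mem_grayImage_iff {n : ℕ} (L : LinearCode R₂ n) (y : Fin n → R₂) :
    gray n y ∈ grayImage L ↔ y ∈ L := by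
  constructor
  · rintro ⟨x, hx, hxy⟩
    rwa [← gray_injective n hxy]
  · exact fun hy => ⟨y, hy, rfl⟩

theorem isSelfDual_of_grayImage {n : ℕ} {L : LinearCode R₂ n} (h : IsSelfDual (grayImage L)) :
    IsSelfDual L := by
  ext y
  rw [← gray_mem_dual_iff, ← gray_mem_grayImage_iff]
  exact (congrArg (gray n y ∈ ·) h).to_iff

/-- The permutation of the coordinates of the Gray image that permutes the four blocks by
`τ`. -/
def blockSwap (n : ℕ) (τ : Equiv.Perm (Fin 4)) : Equiv.Perm (Fin (4 * n)) :=
  (finProdFinEquiv.symm.trans (τ.prodCongr (Equiv.refl _))).trans finProdFinEquiv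

theorem blockSwap_apply (n : ℕ) (τ : Equiv.Perm (Fin 4)) (k : Fin 4) (i : Fin n) :
    blockSwap n τ (finProdFinEquiv (k, i)) = finProdFinEquiv (τ k, i) := by
  simp [blockSwap]

/-- Addition of `1` to the block numbers `0, 1, 2, 3`, as elements of `𝔽₂²`. -/
def swapU : Equiv.Perm (Fin 4) := ⟨![1, 0, 3, 2], ![1, 0, 3, 2], by decide, by decide⟩

/-- Addition of `2` to the block numbers `0, 1, 2, 3`, as elements of `𝔽₂²`. -/
def swapV : Equiv.Perm (Fin 4) := ⟨![2, 3, 0, 1], ![2, 3, 0, 1], by decide, by decide⟩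

/-- u = 1 + (1 + u), and multiplication by the group element 1 + u permutes the group basis, hence
the blocks. -/
theorem gray_smul_u {n : ℕ} (x : Fin n → R₂) :
    gray n (R₂.u • x) = gray n x + gray n x ∘ blockSwap n swapU := by
  funext j
  obtain ⟨⟨k, i⟩, rfl⟩ := finProdFinEquiv.surjective j
  simp only [Pi.add_apply, Function.comp_apply, blockSwap_apply, gray_apply]
  obtain ⟨h1, h2, h3, h4⟩ := coeff_mul R₂.u (x i)
  simp only [Pi.smul_apply, smul_eq_mul, h1, h2, h3, h4]
  have hu : R₂.coeffOne R₂.u = 0 ∧ R₂.coeffU R₂.u = 1 ∧ R₂.coeffV R₂.u = 0 ∧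
      R₂.coeffUV R₂.u = 0 := by
    simp [R₂.u, R₂.coeffOne, R₂.coeffU, R₂.coeffV, R₂.coeffUV]
  simp only [hu, zero_mul, one_mul, zero_add, add_zero]
  generalize R₂.coeffOne (x i) = a
  generalize R₂.coeffU (x i) = b
  generalize R₂.coeffV (x i) = c
  generalize R₂.coeffUV (x i) = d
  revert k a b c d
  decide

theorem gray_smul_v {n : ℕ} (x : Fin n → R₂) :
    gray n (R₂.v • x) = gray n x + gray n x ∘ blockSwap n swapV := by
  funext j
  obtain ⟨⟨k, i⟩, rfl⟩ := finProdFinEquiv.surjective j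
  simp only [Pi.add_apply, Function.comp_apply, blockSwap_apply, gray_apply]
  obtain ⟨h1, h2, h3, h4⟩ := coeff_mul R₂.v (x i)
  simp only [Pi.smul_apply, smul_eq_mul, h1, h2, h3, h4]
  have hv : R₂.coeffOne R₂.v = 0 ∧ R₂.coeffU R₂.v = 0 ∧ R₂.coeffV R₂.v = 1 ∧
      R₂.coeffUV R₂.v = 0 := by
    simp [R₂.v, R₂.coeffOne, R₂.coeffU, R₂.coeffV, R₂.coeffUV]
  simp only [hv, zero_mul, one_mul, zero_add, add_zero]
  generalize R₂.coeffOne (x i) = a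
  generalize R₂.coeffU (x i) = b
  generalize R₂.coeffV (x i) = c
  generalize R₂.coeffUV (x i) = d
  revert k a b c d
  decide

/-- The code over `R₂` whose Gray image is a given code that is invariant under the two
block permutations. -/
def grayPreimage {n : ℕ} (C : BinaryCode (4 * n))
    (hu : ∀ c ∈ C, c ∘ blockSwap n swapU ∈ C) (hv : ∀ c ∈ C, c ∘ blockSwap n swapV ∈ C) :
    LinearCode R₂ n where
  carrier := {x | gray n x ∈ C}
  zero_mem' := by
    change gray n 0 ∈ C
    rw [map_zero]
    exact C.zero_mem
  add_mem' := by
    intro x y hx hy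
    change gray n (x + y) ∈ C
    rw [map_add]
    exact C.add_mem hx hy
  smul_mem' := by
    intro r x hx
    have hsu : ∀ y, gray n y ∈ C → gray n (R₂.u • y) ∈ C := fun y hy => by
      rw [gray_smul_u]
      exact C.add_mem hy (hu _ hy)
    have hsv : ∀ y, gray n y ∈ C → gray n (R₂.v • y) ∈ C := fun y hy => by
      rw [gray_smul_v]
      exact C.add_mem hy (hv _ hy)
    have hs : ∀ (a : ZMod 2) y, gray n y ∈ C → gray n (algebraMap (ZMod 2) R₂ a • y) ∈ C :=
      fun a y hy => by
        rw [algebraMap_smul, map_smul]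
        exact C.smul_mem a hy
    change gray n (r • x) ∈ C
    rw [R₂.eq_coeff r, add_smul, add_smul, add_smul, mul_smul, mul_smul, mul_smul, mul_smul,
      map_add, map_add, map_add]
    exact C.add_mem (C.add_mem (C.add_mem (hs _ _ hx) (hsu _ (hs _ _ hx))) (hsv _ (hs _ _ hx)))
      (hsu _ (hsv _ (hs _ _ hx)))

theorem grayImage_grayPreimage {n : ℕ} (C : BinaryCode (4 * n))
    (hu : ∀ c ∈ C, c ∘ blockSwap n swapU ∈ C) (hv : ∀ c ∈ C, c ∘ blockSwap n swapV ∈ C) :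
    grayImage (grayPreimage C hu hv) = C := by
  ext c
  constructor
  · rintro ⟨x, hx, rfl⟩
    exact hx
  · intro hc
    obtain ⟨x, rfl⟩ := gray_surjective n c
    exact ⟨x, hc, rfl⟩

/-- π sends u and v to 0, hence every group element to 1: it is the augmentation of the group
algebra. -/
theorem proj_eq_sum_gray {n : ℕ} (x : Fin n → R₂) (i : Fin n) :
    proj n x i = ∑ k, gray n x (finProdFinEquiv (k, i)) := by
  simp only [gray_apply, Fin.sum_univ_four]
  have key : ∀ a b c d : ZMod 2, a = d + (c + d) + (b + d) + (a + b + c + d) := by decide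
  exact key _ _ _ _

/-! ### Lifts given by systematic generator matrices -/

section Lift

variable {n m : ℕ}

/-- The coordinates of the Gray image over the coordinates `p`; index `i` of block `k` is
`4 i + k`. -/
def blowUp (p : Fin m → Fin n) (t : Fin (m * 4)) : Fin (4 * n) :=
  finProdFinEquiv ((finProdFinEquiv.symm t).2, p (finProdFinEquiv.symm t).1)

theorem blowUp_apply (p : Fin m → Fin n) (i : Fin m) (k : Fin 4) :
    blowUp p (finProdFinEquiv (i, k)) = finProdFinEquiv (k, p i) := by
  simp [blowUp]

theorem blowUp_bijective {p q : Fin m → Fin n} (h : Function.Bijective (Sum.elim p q)) :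
    Function.Bijective (Sum.elim (blowUp p) (blowUp q)) := by
  constructor
  · have hp : ∀ i j, p i = p j → i = j := fun i j hij =>
      Sum.inl_injective (h.1 (a₁ := Sum.inl i) (a₂ := Sum.inl j) hij)
    have hq : ∀ i j, q i = q j → i = j := fun i j hij =>
      Sum.inr_injective (h.1 (a₁ := Sum.inr i) (a₂ := Sum.inr j) hij)
    have hpq : ∀ i j, p i ≠ q j := fun i j hij => by
      have := h.1 (a₁ := Sum.inl i) (a₂ := Sum.inr j) hij
      cases this
    intro s t hst
    rcases s with s | s <;> rcases t with t | t <;>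
      obtain ⟨⟨i, k⟩, rfl⟩ := finProdFinEquiv.surjective s <;>
      obtain ⟨⟨j, k'⟩, rfl⟩ := finProdFinEquiv.surjective t <;>
      simp only [Sum.elim_inl, Sum.elim_inr, blowUp_apply, EmbeddingLike.apply_eq_iff_eq,
        Prod.mk.injEq] at hst
    · rw [hst.1, hp _ _ hst.2]
    · exact absurd hst.2 (hpq _ _)
    · exact absurd hst.2.symm (hpq _ _)
    · rw [hst.1, hq _ _ hst.2]
  · intro t
    obtain ⟨⟨k, i⟩, rfl⟩ := finProdFinEquiv.surjective t
    obtain ⟨s, rfl⟩ := h.2 i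
    rcases s with s | s
    · exact ⟨Sum.inl (finProdFinEquiv (s, k)), blowUp_apply p s k⟩
    · exact ⟨Sum.inr (finProdFinEquiv (s, k)), blowUp_apply q s k⟩

/-- The entries of `B` do not change when `τ` is applied to both block numbers. -/
def IsBlockInvariant (B : Matrix (Fin (m * 4)) (Fin (m * 4)) (ZMod 2))
    (τ : Equiv.Perm (Fin 4)) : Prop :=
  ∀ i j k k', B (finProdFinEquiv (i, τ k)) (finProdFinEquiv (j, τ k')) =
    B (finProdFinEquiv (i, k)) (finProdFinEquiv (j, k'))

theorem sum_blocks {M : Type*} [AddCommMonoid M] (f : Fin (m * 4) → M) :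
    ∑ t, f t = ∑ i, ∑ k, f (finProdFinEquiv (i, k)) := by
  rw [← Equiv.sum_comp finProdFinEquiv, Fintype.sum_prod_type]

/-- The parity check at block k' of the permuted word is the check at block τ k' of the original
one, once the summation over k is reindexed by τ. -/
theorem blockSwap_mem {p q : Fin m → Fin n} {B : Matrix (Fin (m * 4)) (Fin (m * 4)) (ZMod 2)}
    {τ : Equiv.Perm (Fin 4)} (hB : IsBlockInvariant B τ) :
    ∀ c ∈ sysCode (blowUp p) (blowUp q) B,
      c ∘ blockSwap n τ ∈ sysCode (blowUp p) (blowUp q) B := by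
  intro c hc t
  obtain ⟨⟨j, k'⟩, rfl⟩ := finProdFinEquiv.surjective t
  have h := hc (finProdFinEquiv (j, τ k'))
  rw [sum_blocks] at h ⊢
  simp only [blowUp_apply, Function.comp_apply, blockSwap_apply] at h ⊢
  rw [h]
  refine Finset.sum_congr rfl fun i _ => ?_
  rw [← Equiv.sum_comp τ]
  refine Finset.sum_congr rfl fun k _ => ?_
  rw [hB]

/-- The lift with the given systematic binary generator matrix of its Gray image. -/
def sysLift (p q : Fin m → Fin n) (B : Matrix (Fin (m * 4)) (Fin (m * 4)) (ZMod 2))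
    (hu : IsBlockInvariant B swapU) (hv : IsBlockInvariant B swapV) : LinearCode R₂ n :=
  grayPreimage (sysCode (blowUp p) (blowUp q) B) (blockSwap_mem hu) (blockSwap_mem hv)

/-- Summing the parity equations over the four check coordinates above one position replaces each
block of B by its row sum. As this sum does not depend on the row k of the block, it factors out and
leaves the parity equations of A for the projected word. Surjectivity needs only one preimage per
word, since a word of a systematic code is known from its information part. -/
theorem isLift_sysLift {p q : Fin m → Fin n} (h : Function.Bijective (Sum.elim p q))
    {B : Matrix (Fin (m * 4)) (Fin (m * 4)) (ZMod 2)}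
    (hu : IsBlockInvariant B swapU) (hv : IsBlockInvariant B swapV)
    {A : Matrix (Fin m) (Fin m) (ZMod 2)}
    (hA : ∀ i j k, ∑ k', B (finProdFinEquiv (i, k)) (finProdFinEquiv (j, k')) = A i j) :
    IsLift (sysLift p q B hu hv) (sysCode p q A) := by
  have sub : ∀ x, gray n x ∈ sysCode (blowUp p) (blowUp q) B → proj n x ∈ sysCode p q A := by
    intro x hx j
    simp only [proj_eq_sum_gray]
    have h1 : ∀ k', gray n x (finProdFinEquiv (k', q j)) =
        ∑ i, ∑ k, gray n x (finProdFinEquiv (k, p i)) *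
          B (finProdFinEquiv (i, k)) (finProdFinEquiv (j, k')) := by
      intro k'
      have := hx (finProdFinEquiv (j, k'))
      rw [sum_blocks] at this
      simpa only [blowUp_apply] using this
    simp only [h1]
    rw [Finset.sum_comm]
    refine Finset.sum_congr rfl fun i _ => ?_
    rw [Finset.sum_comm, Finset.sum_mul]
    refine Finset.sum_congr rfl fun k _ => ?_
    rw [← Finset.mul_sum, hA]
  ext y
  constructor
  · rintro ⟨x, hx, rfl⟩
    exact sub x hx
  · intro hy
    -- The information symbols of y are put into block 0 and zeros into the other three, so the four
    -- blocks sum to y there.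
    obtain ⟨x, hx⟩ := gray_surjective n (encode (blowUp_bijective h) B fun t =>
      if (finProdFinEquiv.symm t).2 = 0 then y (p (finProdFinEquiv.symm t).1) else 0)
    have hxm : gray n x ∈ sysCode (blowUp p) (blowUp q) B := hx ▸ encode_mem _ _ _
    refine ⟨x, hxm, ?_⟩
    have hl : ∀ i, proj n x (p i) = y (p i) := by
      intro i
      rw [proj_eq_sum_gray, hx]
      simp only [← blowUp_apply p, encode_left, Equiv.symm_apply_apply]
      simp
    rw [eq_encode h A (sub x hxm), eq_encode h A hy]
    simp only [hl]

end Lift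

/-! ### Codes of rotation systems with numbered faces -/

section Faces

variable {n f : ℕ} {G : SimpleGraph (Fin n)}

/-- A numbering of the faces of `M`: darts have the same number if and only if they belong to
the same face. -/
structure FaceNumbering (M : RotationSystem G) (f : ℕ) where
  num : G.Dart → Fin f
  base : Fin f → G.Dart
  num_facePerm : ∀ d, num (M.facePerm d) = num d
  num_base : ∀ a, num (base a) = a
  -- Fewer than eight steps suffice for faces with at most eight sides; a fixed bound keeps the
  -- condition a finite check.
  reach : ∀ d, ∃ k : Fin 8, M.facePerm^[k] (base (num d)) = d

namespace FaceNumbering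

variable {M : RotationSystem G}

theorem num_eq_of_sameCycle (F : FaceNumbering M f) {d e : G.Dart} (h : M.facePerm.SameCycle d e) :
    F.num d = F.num e := by
  have key : ∀ (k : ℕ) (d : G.Dart), F.num ((M.facePerm ^ k) d) = F.num d := by
    intro k
    induction k with
    | zero => simp
    | succ k ih =>
      intro d
      rw [pow_succ, Equiv.Perm.mul_apply, ih, F.num_facePerm]
  obtain ⟨k, rfl⟩ := h
  obtain ⟨k, rfl | rfl⟩ := k.eq_nat_or_neg
  · rw [zpow_natCast, key]
  · conv_lhs => rw [← (M.facePerm ^ k).apply_symm_apply d]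
    rw [key, zpow_neg, zpow_natCast]
    rfl

/-- Numbers are constant along the face permutation, so one face carries one number. Every dart is
reached from the base dart of its number, so one number belongs to one face. -/
theorem faceOf_eq_iff (F : FaceNumbering M f) (d e : G.Dart) :
    M.faceOf d = M.faceOf e ↔ F.num d = F.num e := by
  have hb : ∀ d, M.facePerm.SameCycle (F.base (F.num d)) d := by
    intro d
    obtain ⟨k, hk⟩ := F.reach d
    refine ⟨(k : ℕ), ?_⟩
    rw [zpow_natCast, ← Equiv.Perm.iterate_eq_pow]
    exact hk
  constructor
  · exact fun h => F.num_eq_of_sameCycle (Quotient.exact h)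
  · intro h
    refine Quotient.sound ?_
    have h1 := hb d
    rw [h] at h1
    exact h1.symm.trans (hb e)

theorem card_face (F : FaceNumbering M f) : Nat.card M.Face = f := by
  let φ : Fin f → M.Face := fun a => M.faceOf (F.base a)
  have hφ : Function.Bijective φ := by
    constructor
    · intro a b h
      have := (F.faceOf_eq_iff _ _).1 h
      rwa [F.num_base, F.num_base] at this
    · intro x
      obtain ⟨d, rfl⟩ := Quotient.exists_rep x
      exact ⟨F.num d, (F.faceOf_eq_iff _ _).2 (F.num_base _)⟩
  rw [← Nat.card_eq_of_bijective φ hφ, Nat.card_eq_fintype_card, Fintype.card_fin]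

theorem faceCode_eq_span (F : FaceNumbering M f) (rows : List ℕ)
    (hrows : ∀ a w, (∃ d : G.Dart, d.fst = w ∧ F.num d = a) ↔ (rows.getD a 0).testBit w = true) :
    faceCode M = Submodule.span (ZMod 2)
      (Set.range fun (a : Fin f) (w : Fin n) => bitVal (rows.getD a 0) w) := by
  have key : ∀ d, M.incidenceMatrix (M.faceOf d) =
      fun w : Fin n => bitVal (rows.getD (F.num d) 0) w := by
    intro d
    funext w
    have : M.Incident (M.faceOf d) w ↔ (rows.getD (F.num d) 0).testBit w = true := by
      rw [← hrows]
      simp only [RotationSystem.Incident, F.faceOf_eq_iff]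
    simp only [RotationSystem.incidenceMatrix, bitVal, this]
  rw [faceCode]
  congr 1
  ext y
  constructor
  · rintro ⟨x, rfl⟩
    obtain ⟨d, rfl⟩ := Quotient.exists_rep x
    exact ⟨F.num d, (key d).symm⟩
  · rintro ⟨a, rfl⟩
    refine ⟨M.faceOf (F.base a), ?_⟩
    rw [key, F.num_base]

end FaceNumbering

/-! ### Certificates for face codes and for planarity -/

/-- The matrix `T` combines the generators into words whose information parts are the unit vectors.
A word of the systematic code is determined by its information part, so it is the corresponding
combination of these. -/
theorem span_eq_sysCode {m : ℕ} {p q : Fin m → Fin n} (h : Function.Bijective (Sum.elim p q))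
    (A : Matrix (Fin m) (Fin m) (ZMod 2)) (R : Fin f → Fin n → ZMod 2)
    (hR : ∀ a, R a ∈ sysCode p q A) (T : Fin m → Fin f → ZMod 2)
    (hT : ∀ i k, ∑ a, T i a * R a (p k) = if i = k then 1 else 0) :
    Submodule.span (ZMod 2) (Set.range R) = sysCode p q A := by
  refine le_antisymm (Submodule.span_le.2 ?_) fun y hy => ?_
  · rintro _ ⟨a, rfl⟩
    exact hR a
  · let z : Fin n → ZMod 2 := ∑ i, y (p i) • ∑ a, T i a • R a
    have hz : z ∈ Submodule.span (ZMod 2) (Set.range R) :=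
      Submodule.sum_mem _ fun i _ => Submodule.smul_mem _ _ (Submodule.sum_mem _ fun a _ =>
        Submodule.smul_mem _ _ (Submodule.subset_span ⟨a, rfl⟩))
    have hz' : z ∈ sysCode p q A :=
      Submodule.sum_mem _ fun i _ => Submodule.smul_mem _ _ (Submodule.sum_mem _ fun a _ =>
        Submodule.smul_mem _ _ (hR a))
    have hzy : ∀ k, z (p k) = y (p k) := by
      intro k
      simp [z, Finset.sum_apply, hT]
    have : y = z := by
      rw [eq_encode h A hy, eq_encode h A hz']
      simp only [hzy]
    rw [this]
    exact hz

/-- Statements about all weights of the small codes reduce to which pairs (left weight, right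
weight) occur, a finite table that can be evaluated. -/
theorem exists_sumCount_ne_zero {m : ℕ} {p q : Fin m → Fin n}
    (h : Function.Bijective (Sum.elim p q)) {rows : List ℕ} (hm : rows.length = m)
    {c : Fin n → ZMod 2} (hc : c ∈ sysCode p q (rowMatrix m rows)) :
    ∃ k ≤ m, ∃ t ≤ m, BitSlice.sumCount rows (List.range m) k t ≠ 0 ∧ hammingNorm c = k + t := by
  have hle : ∀ x : Fin m → ZMod 2, hammingNorm x ≤ m := fun x =>
    hammingNorm_le_card_fintype.trans (by simp)
  refine ⟨_, hle fun i => c (p i), _, hle fun j => c (q j), ?_, hammingNorm_split h c⟩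
  rw [← pairCount_rowMatrix hm, pairCount, Finset.card_ne_zero]
  refine ⟨fun i => c (p i), ?_⟩
  simp only [Finset.mem_filter, Finset.mem_univ, true_and]
  congr 1
  exact (funext hc).symm

/-- Moving to smaller and smaller neighbours, every vertex reaches 0. -/
theorem connected_of_parent [NeZero n] (h : ∀ x : Fin n, x ≠ 0 → ∃ y < x, G.Adj y x) :
    G.Connected := by
  have key : ∀ (k : ℕ) (x : Fin n), x.val = k → G.Reachable 0 x := by
    intro k
    induction k using Nat.strong_induction_on with
    | _ k ih =>
      intro x hx
      by_cases h0 : x = 0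
      · rw [h0]
      · obtain ⟨y, hy, hxy⟩ := h x h0
        exact (ih y.val (hx ▸ hy) y rfl).trans hxy.reachable
  exact { preconnected := fun x y => (key _ x rfl).symm.trans (key _ y rfl), nonempty := ⟨0⟩ }

/-- A cubic graph has 2|E| = 3n, so Euler's formula n + f = |E| + 2 amounts to 2f = n + 4. -/
theorem isBicubicPlanar_of [NeZero n] [DecidableRel G.Adj] {M : RotationSystem G}
    (F : FaceNumbering M f) (hc : ∀ x : Fin n, x ≠ 0 → ∃ y < x, G.Adj y x)
    (hr : G.IsRegularOfDegree 3) (color : Fin n → Fin 2)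
    (hb : ∀ x y, G.Adj x y → color x ≠ color y) (hf : 2 * f = n + 4) : IsBicubicPlanar M := by
  have hconn := connected_of_parent hc
  refine ⟨hconn, hr, ⟨⟨color, fun {x y} hxy => hb x y hxy⟩⟩, hconn, ?_⟩
  have hs := G.sum_degrees_eq_twice_card_edges
  rw [Finset.sum_congr rfl fun v _ => hr v, Finset.sum_const, Finset.card_univ, Fintype.card_fin,
    smul_eq_mul] at hs
  rw [F.card_face, Nat.card_eq_fintype_card, Fintype.card_fin, Nat.card_eq_fintype_card,
    ← SimpleGraph.edgeFinset_card]
  omega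

/-- The number of a dart, from the numbers of the darts to the neighbours of each vertex. -/
def dartNumber {k : ℕ} (nb : Fin n → Fin 3 → Fin n) (t : Fin n → Fin 3 → Fin k) (d : G.Dart) :
    Fin k :=
  if d.snd = nb d.fst 0 then t d.fst 0 else if d.snd = nb d.fst 1 then t d.fst 1 else t d.fst 2

end Faces

theorem forall_dart {n : ℕ} {G : SimpleGraph (Fin n)} {P : G.Dart → Prop}
    (h : ∀ x y, (h : G.Adj x y) → P ⟨(x, y), h⟩) : ∀ d, P d := fun d => h _ _ d.adj

theorem exists_dart_iff {n : ℕ} {G : SimpleGraph (Fin n)} {P : G.Dart → Prop} :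
    (∃ d, P d) ↔ ∃ x y, ∃ h : G.Adj x y, P ⟨(x, y), h⟩ :=
  ⟨fun ⟨d, hd⟩ => ⟨_, _, d.adj, hd⟩, fun ⟨_, _, _, h⟩ => ⟨_, h⟩⟩

/-! ### The code of the first graph -/

/-- The numbers of the faces to which the three darts at each vertex of `G₁` belong. -/
def dartTable₁ : Fin 16 → Fin 3 → Fin 10 :=
  ![![0, 1, 2], ![0, 3, 1], ![0, 4, 3], ![0, 5, 4], ![0, 6, 5], ![6, 0, 7], ![7, 0, 8],
    ![2, 8, 0], ![1, 9, 2], ![3, 9, 1], ![4, 9, 3], ![4, 5, 9], ![5, 6, 9], ![9, 6, 7], ![9, 7, 8],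
    ![9, 8, 2]]

set_option maxRecDepth 4000 in
def faceNumbering₁ : FaceNumbering M₁ 10 where
  num := dartNumber nb₁ dartTable₁
  base := ![⟨(0, 1), by decide⟩, ⟨(0, 8), by decide⟩, ⟨(0, 7), by decide⟩, ⟨(1, 9), by decide⟩,
    ⟨(2, 10), by decide⟩,
    ⟨(3, 11), by decide⟩, ⟨(4, 12), by decide⟩, ⟨(5, 13), by decide⟩, ⟨(6, 14), by decide⟩, ⟨(8,
    15), by decide⟩]
  num_facePerm := forall_dart (by decide +kernel)
  num_base := by decide +kernel
  reach := forall_dart (by decide +kernel)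

/-- The vertices of the faces of `G₁`. -/
def faceRows₁ : List ℕ := [255, 771, 33153, 1542, 3084, 6168, 12336, 24672, 49344, 65280]

/-- Information positions of the code of `G₁`. -/
def info₁ : Fin 8 → Fin 16 := ![0, 1, 2, 3, 4, 5, 6, 8]

/-- The complement of the information positions of the code of `G₁`. -/
def check₁ : Fin 8 → Fin 16 := ![7, 9, 10, 11, 12, 13, 14, 15]

theorem info_check_bijective₁ : Function.Bijective (Sum.elim info₁ check₁) := by
  decide +kernel

/-- The rows of the systematic generator matrix of the code of `G₁`. -/
def codeRows₁ : List ℕ := [127, 131, 133, 137, 145, 161, 193, 254]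

theorem faceRows_mem₁ (a : Fin 10) : (fun w : Fin 16 => bitVal (faceRows₁.getD a 0) w) ∈
    sysCode info₁ check₁ (rowMatrix 8 codeRows₁) := by
  rw [mem_sysCode]
  revert a
  decide +kernel

theorem faceCode_eq₁ : faceCode M₁ = sysCode info₁ check₁ (rowMatrix 8 codeRows₁) := by
  rw [faceNumbering₁.faceCode_eq_span faceRows₁]
  · exact span_eq_sysCode info_check_bijective₁ _ _ faceRows_mem₁
      -- Entry i lists, as bits, the faces whose sum has the i-th unit vector as information part.
      -- All entries are below 256: the first eight of the ten faces already generate the code.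
      (fun i a => bitVal ([169, 6, 14, 30, 62, 126, 254, 173].getD i 0) a) (by decide +kernel)
  · simp only [exists_dart_iff]
    decide +kernel

theorem isBicubicPlanar₁ : IsBicubicPlanar M₁ :=
  isBicubicPlanar_of faceNumbering₁ (by decide +kernel)
    (fun v => by revert v; decide +kernel)
    ![0, 1, 0, 1, 0, 1, 0, 1, 1, 0, 1, 0, 1, 0, 1, 0] (by decide +kernel) rfl

theorem isSelfDual_faceCode₁ : IsSelfDual (faceCode M₁) := by
  rw [faceCode_eq₁]
  exact isSelfDual_sysCode info_check_bijective₁ _ (by decide +kernel)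

theorem four_le_of_sumCount₁ : ∀ k ≤ 8, ∀ t ≤ 8,
    BitSlice.sumCount codeRows₁ (List.range 8) k t ≠ 0 → k + t ≠ 0 → 4 ≤ k + t := by
  decide +kernel

theorem minDist_faceCode₁ : minDist (faceCode M₁) = 4 := by
  -- Face 1 is a square and gives a word of weight 4.
  have hrow : (fun w : Fin 16 => bitVal (faceRows₁.getD (1 : Fin 10) 0) w) ∈ faceCode M₁ :=
    faceCode_eq₁ ▸ faceRows_mem₁ 1
  have hw : hammingNorm (fun w : Fin 16 => bitVal (faceRows₁.getD (1 : Fin 10) 0) w) = 4 := by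
    decide +kernel
  have hmem : 4 ∈ {w | ∃ c ∈ faceCode M₁, c ≠ 0 ∧ hammingNorm c = w} :=
    ⟨_, hrow, fun h0 => by rw [h0, hammingNorm_zero] at hw; omega, hw⟩
  refine le_antisymm (Nat.sInf_le hmem) (le_csInf ⟨4, hmem⟩ ?_)
  rintro _ ⟨c, hc, hc0, rfl⟩
  rw [faceCode_eq₁] at hc
  obtain ⟨k, hk, t, ht, hkt, hw⟩ := exists_sumCount_ne_zero info_check_bijective₁ rfl hc
  rw [hw]
  refine four_le_of_sumCount₁ k hk t ht hkt ?_
  rw [← hw]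
  exact hammingNorm_ne_zero_iff.2 hc0

theorem hasParameters_faceCode₁ : HasParameters (faceCode M₁) 8 4 :=
  ⟨by rw [faceCode_eq₁, finrank_sysCode info_check_bijective₁], minDist_faceCode₁⟩

theorem isTypeII_faceCode₁ : IsTypeII (faceCode M₁) := by
  refine ⟨isSelfDual_faceCode₁, fun c hc => ?_⟩
  rw [faceCode_eq₁] at hc
  obtain ⟨k, hk, t, ht, hkt, hw⟩ := exists_sumCount_ne_zero info_check_bijective₁ rfl hc
  rw [hw]
  have key : ∀ k ≤ 8, ∀ t ≤ 8,
      BitSlice.sumCount codeRows₁ (List.range 8) k t ≠ 0 → 4 ∣ k + t := by decide +kernel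
  exact key k hk t ht hkt

/-! ### The code of the second graph -/

/-- The numbers of the faces to which the three darts at each vertex of `G₂` belong. -/
def dartTable₂ : Fin 16 → Fin 3 → Fin 10 :=
  ![![0, 1, 2], ![3, 1, 0], ![3, 4, 1], ![4, 5, 1], ![1, 5, 6], ![1, 6, 2], ![2, 6, 7],
    ![5, 7, 6], ![7, 0, 2], ![7, 3, 0], ![7, 8, 3], ![8, 9, 3], ![9, 4, 3], ![5, 4, 9], ![5, 9, 8],
    ![7, 5, 8]]

set_option maxRecDepth 4000 in
def faceNumbering₂ : FaceNumbering M₂ 10 where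
  num := dartNumber nb₂ dartTable₂
  base := ![⟨(0, 1), by decide⟩, ⟨(0, 5), by decide⟩, ⟨(0, 8), by decide⟩, ⟨(1, 2), by decide⟩,
    ⟨(2, 3), by decide⟩,
    ⟨(3, 4), by decide⟩, ⟨(4, 5), by decide⟩, ⟨(6, 8), by decide⟩, ⟨(10, 11), by decide⟩, ⟨(11,
    12), by decide⟩]
  num_facePerm := forall_dart (by decide +kernel)
  num_base := by decide +kernel
  reach := forall_dart (by decide +kernel)

/-- The vertices of the faces of `G₂`. -/
def faceRows₂ : List ℕ := [771, 63, 353, 7686, 12300, 57496, 240, 34752, 52224, 30720]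

/-- Information positions of the code of `G₂`. -/
def info₂ : Fin 8 → Fin 16 := ![0, 1, 2, 3, 4, 6, 10, 11]

/-- The complement of the information positions of the code of `G₂`. -/
def check₂ : Fin 8 → Fin 16 := ![5, 7, 8, 9, 12, 13, 14, 15]

theorem info_check_bijective₂ : Function.Bijective (Sum.elim info₂ check₂) := by
  decide +kernel

/-- The rows of the systematic generator matrix of the code of `G₂`. -/
def codeRows₂ : List ℕ := [59, 55, 239, 223, 61, 62, 176, 112]

theorem faceRows_mem₂ (a : Fin 10) : (fun w : Fin 16 => bitVal (faceRows₂.getD a 0) w) ∈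
    sysCode info₂ check₂ (rowMatrix 8 codeRows₂) := by
  rw [mem_sysCode]
  revert a
  decide +kernel

theorem faceCode_eq₂ : faceCode M₂ = sysCode info₂ check₂ (rowMatrix 8 codeRows₂) := by
  rw [faceNumbering₂.faceCode_eq_span faceRows₂]
  · exact span_eq_sysCode info_check_bijective₂ _ _ faceRows_mem₂
      -- Again the combinations of faces producing the unit vectors on the information positions;
      -- the last two faces are not needed.
      (fun i a => bitVal ([87, 86, 35, 51, 19, 83, 211, 174].getD i 0) a) (by decide +kernel)
  · simp only [exists_dart_iff]
    decide +kernel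

theorem isBicubicPlanar₂ : IsBicubicPlanar M₂ :=
  isBicubicPlanar_of faceNumbering₂ (by decide +kernel)
    (fun v => by revert v; decide +kernel)
    ![0, 1, 0, 1, 0, 1, 0, 1, 1, 0, 1, 0, 1, 0, 1, 0] (by decide +kernel) rfl

theorem isSelfDual_faceCode₂ : IsSelfDual (faceCode M₂) := by
  rw [faceCode_eq₂]
  exact isSelfDual_sysCode info_check_bijective₂ _ (by decide +kernel)

theorem four_le_of_sumCount₂ : ∀ k ≤ 8, ∀ t ≤ 8,
    BitSlice.sumCount codeRows₂ (List.range 8) k t ≠ 0 → k + t ≠ 0 → 4 ≤ k + t := by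
  decide +kernel

theorem minDist_faceCode₂ : minDist (faceCode M₂) = 4 := by
  have hrow : (fun w : Fin 16 => bitVal (faceRows₂.getD (0 : Fin 10) 0) w) ∈ faceCode M₂ :=
    faceCode_eq₂ ▸ faceRows_mem₂ 0
  have hw : hammingNorm (fun w : Fin 16 => bitVal (faceRows₂.getD (0 : Fin 10) 0) w) = 4 := by
    decide +kernel
  have hmem : 4 ∈ {w | ∃ c ∈ faceCode M₂, c ≠ 0 ∧ hammingNorm c = w} :=
    ⟨_, hrow, fun h0 => by rw [h0, hammingNorm_zero] at hw; omega, hw⟩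
  refine le_antisymm (Nat.sInf_le hmem) (le_csInf ⟨4, hmem⟩ ?_)
  rintro _ ⟨c, hc, hc0, rfl⟩
  rw [faceCode_eq₂] at hc
  obtain ⟨k, hk, t, ht, hkt, hw⟩ := exists_sumCount_ne_zero info_check_bijective₂ rfl hc
  rw [hw]
  refine four_le_of_sumCount₂ k hk t ht hkt ?_
  rw [← hw]
  exact hammingNorm_ne_zero_iff.2 hc0

theorem hasParameters_faceCode₂ : HasParameters (faceCode M₂) 8 4 :=
  ⟨by rw [faceCode_eq₂, finrank_sysCode info_check_bijective₂], minDist_faceCode₂⟩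

theorem isTypeI_faceCode₂ : IsTypeI (faceCode M₂) := by
  refine ⟨isSelfDual_faceCode₂, fun h => ?_⟩
  -- Face 1 is a hexagon, so its word has weight 6, which is not divisible by 4.
  have h6 := h _ (faceCode_eq₂ ▸ faceRows_mem₂ 1)
  revert h6
  decide +kernel

/-! ### Packaging of the checks -/

theorem castAdd_natAdd_bijective (m n : ℕ) :
    Function.Bijective (Sum.elim (Fin.castAdd n) (Fin.natAdd m) : Fin m ⊕ Fin n → Fin (m + n)) := by
  convert (finSumFinEquiv (m := m) (n := n)).bijective using 1
  funext x
  rcases x with x | x <;> rfl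

theorem exists_hasW641 {β : ℕ} (rows : List ℕ) (h₁ : 14 ≤ β) (h₂ : β ≤ 284)
    (h : checkCode rows (1312 + 16 * β) (22016 - 64 * β) = true) :
    ∃ C : BinaryCode 64, IsExtremalTypeI64 C ∧ HasW641 C β :=
  ⟨_, hasW641_of_checkCode (castAdd_natAdd_bijective 32 32) h₁ h₂ h⟩

theorem exists_hasW642 {β : ℕ} (rows : List ℕ) (h₂ : β ≤ 277)
    (h : checkCode rows (1312 + 16 * β) (23040 - 64 * β) = true) :
    ∃ C : BinaryCode 64, IsExtremalTypeI64 C ∧ HasW642 C β :=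
  ⟨_, hasW642_of_checkCode (castAdd_natAdd_bijective 32 32) h₂ h⟩

/-- The blocks of the matrix with the given rows are invariant under the translations of the
group of order `4`, and their row sums are the entries of the matrix `A`. -/
def IsBlockLift (rows : List ℕ) (A : Matrix (Fin 8) (Fin 8) (ZMod 2)) : Prop :=
  IsBlockInvariant (m := 8) (rowMatrix 32 rows) swapU ∧
    IsBlockInvariant (m := 8) (rowMatrix 32 rows) swapV ∧
    ∀ (i j : Fin 8) (k : Fin 4), ∑ k' : Fin 4,
      rowMatrix 32 rows (finProdFinEquiv (i, k)) (finProdFinEquiv (j, k')) = A i j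

instance (rows : List ℕ) (A : Matrix (Fin 8) (Fin 8) (ZMod 2)) :
    Decidable (IsBlockLift rows A) := by
  unfold IsBlockLift IsBlockInvariant
  infer_instance

/-- Once the Gray image of the lift is identified with the systematic binary code, its binary
properties `P` transfer directly, and self-duality over R₂ follows from binary self-duality. -/
theorem exists_lift {p q : Fin 8 → Fin 16} (hpq : Function.Bijective (Sum.elim p q))
    {A : Matrix (Fin 8) (Fin 8) (ZMod 2)} {rows : List ℕ} (h : IsBlockLift rows A)
    {P : BinaryCode 64 → Prop} (hsd : ∀ C, P C → IsSelfDual C)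
    (hP : P (sysCode (blowUp p) (blowUp q) (rowMatrix 32 rows))) :
    ∃ L : LinearCode R₂ 16, IsSelfDual L ∧ IsLift L (sysCode p q A) ∧ P (grayImage L) := by
  have hg : grayImage (sysLift p q (rowMatrix 32 rows) h.1 h.2.1) =
      sysCode (blowUp p) (blowUp q) (rowMatrix 32 rows) := grayImage_grayPreimage _ _ _
  refine ⟨sysLift p q (rowMatrix 32 rows) h.1 h.2.1, isSelfDual_of_grayImage ?_,
    isLift_sysLift hpq h.1 h.2.1 h.2.2, ?_⟩
  · rw [hg]
    exact hsd _ hP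
  · rwa [hg]

theorem exists_lift_hasW641 {p q : Fin 8 → Fin 16} (hpq : Function.Bijective (Sum.elim p q))
    {A : Matrix (Fin 8) (Fin 8) (ZMod 2)} {D : BinaryCode 16} (hD : D = sysCode p q A) {β : ℕ}
    (rows : List ℕ) (hA : IsBlockLift rows A) (h₁ : 14 ≤ β) (h₂ : β ≤ 284)
    (h : checkCode rows (1312 + 16 * β) (22016 - 64 * β) = true) :
    ∃ L : LinearCode R₂ 16, IsSelfDual L ∧ IsLift L D ∧
      IsExtremalTypeI64 (grayImage L) ∧ HasW641 (grayImage L) β := by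
  rw [hD]
  exact exists_lift hpq hA (P := fun C => IsExtremalTypeI64 C ∧ HasW641 C β)
    (fun C hC => hC.1.1.1) (hasW641_of_checkCode (blowUp_bijective hpq) h₁ h₂ h)

theorem exists_lift_hasW642 {p q : Fin 8 → Fin 16} (hpq : Function.Bijective (Sum.elim p q))
    {A : Matrix (Fin 8) (Fin 8) (ZMod 2)} {D : BinaryCode 16} (hD : D = sysCode p q A) {β : ℕ}
    (rows : List ℕ) (hA : IsBlockLift rows A) (h₂ : β ≤ 277)
    (h : checkCode rows (1312 + 16 * β) (23040 - 64 * β) = true) :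
    ∃ L : LinearCode R₂ 16, IsSelfDual L ∧ IsLift L D ∧
      IsExtremalTypeI64 (grayImage L) ∧ HasW642 (grayImage L) β := by
  rw [hD]
  exact exists_lift hpq hA (P := fun C => IsExtremalTypeI64 C ∧ HasW642 C β)
    (fun C hC => hC.1.1.1) (hasW642_of_checkCode (blowUp_bijective hpq) h₂ h)

/-! ### Binary matrices of the codes

Bit `j` of row `i` is entry `(i, j)`. -/

theorem exists_W641_14 : ∃ C : BinaryCode 64, IsExtremalTypeI64 C ∧ HasW641 C 14 :=
  exists_hasW641
    [4212262434, 1985704834, 3042606718, 796487962, 2666225670, 1413016064, 1464860777, 2982174579,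
     4241303421, 2292583700, 4178476116, 2092682165, 3996552585, 377302688, 2724671083, 3135893868,
     1178884014, 3879338727, 2185793105, 817533821, 2101987996, 2923730395, 3452408452, 3638617441,
     1103948980, 3130857594, 4264703336, 113595481, 1167813578, 1780144378, 253635353, 592632976]
    (by decide) (by decide) (by decide +kernel)

theorem exists_W641_18 : ∃ C : BinaryCode 64, IsExtremalTypeI64 C ∧ HasW641 C 18 :=
  exists_hasW641
    [424917242, 3495137704, 2826821431, 1371654159, 4086339878, 625293198, 37642349, 174416152,
     1977606524, 2250143291, 243636419, 2443363217, 336032833, 966483689, 3217548578, 2909484344,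
     14050701, 1594145652, 1633454302, 212096762, 1489303001, 2018703493, 3040079911, 2596509282,
     1143939009, 1933975718, 1327821856, 3610048317, 692690363, 376225365, 425791438, 4134675313]
    (by decide) (by decide) (by decide +kernel)

theorem exists_W641_22 : ∃ C : BinaryCode 64, IsExtremalTypeI64 C ∧ HasW641 C 22 :=
  exists_hasW641
    [3627827389, 1562805244, 3889694033, 3374501960, 516159046, 120216055, 955377206, 714584316,
     3503323998, 1845201680, 2715997923, 616102521, 2922951271, 2063600355, 978393859, 3925090842,
     2620232089, 3665272237, 982896541, 2536329486, 2817782848, 3655437333, 4248485481, 3092902941,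
     4238889450, 2673107093, 3641992475, 338226360, 1718730091, 1770552255, 4211692949, 3957311118]
    (by decide) (by decide) (by decide +kernel)

theorem exists_W641_25 : ∃ C : BinaryCode 64, IsExtremalTypeI64 C ∧ HasW641 C 25 :=
  exists_hasW641
    [1201101039, 783375779, 4050877305, 3481089753, 390392700, 3969991117, 1797820315, 2795571061,
     4187592340, 486093046, 3821133001, 3831609325, 2244515474, 595579966, 2350389661, 797572680,
     2868150089, 4160514056, 1672404135, 753105586, 4107529117, 3335217311, 4042415395, 1327758672,
     3328514112, 3686867941, 3241435942, 2833990825, 4294327909, 2060771217, 2850140232, 3194563264]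
    (by decide) (by decide) (by decide +kernel)

theorem exists_W641_29 : ∃ C : BinaryCode 64, IsExtremalTypeI64 C ∧ HasW641 C 29 :=
  exists_hasW641
    [1671935883, 3035142149, 1797963472, 1518023089, 2838348222, 1995998306, 4264462576, 2379098847,
     4140192851, 2727352891, 2040011104, 3226556554, 2244515473, 2635529983, 2821256954, 797572676,
     816691936, 4160514052, 1201550287, 2458538105, 3753690683, 3986967866, 3684528268, 4262794585,
     3328514112, 1100539462, 3463160290, 2206492937, 1794128135, 1371271741, 2850140228, 2589574564]
    (by decide) (by decide) (by decide +kernel)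

theorem exists_W641_32 : ∃ C : BinaryCode 64, IsExtremalTypeI64 C ∧ HasW641 C 32 :=
  exists_hasW641
    [2544960321, 2663838668, 2603950394, 994073862, 2579972618, 3027799904, 3393019229, 3739611128,
     1393469203, 960246566, 2205387859, 2625489871, 2300068808, 430270525, 1959223628, 488525367,
     82590527, 3206334313, 451699590, 2161912218, 3864272496, 3056294370, 3776883006, 680004521,
     1204382151, 3417834157, 171836429, 3752872850, 3830264208, 544969712, 3285701340, 99998880]
    (by decide) (by decide) (by decide +kernel)

theorem exists_W641_36 : ∃ C : BinaryCode 64, IsExtremalTypeI64 C ∧ HasW641 C 36 :=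
  exists_hasW641
    [3714835990, 220585893, 2541213294, 1381080495, 347935751, 3036063497, 997215371, 4037001555,
     2720012877, 3256875812, 1117213763, 1917379996, 3455215739, 3978976513, 2215136882, 3602567202,
     3381208875, 4044185981, 2982970115, 301705973, 756124498, 2361579053, 195342520, 2935811508,
     14298973, 841449390, 3818373734, 3759444345, 2654422834, 1786850, 976344744, 2867000960]
    (by decide) (by decide) (by decide +kernel)

theorem exists_W641_39 : ∃ C : BinaryCode 64, IsExtremalTypeI64 C ∧ HasW641 C 39 :=
  exists_hasW641
    [1656282071, 697559914, 2240729336, 3697578845, 507833137, 1797636937, 3670992561, 220477843,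
     2488296441, 1327719429, 3094843453, 3306144615, 2804042357, 1308449815, 157386917, 2865784686,
     3265800373, 54342430, 442794894, 2198106829, 3925237883, 2191818273, 2396205525, 1994637932,
     4258201671, 2268276626, 1577682304, 2291274782, 1513445292, 1726747154, 1246026972, 2982018704]
    (by decide) (by decide) (by decide +kernel)

theorem exists_W641_44 : ∃ C : BinaryCode 64, IsExtremalTypeI64 C ∧ HasW641 C 44 :=
  exists_hasW641
    [563564376, 2954560705, 1039058088, 2777137468, 3332323682, 1539975677, 434619242, 3073912584,
     1207801836, 4080042272, 998759600, 2584141737, 1312202056, 2744850397, 3851819470, 330656731,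
     1707630127, 1204039494, 3274718713, 1002844296, 1793522505, 3762125365, 304274588, 1092459546,
     1197724796, 30896629, 233219826, 783728877, 2266941391, 1168448239, 3926138288, 2232884926]
    (by decide) (by decide) (by decide +kernel)

theorem exists_W641_46 : ∃ C : BinaryCode 64, IsExtremalTypeI64 C ∧ HasW641 C 46 :=
  exists_hasW641
    [2529125378, 3703428975, 3759124728, 1538847955, 953366708, 3781134436, 2733585849, 2043329455,
     3925564486, 3372973626, 2626613818, 1763000302, 1398972775, 1934005546, 894276102, 3648185147,
     391709000, 3868618712, 3689245708, 2514520283, 3608765961, 2421111159, 3397627626, 3637571407,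
     2624077758, 49526644, 3382058092, 348765104, 3696678685, 406920222, 2589616460, 3805644130]
    (by decide) (by decide) (by decide +kernel)

theorem exists_W641_53 : ∃ C : BinaryCode 64, IsExtremalTypeI64 C ∧ HasW641 C 53 :=
  exists_hasW641
    [1062620528, 1795246223, 4070394104, 1909039669, 2571417880, 195757764, 3016097593, 1154644195,
     3202870221, 3422509828, 2168266821, 3632384723, 4260531171, 2495874899, 1729846312, 2092535960,
     878201384, 2335743071, 4145980578, 408458023, 3734802728, 426983196, 3872219229, 371167151,
     327275236, 3237673116, 302221078, 3528590210, 1923864802, 1593773582, 3894047744, 2739642016]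
    (by decide) (by decide) (by decide +kernel)

theorem exists_W641_59 : ∃ C : BinaryCode 64, IsExtremalTypeI64 C ∧ HasW641 C 59 :=
  exists_hasW641
    [1390217395, 4094871628, 743090971, 1861504347, 2298194873, 2912383148, 1176976898, 3753597184,
     3826085251, 3295873606, 1977831021, 4068845985, 2037716526, 463658065, 1571803716, 781958891,
     3617377269, 3642359833, 2715686305, 1495800016, 1571123247, 229184135, 4290163758, 347094818,
     3653106469, 4153026724, 1240427129, 2714533895, 432072848, 2226899166, 3215572622, 3090795400]
    (by decide) (by decide) (by decide +kernel)

theorem exists_W641_60 : ∃ C : BinaryCode 64, IsExtremalTypeI64 C ∧ HasW641 C 60 :=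
  exists_hasW641
    [2529125378, 2834868493, 4165905639, 805145265, 953366708, 2376246623, 3471529924, 2033448169,
     3925564486, 2784383745, 1589816971, 99095253, 2308353679, 2840319364, 2617041804, 3044442438,
     3444851174, 2452250364, 1968446854, 2501494685, 2740721771, 3825878805, 147845723, 3033828658,
     4036301445, 49526644, 328948930, 3599099649, 518243562, 2589616460, 3266647030, 953730508]
    (by decide) (by decide) (by decide +kernel)

theorem exists_W641_64 : ∃ C : BinaryCode 64, IsExtremalTypeI64 C ∧ HasW641 C 64 :=
  exists_hasW641
    [3877535133, 1625531907, 6798598, 641107460, 1147885829, 2642626138, 860005204, 718609928,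
     1012260010, 2933393250, 1952348680, 3726366460, 1076090942, 3924492976, 286684146, 3761245235,
     2345109153, 3152029107, 1168172499, 2289889862, 515664181, 366525810, 1253600385, 1978686847,
     3618049104, 2454745392, 1910490120, 3209585634, 3413013508, 4287126395, 2111590315, 4118905971]
    (by decide) (by decide) (by decide +kernel)

theorem exists_W641_74 : ∃ C : BinaryCode 64, IsExtremalTypeI64 C ∧ HasW641 C 74 :=
  exists_hasW641
    [505596953, 861091575, 1743833152, 1245207580, 1008420382, 1065013865, 2312418811, 2234216960,
     2870954139, 935311835, 1382653075, 2274194897, 2540121020, 3964417970, 1244542813, 3905493491,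
     2636508809, 2091056389, 3840510743, 1820492237, 3359567028, 3860054990, 2662317501, 2115102894,
     2521562391, 2001316481, 3226305358, 4100310015, 2455280467, 3405393632, 1550116104, 381930688]
    (by decide) (by decide) (by decide +kernel)

/-! ### Binary codes in the second family -/

theorem exists_W642_0 : ∃ C : BinaryCode 64, IsExtremalTypeI64 C ∧ HasW642 C 0 :=
  exists_hasW642
    [254989850, 2385876862, 180628136, 2622648103, 250582365, 4071887846, 2317286323, 1911541702,
     504124651, 1144085157, 3320322059, 496256853, 1368026021, 843616742, 4034997966, 4241926848,
     2302703060, 2669731671, 1578727347, 2975207744, 2492045534, 3952411386, 1554234439, 300846206,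
     2829059734, 1020831287, 32971620, 4135020928, 1781172713, 253673980, 2777662200, 1781356610]
    (by decide) (by decide +kernel)

theorem exists_W642_1 : ∃ C : BinaryCode 64, IsExtremalTypeI64 C ∧ HasW642 C 1 :=
  exists_hasW642
    [3051410768, 2507212150, 257137543, 956954750, 1197206367, 2140373906, 4172516782, 3849904969,
     1132662325, 3069476473, 2683680835, 3029546791, 3149897048, 650675878, 1310700450, 3434555347,
     3066846152, 2622480187, 2807326402, 443819292, 1677083584, 2385121168, 3598898341, 331516194,
     523088305, 1823922234, 713439983, 3232811947, 3634697854, 211516804, 1711214308, 2594836870]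
    (by decide) (by decide +kernel)

theorem exists_W642_2 : ∃ C : BinaryCode 64, IsExtremalTypeI64 C ∧ HasW642 C 2 :=
  exists_hasW642
    [4099656211, 3181853521, 890053280, 2114964968, 1606669391, 3329294989, 1693393778, 3477625675,
     1377331996, 2022711450, 4156844035, 1457834678, 1035570351, 2328016241, 540196010, 3014424282,
     4130420771, 1104844411, 1184044372, 1374556879, 1704366316, 2863007150, 460970608, 4190350166,
     447576521, 2735859785, 3814549378, 563468154, 3950451260, 1191227380, 755922820, 390658816]
    (by decide) (by decide +kernel)

theorem exists_W642_4 : ∃ C : BinaryCode 64, IsExtremalTypeI64 C ∧ HasW642 C 4 :=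
  exists_hasW642
    [4215486690, 1729864115, 3882480117, 3373018568, 2383838422, 3589682688, 2016732733, 3472362868,
     81171930, 2930026631, 2331411004, 929397120, 4013875809, 1452184369, 1123969285, 648610649,
     1409101107, 473948984, 1426136085, 3555904893, 3133001223, 2376981972, 3341815570, 1873766827,
     639422553, 227698211, 1956286074, 1414573909, 4106700585, 3695705394, 1128188312, 1554794558]
    (by decide) (by decide +kernel)

theorem exists_W642_5 : ∃ C : BinaryCode 64, IsExtremalTypeI64 C ∧ HasW642 C 5 :=
  exists_hasW642
    [2507065200, 3053393750, 803047847, 233021942, 1396678903, 1266276890, 3428439078, 4045187297,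
     2003392445, 3069476473, 3212552803, 2155441839, 3149897048, 850185486, 1310700450, 3434555347,
     3066846152, 2622480187, 2279240930, 989476668, 2006059112, 2929991088, 3798502701, 128369290,
     734521401, 1482457522, 168306895, 3762215307, 4163568734, 946938892, 1165040836, 2594836870]
    (by decide) (by decide +kernel)

theorem exists_W642_6 : ∃ C : BinaryCode 64, IsExtremalTypeI64 C ∧ HasW642 C 6 :=
  exists_hasW642
    [4215486690, 977750296, 3124042078, 2510317047, 3535418601, 3589682688, 627576470, 3472362868,
     81171930, 4093132844, 3596274179, 1808347583, 4006494965, 1467888549, 530743726, 660186061,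
     1376619943, 1083419399, 1425128577, 2393777622, 3142413971, 3506542059, 3341815570, 1851771199,
     669806797, 1355714184, 1956286074, 151799806, 2845552514, 3695705394, 32546965, 1128188312]
    (by decide) (by decide +kernel)

theorem exists_W642_8 : ∃ C : BinaryCode 64, IsExtremalTypeI64 C ∧ HasW642 C 8 :=
  exists_hasW642
    [2780581026, 2892573184, 109683026, 206880405, 2578781393, 114151855, 2373170024, 856586317,
     2824215299, 2020206636, 3774362051, 3429209334, 2705359806, 3673266292, 1026935861, 1363735508,
     2577130221, 962044771, 2213319911, 3780112255, 4094627212, 4106358949, 3157565696, 2114550560,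
     2301188390, 2733341907, 1465629023, 379849325, 1509389022, 195266488, 4276696922, 4035138324]
    (by decide) (by decide +kernel)

theorem exists_W642_9 : ∃ C : BinaryCode 64, IsExtremalTypeI64 C ∧ HasW642 C 9 :=
  exists_hasW642
    [3270807494, 1567659853, 1149712615, 2819380835, 440310797, 1495004775, 1518979851, 3353687187,
     3731727279, 2649922808, 895120896, 31937688, 2733184868, 821130468, 3424105800, 2479116120,
     1409619225, 3360287207, 861847718, 1839045060, 1523208638, 1155716023, 2408282727, 1763143168,
     4226238225, 3293760021, 1095467245, 2754065479, 2302515387, 1942730435, 3335851373, 881930516]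
    (by decide) (by decide +kernel)

theorem exists_W642_10 : ∃ C : BinaryCode 64, IsExtremalTypeI64 C ∧ HasW642 C 10 :=
  exists_hasW642
    [190276596, 449308559, 24064937, 3591213118, 2243882598, 1602488899, 197384303, 3981947478,
     3753262999, 1988042148, 3919960274, 360231112, 4063300518, 894020740, 3719206127, 4217729477,
     3261018588, 575830291, 1124872215, 3001240829, 3203682579, 3500201343, 1290299778, 2281195084,
     4257595375, 839290521, 732902362, 1291271200, 3300420693, 3638128362, 2763638678, 367081996]
    (by decide) (by decide +kernel)

theorem exists_W642_12 : ∃ C : BinaryCode 64, IsExtremalTypeI64 C ∧ HasW642 C 12 :=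
  exists_hasW642
    [2684211454, 2735110261, 403555070, 2170101396, 1494858361, 743332553, 189135292, 4262222199,
     320365342, 696909575, 3987450788, 3101119186, 1857338759, 388766441, 4066516567, 1093456627,
     2932330050, 2214993661, 1923566537, 701031036, 2436596953, 3953171571, 2855262286, 4061000341,
     1955389865, 667678996, 459016639, 3368221967, 143942865, 447978429, 446073426, 2752124808]
    (by decide) (by decide +kernel)

theorem exists_W642_13 : ∃ C : BinaryCode 64, IsExtremalTypeI64 C ∧ HasW642 C 13 :=
  exists_hasW642
    [170803985, 2681415319, 611150287, 3731536300, 1495880984, 443320019, 4234680014, 510392145,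
     1497206256, 2487380755, 2321902509, 3438717377, 2527420907, 3504951831, 2064806961, 474854330,
     2781312486, 3666618143, 2356462217, 3592685926, 2845532568, 4013672364, 3457225864, 3862072075,
     3939696101, 1011133550, 3821428406, 2034200652, 569195548, 52827742, 3955232900, 1430277536]
    (by decide) (by decide +kernel)

theorem exists_W642_14 : ∃ C : BinaryCode 64, IsExtremalTypeI64 C ∧ HasW642 C 14 :=
  exists_hasW642
    [2540237913, 1659191174, 3154630007, 337054498, 939324262, 1805754999, 2651581450, 3118703049,
     3213316144, 1701453532, 1621822860, 2734742670, 5371032, 1787558157, 593153693, 2558600862,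
     39386476, 1685769224, 127241354, 2378364405, 3322932062, 2806218152, 740517635, 20155035,
     2931304454, 2337589818, 1341217786, 36545433, 2118098512, 1951847074, 302231285, 3252897778]
    (by decide) (by decide +kernel)

theorem exists_W642_16 : ∃ C : BinaryCode 64, IsExtremalTypeI64 C ∧ HasW642 C 16 :=
  exists_hasW642
    [2149584733, 2894838741, 4108151302, 172070444, 1951437246, 2714073051, 3121871746, 1278355837,
     1054524387, 928311603, 1432046591, 1422244489, 3932005263, 2930178025, 348022365, 3507657697,
     1443000579, 1571547792, 1384514283, 8144494, 3248260963, 1198941380, 2484193275, 3717523102,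
     3003993094, 1387328974, 3982325584, 1148851935, 372582389, 1264425481, 1819589450, 1753297566]
    (by decide) (by decide +kernel)

theorem exists_W642_17 : ∃ C : BinaryCode 64, IsExtremalTypeI64 C ∧ HasW642 C 17 :=
  exists_hasW642
    [2747685797, 602130348, 82590674, 912316852, 3242395134, 4139877583, 3456619986, 1628694231,
     2132683334, 904880318, 4047805000, 2979503630, 1102307425, 1792707236, 3610122071, 496236985,
     3306735054, 356280951, 614711715, 3230427918, 2614148881, 3897661377, 2307145885, 2858511720,
     2408016758, 350939841, 748322021, 4225842749, 2707318492, 197010471, 3447096357, 1910111409]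
    (by decide) (by decide +kernel)

theorem exists_W642_18 : ∃ C : BinaryCode 64, IsExtremalTypeI64 C ∧ HasW642 C 18 :=
  exists_hasW642
    [128017250, 722130922, 1935410748, 2378234384, 3096209295, 3935890901, 3121871748, 2163138377,
     1971804653, 928311606, 2575809997, 1422244490, 1843187638, 3858460129, 2470382178, 3507657698,
     1443000582, 1571547792, 1384514286, 3433082975, 2327911789, 2343211763, 2484193278, 1511361188,
     881598524, 2657879039, 3982325584, 2292637933, 2444512202, 1819589452, 4009778852, 2273406008]
    (by decide) (by decide +kernel)

theorem exists_W642_20 : ∃ C : BinaryCode 64, IsExtremalTypeI64 C ∧ HasW642 C 20 :=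
  exists_hasW642
    [2772729501, 2155535850, 2841465116, 2011598599, 2351803024, 2987015433, 2833023496, 3500575678,
     3191858951, 3236645880, 2207013079, 4191640278, 532238205, 3703157739, 4092540905, 3141118129,
     1692356350, 395485111, 1890803637, 407384380, 3700516620, 15020965, 2970215211, 4293429910,
     1595594632, 2845849878, 2071449512, 1161303768, 209808866, 3775846830, 658729704, 1181006354]
    (by decide) (by decide +kernel)

theorem exists_W642_21 : ∃ C : BinaryCode 64, IsExtremalTypeI64 C ∧ HasW642 C 21 :=
  exists_hasW642
    [148489907, 163498014, 3584663963, 1011169745, 753535399, 1424228515, 3410756755, 49435301,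
     2622523826, 2916963812, 3274422360, 1719664596, 1791524388, 282480968, 3268848479, 2182635930,
     3031982286, 664296628, 432458041, 1397029896, 2053923035, 379525912, 206717255, 3162504113,
     1104460161, 1729576068, 3862505156, 1514572590, 2276192074, 2759443682, 3785465296, 1434328752]
    (by decide) (by decide +kernel)

theorem exists_W642_22 : ∃ C : BinaryCode 64, IsExtremalTypeI64 C ∧ HasW642 C 22 :=
  exists_hasW642
    [2149584733, 110277576, 1589928475, 2690162225, 3729365411, 2714073051, 269153183, 3861586272,
     1054524387, 928311603, 1432046591, 1422244489, 3932005263, 2930178025, 348022365, 3507657697,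
     1443000579, 4155695757, 4171172598, 8144494, 3248260963, 3983502553, 2484193275, 3717523102,
     420758555, 1387328974, 1195671373, 1148851935, 372582389, 1264425481, 3329078103, 1753297566]
    (by decide) (by decide +kernel)

theorem exists_W642_23 : ∃ C : BinaryCode 64, IsExtremalTypeI64 C ∧ HasW642 C 23 :=
  exists_hasW642
    [1655754014, 3035142149, 1797963472, 990403566, 2822421291, 2012217079, 4281987685, 2379098847,
     2545237516, 2727352891, 2040011104, 3226556554, 3837525198, 2617345130, 3378224293, 1325044763,
     834322549, 2543352014, 653089168, 4075700403, 3218659057, 3971168175, 3153682502, 4262794585,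
     3328514112, 552307737, 3463160290, 2206492937, 1794128135, 1353484456, 3380977806, 2605629233]
    (by decide) (by decide +kernel)

theorem exists_W642_24 : ∃ C : BinaryCode 64, IsExtremalTypeI64 C ∧ HasW642 C 24 :=
  exists_hasW642
    [3345976763, 2680624681, 2957229128, 194127445, 2393655420, 281993425, 1568654279, 3516054209,
     735068012, 3595421534, 943388350, 3310996484, 444457568, 3836311758, 2243201962, 217511162,
     2676527004, 572534105, 508767212, 2721434466, 2310465377, 423124827, 3439478115, 895218153,
     2004779236, 3060703804, 3505618696, 3728541935, 1540558103, 4180907260, 3933056162, 2536187424]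
    (by decide) (by decide +kernel)

theorem exists_W642_25 : ∃ C : BinaryCode 64, IsExtremalTypeI64 C ∧ HasW642 C 25 :=
  exists_hasW642
    [4105138142, 566150236, 954235392, 2082844907, 1032933593, 1364832485, 4026114540, 201675448,
     485853664, 3043227907, 3839404851, 518326168, 3807801321, 1202872528, 255683539, 374566515,
     3372814674, 63948753, 4033064430, 1721090685, 3665223923, 4171585772, 2694190869, 3574083160,
     1101893463, 3869980557, 1356627965, 809502333, 1659788223, 3731800608, 3569933320, 2855397280]
    (by decide) (by decide +kernel)

theorem exists_W642_28 : ∃ C : BinaryCode 64, IsExtremalTypeI64 C ∧ HasW642 C 28 :=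
  exists_hasW642
    [2917416572, 823215967, 1797005945, 826837369, 1574911227, 932828310, 3886962707, 1663444880,
     472720594, 426975516, 2103419927, 2113049507, 1483462023, 1992395953, 2987924232, 2470570117,
     2404408645, 2601981475, 4077191217, 315226920, 912451635, 1743759754, 2906877019, 1218881080,
     2741919568, 1007972681, 2675556553, 2680883715, 750221837, 2320470540, 767729916, 2290201976]
    (by decide) (by decide +kernel)

theorem exists_W642_29 : ∃ C : BinaryCode 64, IsExtremalTypeI64 C ∧ HasW642 C 29 :=
  exists_hasW642
    [1395923958, 2357376170, 2447476024, 416777412, 4164676613, 2315144545, 1048516779, 3485213628,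
     1836851080, 3500088002, 2212024849, 302782289, 3687839323, 3629476012, 3487514533, 3952651067,
     3367834265, 497847628, 3191733186, 3835292559, 644813761, 198267615, 44817091, 2279353426,
     1291641368, 3185001553, 101321547, 1808050112, 426897183, 904575783, 4287765287, 1241742469]
    (by decide) (by decide +kernel)

theorem exists_W642_30 : ∃ C : BinaryCode 64, IsExtremalTypeI64 C ∧ HasW642 C 30 :=
  exists_hasW642
    [3866780583, 2676752593, 4109666203, 534324582, 112360679, 3358914309, 3885925536, 1365099500,
     3377397778, 860928128, 1825576724, 1174547675, 3729700454, 736098452, 1813951412, 2612337241,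
     1193383175, 906225377, 1225690591, 2159300402, 3086885115, 2189890430, 4167540270, 2267029118,
     2893559287, 73312493, 1898571809, 112187304, 3371102837, 1771700682, 1537341202, 272970360]
    (by decide) (by decide +kernel)

theorem exists_W642_32 : ∃ C : BinaryCode 64, IsExtremalTypeI64 C ∧ HasW642 C 32 :=
  exists_hasW642
    [4068639839, 2569205923, 3948039519, 1997731680, 2560225258, 1164604202, 3419581881, 2620599301,
     1973515440, 370147070, 547760338, 4040973401, 267161881, 3255389335, 2134415567, 3118609667,
     1123291613, 2901302186, 2367201315, 3421821593, 682036204, 1875821661, 1818632948, 583099277,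
     972292226, 7755239, 2542546040, 2595881096, 3405473794, 3630520749, 216210063, 2971092599]
    (by decide) (by decide +kernel)

theorem exists_W642_33 : ∃ C : BinaryCode 64, IsExtremalTypeI64 C ∧ HasW642 C 33 :=
  exists_hasW642
    [3694987823, 4211445021, 3926578726, 1241225381, 3797103037, 623328908, 4073024456, 3720397275,
     601937975, 908159264, 2988440387, 3231171900, 1762664879, 1416639287, 146720766, 8821189,
     735431925, 2542620910, 1797176112, 2464897668, 3888570098, 767005702, 1797369324, 119788942,
     3758051414, 3909480514, 1711820628, 1422684311, 4117696366, 2186345403, 3804290348, 3007949232]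
    (by decide) (by decide +kernel)

theorem exists_W642_36 : ∃ C : BinaryCode 64, IsExtremalTypeI64 C ∧ HasW642 C 36 :=
  exists_hasW642
    [393933912, 1854604590, 2644891903, 2681062202, 4029977936, 970889221, 1561041760, 2249666895,
     1095944163, 1481029524, 1118151497, 1938740833, 3570773899, 810739851, 2734560447, 1207352518,
     1844586404, 396884978, 3661246239, 1153208485, 4143686301, 1917515209, 2304474069, 4280573419,
     482169179, 3582429763, 2705136563, 3769946154, 270769851, 2105354788, 4161273824, 3033993576]
    (by decide) (by decide +kernel)

theorem exists_W642_37 : ∃ C : BinaryCode 64, IsExtremalTypeI64 C ∧ HasW642 C 37 :=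
  exists_hasW642
    [2527274394, 3955760866, 2949984457, 1320638357, 3765705642, 3811804787, 3492323420, 1339876373,
     2265907049, 2039702556, 580241832, 2665635873, 117171422, 2804707470, 3789049777, 4149672685,
     3322553328, 4015602539, 3170516852, 3356426486, 154087997, 310800173, 1133859834, 2441241556,
     2667847789, 689662265, 506498784, 3704980688, 2195320344, 4148606642, 1283386406, 3556103284]
    (by decide) (by decide +kernel)

theorem exists_W642_38 : ∃ C : BinaryCode 64, IsExtremalTypeI64 C ∧ HasW642 C 38 :=
  exists_hasW642
    [1029673147, 2636886072, 665438327, 1587996112, 2378096467, 1616745950, 1796411248, 368941294,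
     914826554, 1453469646, 3841744143, 3815716574, 3818277179, 1896413866, 2320548962, 1344970228,
     1796997631, 4193995204, 3414103090, 960301721, 507241481, 2313236516, 1162973641, 2061069944,
     3032848553, 766277029, 975521906, 2431396320, 3830051542, 3886774136, 2180113348, 3818861330]
    (by decide) (by decide +kernel)

theorem exists_W642_40 : ∃ C : BinaryCode 64, IsExtremalTypeI64 C ∧ HasW642 C 40 :=
  exists_hasW642
    [1448329595, 3053393750, 2157879924, 1722460362, 3634574310, 4111233887, 2059027311, 1820433794,
     2918509868, 1589107288, 2452705137, 3329917569, 3180059232, 2189106559, 2243201957, 3791504065,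
     4183484982, 2704333667, 2306346454, 718263926, 2423305889, 571451973, 1874876676, 3762584643,
     4049228456, 1035465146, 802485201, 2463591469, 2938006246, 3341829507, 1927919015, 2421013693]
    (by decide) (by decide +kernel)

theorem exists_W642_41 : ∃ C : BinaryCode 64, IsExtremalTypeI64 C ∧ HasW642 C 41 :=
  exists_hasW642
    [1244883369, 1910214046, 1708135176, 3154432503, 509744565, 1487251204, 3143708246, 860553733,
     2376026354, 1885926075, 2391848584, 498814687, 184123890, 3716869386, 1380545891, 3945977756,
     2613500869, 3080575207, 3708868840, 3762244717, 258653848, 3101089904, 1660281347, 1683830818,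
     4071233176, 1735019238, 3510059729, 260103902, 2602731893, 3390507470, 3882071216, 2394631384]
    (by decide) (by decide +kernel)

theorem exists_W642_44 : ∃ C : BinaryCode 64, IsExtremalTypeI64 C ∧ HasW642 C 44 :=
  exists_hasW642
    [1319342742, 3898947069, 276866509, 4249418699, 4017293807, 2652431544, 1499839445, 1874193523,
     1862039929, 3310886583, 2517039974, 389628009, 2591705184, 4201519651, 2669916434, 1736898943,
     1572436186, 3299409347, 2428672061, 1952548140, 1465272398, 970086132, 1498344520, 99508925,
     442835900, 3301168659, 1663576219, 60453695, 1924558867, 1625960816, 3632698892, 2050493359]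
    (by decide) (by decide +kernel)

theorem exists_W642_48 : ∃ C : BinaryCode 64, IsExtremalTypeI64 C ∧ HasW642 C 48 :=
  exists_hasW642
    [1760178172, 3149662494, 793482573, 2378206934, 3731405770, 1584785193, 4225211735, 3716351892,
     2604019046, 2954959765, 222416139, 2920463645, 2149675070, 2916711255, 1818047688, 3302050628,
     159232006, 1935240777, 1752546835, 2975134866, 1659508761, 836986634, 3618867253, 3827445345,
     2538568171, 3215110005, 1819867207, 640024824, 484661707, 917570428, 644081379, 2286217562]
    (by decide) (by decide +kernel)

theorem exists_W642_51 : ∃ C : BinaryCode 64, IsExtremalTypeI64 C ∧ HasW642 C 51 :=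
  exists_hasW642
    [1768581286, 621677587, 2955336099, 3879640740, 459631698, 1117538221, 3996588880, 1005364614,
     3197923212, 2230952754, 1635792705, 2835616843, 985863571, 2037706702, 66428953, 3754270079,
     1265622838, 1628652159, 2163303593, 1112718427, 1236502406, 1673038673, 1323610898, 735422130,
     2098485951, 2716145050, 533054085, 2709925988, 1528434693, 4112078986, 344697732, 2048418792]
    (by decide) (by decide +kernel)

theorem exists_W642_52 : ∃ C : BinaryCode 64, IsExtremalTypeI64 C ∧ HasW642 C 52 :=
  exists_hasW642
    [1489361056, 3803863415, 1612199199, 1995401497, 1691946195, 3629243261, 3333446851, 3147599959,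
     4030886107, 3817328836, 1061454910, 1111952248, 1950683069, 2018220049, 2322114519, 69503639,
     2779136616, 1595258009, 2299014479, 3200761541, 2891106912, 2809665045, 752172130, 192613719,
     173064950, 80368198, 334925584, 384493012, 4178645358, 3993511852, 3492835843, 1392548399]
    (by decide) (by decide +kernel)

theorem exists_W642_56 : ∃ C : BinaryCode 64, IsExtremalTypeI64 C ∧ HasW642 C 56 :=
  exists_hasW642
    [1760178172, 3019153337, 770906252, 2378206934, 3731405770, 3565781939, 4184805526, 1439166159,
     456807066, 987594511, 267993290, 2896834780, 2288641689, 2942432918, 1679139439, 1155347640,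
     2168019293, 4188342995, 1652925813, 2975134866, 1746535295, 836986634, 3574269428, 3868894112,
     498277745, 895405039, 1858106758, 640024824, 509334538, 3203787303, 618359586, 2192896572]
    (by decide) (by decide +kernel)

theorem exists_W642_58 : ∃ C : BinaryCode 64, IsExtremalTypeI64 C ∧ HasW642 C 58 :=
  exists_hasW642
    [71942683, 1980043948, 1159445692, 1444377687, 2781734662, 1764589687, 2517556259, 3050566346,
     3317496050, 3861424945, 3528365556, 506590563, 2283223223, 2042194733, 841531892, 1463785000,
     3195202297, 90443351, 1921353060, 1256854695, 2660513553, 3273686202, 2681794682, 3321327836,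
     3483571984, 474523244, 2018874731, 2524690172, 1426256391, 1328843995, 2683090807, 908950537]
    (by decide) (by decide +kernel)

theorem exists_W642_64 : ∃ C : BinaryCode 64, IsExtremalTypeI64 C ∧ HasW642 C 64 :=
  exists_hasW642
    [1653527915, 4281203483, 2037152001, 2996727405, 1750268267, 4122268742, 2087961884, 1738416284,
     2521740290, 2404624563, 4185385075, 4277784400, 783443814, 4260835589, 2905989199, 1689979431,
     2941667953, 4214426532, 997341437, 2105867571, 1283106139, 2611459866, 2346457829, 357565155,
     3593005271, 3461306282, 2692556927, 2547275380, 3960495300, 4053195376, 828221841, 1932192216]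
    (by decide) (by decide +kernel)

theorem exists_W642_72 : ∃ C : BinaryCode 64, IsExtremalTypeI64 C ∧ HasW642 C 72 :=
  exists_hasW642
    [3009547223, 2926589543, 3687706654, 741416014, 3954629235, 546174593, 800990205, 3398985447,
     195114120, 328049943, 3686538168, 789066285, 3818852153, 2218455506, 1043984299, 3457221224,
     3425533221, 3570159380, 2943679609, 151179549, 2984507243, 1127002892, 788173200, 2868298379,
     1601417715, 964364075, 2455162629, 1215261357, 888785347, 732601571, 2425640160, 3149657676]
    (by decide) (by decide +kernel)

theorem exists_W642_80 : ∃ C : BinaryCode 64, IsExtremalTypeI64 C ∧ HasW642 C 80 :=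
  exists_hasW642
    [2184257199, 717987225, 2620063630, 1075210032, 1487282591, 1149898488, 4248483083, 1208549821,
     1198263520, 2446594646, 1272302181, 3343949794, 3784682806, 2809198288, 2877928456, 2194542605,
     1810223892, 2782901619, 4090776726, 3459123766, 3966616064, 213131307, 877738386, 3822377854,
     2958633565, 2504422259, 3901003262, 753481248, 1525663310, 1506628340, 1756316898, 1507508700]
    (by decide) (by decide +kernel)

theorem exists_W642_88 : ∃ C : BinaryCode 64, IsExtremalTypeI64 C ∧ HasW642 C 88 :=
  exists_hasW642
    [540084783, 2547968605, 433846210, 319390030, 723027042, 2607333924, 4153913715, 387363340,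
     297842206, 482486054, 2695918445, 1456843596, 753536661, 4170056463, 3021286384, 718962972,
     2284073273, 3199710375, 3899121852, 3939181675, 1938321920, 2910055837, 4159994504, 1747782402,
     2984163846, 3931096614, 2720229604, 567020684, 792406711, 1449463445, 1020872637, 1260066526]
    (by decide) (by decide +kernel)

theorem exists_W642_96 : ∃ C : BinaryCode 64, IsExtremalTypeI64 C ∧ HasW642 C 96 :=
  exists_hasW642
    [3121183911, 667922828, 2466912297, 1541993093, 2869236674, 844328997, 2142879746, 3161998461,
     634740874, 3164840624, 1153695092, 3881832037, 2354768084, 1839278437, 382113547, 3768685577,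
     2945667470, 428519361, 1783267589, 3933917410, 1981940376, 4086192764, 2609274301, 2229436085,
     1865117400, 52239163, 4154907032, 3411433516, 4024406183, 4083812914, 132601894, 980430552]
    (by decide) (by decide +kernel)

theorem exists_W642_104 : ∃ C : BinaryCode 64, IsExtremalTypeI64 C ∧ HasW642 C 104 :=
  exists_hasW642
    [3528053689, 3885723083, 2828424584, 2355401281, 873904339, 3867597195, 358307257, 2089894447,
     2662846434, 717477152, 78438576, 3331726895, 2117280509, 644295642, 718637613, 3736784283,
     3512389581, 3834333050, 4178589875, 2295679325, 3185557924, 2313790605, 2929616197, 876505762,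
     2166661901, 2324702579, 1242369965, 1246972202, 2275360697, 266922009, 1162158620, 2745891988]
    (by decide) (by decide +kernel)

theorem exists_W642_108 : ∃ C : BinaryCode 64, IsExtremalTypeI64 C ∧ HasW642 C 108 :=
  exists_hasW642
    [3826806553, 2390721988, 2607073820, 555084828, 709680728, 1852384673, 2286983338, 3851453281,
     1580959835, 3284394891, 2464909258, 3526870843, 384763024, 1318955840, 1311165541, 3441313254,
     1886527729, 3151554621, 1252891061, 1712873965, 1201732424, 371267257, 1251083363, 1492120029,
     2371558866, 1267985052, 1410847756, 2370534085, 3888618994, 3933966254, 1377828226, 3837149408]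
    (by decide) (by decide +kernel)

theorem exists_W642_112 : ∃ C : BinaryCode 64, IsExtremalTypeI64 C ∧ HasW642 C 112 :=
  exists_hasW642
    [2722376344, 2761947527, 433846210, 319390030, 2586621711, 710734153, 3410949839, 412018282,
     509141624, 2725134381, 2482069687, 1498283818, 2701621828, 3419345109, 3021286384, 625137018,
     3143967459, 861585526, 3899121852, 1730564282, 1938321920, 2443880993, 1187006949, 3642308719,
     259185933, 3931096614, 320297865, 2432188385, 477772141, 3557830178, 1149452984, 2381149392]
    (by decide) (by decide +kernel)

theorem exists_W642_114 : ∃ C : BinaryCode 64, IsExtremalTypeI64 C ∧ HasW642 C 114 :=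
  exists_hasW642
    [3424771715, 2390721988, 3009248134, 153902470, 41250754, 1852384673, 4067873968, 3851453281,
     605930561, 3118837649, 3237247562, 2150120123, 1054258442, 1653876783, 1713339903, 2667690086,
     1886527729, 3151554621, 1722030810, 1310838903, 1201732424, 371267257, 817121401, 1893089351,
     4152185288, 1267985052, 2083415446, 2370534085, 3050856562, 2422064052, 2049330200, 3837149408]
    (by decide) (by decide +kernel)

theorem exists_W642_118 : ∃ C : BinaryCode 64, IsExtremalTypeI64 C ∧ HasW642 C 118 :=
  exists_hasW642
    [2955070510, 2390721988, 3009248133, 1930039711, 41250753, 1749842709, 2286983338, 3820346837,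
     574135029, 3320233279, 3134338643, 4230686742, 1054258441, 1722030809, 1614422856, 2667690085,
     208745055, 3353082515, 513227394, 841138906, 1032238930, 1780614167, 1287084759, 215306986,
     4152185288, 1267985052, 101198223, 4048054379, 3489541227, 103112373, 2422064052, 3837149408]
    (by decide) (by decide +kernel)

theorem exists_W642_120 : ∃ C : BinaryCode 64, IsExtremalTypeI64 C ∧ HasW642 C 120 :=
  exists_hasW642
    [1294035368, 2146061655, 1079518696, 2376477634, 4261270340, 1286079132, 2497590496, 1152957407,
     478597593, 829161495, 3520315859, 51976517, 3144515032, 2628523718, 587327883, 4294190656,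
     1667992789, 4226117261, 4034137464, 2069918166, 3381073970, 2776674437, 2080031597, 2690061706,
     2558425691, 139967793, 2149456933, 686065702, 1271688658, 3400784688, 3384901576, 2981125285]
    (by decide) (by decide +kernel)

theorem exists_W642_184 : ∃ C : BinaryCode 64, IsExtremalTypeI64 C ∧ HasW642 C 184 :=
  exists_hasW642
    [2722376344, 363580138, 433846210, 319390030, 723027042, 2607333924, 4153913715, 2506330811,
     2478151337, 2662795153, 583357402, 3567291387, 753536661, 2063279032, 3021286384, 2830082475,
     173085070, 3199710375, 3899121852, 3939181675, 1938321920, 2910055837, 4159994504, 1747782402,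
     866884273, 3931096614, 2720229604, 567020684, 2907572736, 3557830178, 1020872637, 3379443305]
    (by decide) (by decide +kernel)

/-! ### Lifts of the code of the second graph -/

theorem exists_lift₂_W641_16 : ∃ L : LinearCode R₂ 16, IsSelfDual L ∧
    IsLift L (faceCode M₂) ∧ IsExtremalTypeI64 (grayImage L) ∧ HasW641 (grayImage L) 16 :=
  exists_lift_hasW641 info_check_bijective₂ faceCode_eq₂
    [205841691, 210295335, 51492174, 52591245, 4179702152, 4128387652, 4135896098, 4182296593,
     2010347502, 3152264157, 3715947963, 4005359223, 3141259643, 2000151223, 4006507742, 3721246957,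
     867443905, 863508674, 3437330740, 3436331576, 2501014602, 1780594821, 1699270938, 2592399909,
     3823841482, 3554095301, 3166617658, 2088615989, 3464639919, 3443604063, 992527791, 924109407]
    (by decide +kernel) (by decide) (by decide) (by decide +kernel)

theorem exists_lift₂_W641_20 : ∃ L : LinearCode R₂ 16, IsSelfDual L ∧
    IsLift L (faceCode M₂) ∧ IsExtremalTypeI64 (grayImage L) ∧ HasW641 (grayImage L) 20 :=
  exists_lift_hasW641 info_check_bijective₂ faceCode_eq₂
    [2793264423, 1505683995, 2849469837, 1458289230, 1522031944, 2775887492, 1524782866, 2781981473,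
     3139770385, 1998201890, 4001710660, 3712647560, 1911702756, 3002173656, 3573027249, 3908313714,
     1696035083, 2586554887, 2504905742, 1787750413, 2518806035, 1762843939, 1770306380, 2521331596,
     3918448047, 3595422303, 3056285103, 2031565407, 4151881718, 4222902265, 4258443257, 4276183030]
    (by decide +kernel) (by decide) (by decide) (by decide +kernel)

theorem exists_lift₂_W641_24 : ∃ L : LinearCode R₂ 16, IsSelfDual L ∧
    IsLift L (faceCode M₂) ∧ IsExtremalTypeI64 (grayImage L) ∧ HasW641 (grayImage L) 24 :=
  exists_lift_hasW641 info_check_bijective₂ faceCode_eq₂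
    [2696840062, 1350386621, 2699767003, 1356274919, 4139711271, 4185782043, 4192992909, 4141350222,
     3085912909, 2078246798, 3988725271, 3732876587, 3627174839, 3828451195, 1925717741, 2982424030,
     2586306654, 1696322733, 1787671131, 2504946087, 1871215907, 2672082451, 2669860748, 1863445324,
     2199439008, 1126484304, 742537632, 478230096, 1384600425, 2706088854, 1479367830, 2753473641]
    (by decide +kernel) (by decide) (by decide) (by decide +kernel)

theorem exists_lift₂_W641_26 : ∃ L : LinearCode R₂ 16, IsSelfDual L ∧
    IsLift L (faceCode M₂) ∧ IsExtremalTypeI64 (grayImage L) ∧ HasW641 (grayImage L) 26 :=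
  exists_lift_hasW641 info_check_bijective₂ faceCode_eq₂
    [4117947316, 4205958008, 4124622049, 4209278162, 1725453454, 2581899341, 2574405931, 1722917399,
     1311385725, 2366969022, 462062295, 658850283, 1208258004, 2215137000, 302065521, 553786290,
     1515107009, 2777510338, 1511778356, 2770850872, 898506278, 978136345, 3307948937, 3390539590,
     3541187317, 3810604538, 2085145333, 3162818042, 1373148505, 2732878502, 1416783190, 2830211753]
    (by decide +kernel) (by decide) (by decide) (by decide +kernel)

theorem exists_lift₂_W641_28 : ∃ L : LinearCode R₂ 16, IsSelfDual L ∧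
    IsLift L (faceCode M₂) ∧ IsExtremalTypeI64 (grayImage L) ∧ HasW641 (grayImage L) 28 :=
  exists_lift_hasW641 info_check_bijective₂ faceCode_eq₂
    [203128763, 203931511, 55500782, 59633629, 1876637741, 2682729502, 2675884679, 1874706763,
     3984634148, 3728765464, 3072386177, 2064701506, 3841691154, 3640085793, 2986224456, 1929189252,
     176235627, 88217751, 170164638, 85475949, 890417875, 975270371, 3309889660, 3397702844,
     742980240, 478475616, 2199059040, 1126299024, 2884331833, 1473746486, 2931726022, 1568500169]
    (by decide +kernel) (by decide) (by decide) (by decide +kernel)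

theorem exists_lift₂_W641_30 : ∃ L : LinearCode R₂ 16, IsSelfDual L ∧
    IsLift L (faceCode M₂) ∧ IsExtremalTypeI64 (grayImage L) ∧ HasW641 (grayImage L) 30 :=
  exists_lift_hasW641 info_check_bijective₂ faceCode_eq₂
    [3230587163, 3226330663, 808154702, 806861197, 2742892514, 1404976081, 2899824056, 1558957684,
     2078270018, 3085947265, 3732912152, 3988747300, 307383227, 564234103, 1213734638, 2225352157,
     4191306226, 4141974257, 4135064824, 4189333748, 4142417695, 4191456047, 4189199695, 4134612623,
     3501782518, 3765762809, 1893922297, 2966551286, 4074648522, 4058854341, 4168862778, 4105686069]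
    (by decide +kernel) (by decide) (by decide) (by decide +kernel)

theorem exists_lift₂_W641_34 : ∃ L : LinearCode R₂ 16, IsSelfDual L ∧
    IsLift L (faceCode M₂) ∧ IsExtremalTypeI64 (grayImage L) ∧ HasW641 (grayImage L) 34 :=
  exists_lift_hasW641 info_check_bijective₂ faceCode_eq₂
    [4283332078, 4287478493, 4280014267, 4280806007, 1869887726, 2679649501, 2681324219, 1877131639,
     1145091917, 2290121614, 286321943, 572579371, 1211229409, 2217924818, 314880436, 566784632,
     1605951943, 2943668939, 1608692797, 2949740606, 85701845, 170359018, 89055605, 177066682,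
     2032926656, 3055026112, 3599695664, 3914202928, 2881370816, 1467823552, 2934688304, 1574421808]
    (by decide +kernel) (by decide) (by decide) (by decide +kernel)

theorem exists_lift₂_W641_38 : ∃ L : LinearCode R₂ 16, IsSelfDual L ∧
    IsLift L (faceCode M₂) ∧ IsExtremalTypeI64 (grayImage L) ∧ HasW641 (grayImage L) 38 :=
  exists_lift_hasW641 info_check_bijective₂ faceCode_eq₂
    [1069359147, 1065226263, 3488055438, 3487252557, 4034184237, 4038641694, 4040241543, 4041355851,
     2977623534, 1924521693, 3839539131, 3638918007, 487293416, 772227796, 1192109234, 2332891249,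
     3236227015, 3235437515, 816954685, 812809790, 2626385692, 1816640300, 1664015683, 2468212355,
     646208755, 424193267, 2300662780, 1175626748, 237530357, 219454714, 193106933, 121725946]
    (by decide +kernel) (by decide) (by decide) (by decide +kernel)

theorem exists_lift₂_W642_3 : ∃ L : LinearCode R₂ 16, IsSelfDual L ∧
    IsLift L (faceCode M₂) ∧ IsExtremalTypeI64 (grayImage L) ∧ HasW642 (grayImage L) 3 :=
  exists_lift_hasW642 info_check_bijective₂ faceCode_eq₂
    [1779753175, 2502480107, 2587996285, 1703047358, 1662717204, 2468810280, 2622359361, 1821182850,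
     556459076, 303421576, 2223681809, 1212510754, 2387905819, 1302875687, 726738766, 396499853,
     1550921118, 2897354349, 1406437227, 2749909911, 3283646227, 3279207203, 1021500748, 1020391052,
     2039202608, 3058156336, 3593354432, 3911007424, 3420142325, 3353818618, 1048496885, 1035847162]
    (by decide +kernel) (by decide) (by decide +kernel)

theorem exists_lift₂_W642_7 : ∃ L : LinearCode R₂ 16, IsSelfDual L ∧
    IsLift L (faceCode M₂) ∧ IsExtremalTypeI64 (grayImage L) ∧ HasW642 (grayImage L) 7 :=
  exists_lift_hasW642 info_check_bijective₂ faceCode_eq₂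
    [1770293777, 2521318690, 2518755908, 1762792840, 169109287, 86547227, 172072333, 92433998,
     3094602797, 1957943326, 3806114183, 3521933899, 2281212749, 1274300302, 770846231, 519118123,
     860810590, 864935597, 3424368475, 3425139623, 1558107254, 2901272761, 1400599001, 2746725094,
     1980847513, 3106056806, 3645134182, 3867716249, 2931357087, 1567947375, 2883777903, 1473378975]
    (by decide +kernel) (by decide) (by decide +kernel)

theorem exists_lift₂_W642_11 : ∃ L : LinearCode R₂ 16, IsSelfDual L ∧
    IsLift L (faceCode M₂) ∧ IsExtremalTypeI64 (grayImage L) ∧ HasW642 (grayImage L) 11 :=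
  exists_lift_hasW642 info_check_bijective₂ faceCode_eq₂
    [3434948881, 3430815266, 870811204, 870009224, 2739760708, 1401855368, 2887228177, 1546348322,
     3679120173, 3884308254, 2115681927, 3173350731, 3513505934, 3801605197, 1956540971, 3094196503,
     960767026, 914888753, 3323036104, 3374465732, 3404256469, 3319064810, 984772981, 896643770,
     3543070214, 3810392329, 2089548041, 3158832646, 1649240495, 2442040927, 2551682735, 1680566623]
    (by decide +kernel) (by decide) (by decide +kernel)

theorem exists_lift₂_W642_15 : ∃ L : LinearCode R₂ 16, IsSelfDual L ∧
    IsLift L (faceCode M₂) ∧ IsExtremalTypeI64 (grayImage L) ∧ HasW642 (grayImage L) 15 :=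
  exists_lift_hasW642 info_check_bijective₂ faceCode_eq₂
    [869381867, 870480343, 3430214078, 3434665597, 3384214139, 3329950135, 921503966, 970851565,
     1914342782, 2972012221, 3628738523, 3833928679, 496730695, 778518923, 1198401565, 2342327342,
     2585688212, 1697494120, 1783353953, 2508710290, 2575162149, 1723787034, 1725398661, 2582363466,
     2307368393, 1179343558, 640525622, 421419577, 4146854406, 4212651273, 4254005769, 4266521862]
    (by decide +kernel) (by decide) (by decide +kernel)

theorem exists_lift₂_W642_26 : ∃ L : LinearCode R₂ 16, IsSelfDual L ∧
    IsLift L (faceCode M₂) ∧ IsExtremalTypeI64 (grayImage L) ∧ HasW642 (grayImage L) 26 :=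
  exists_lift_hasW642 info_check_bijective₂ faceCode_eq₂
    [114758471, 166405003, 159206429, 113151022, 3317369678, 3396798349, 904793627, 987565351,
     3084708055, 2079118571, 3983782525, 3736302014, 2023442219, 3026684695, 3530431886, 3785174605,
     4229179143, 4230486795, 4081159437, 4085403150, 894243562, 982393301, 3306637498, 3391849589,
     2262672188, 1240355644, 695708867, 381377731, 1467241324, 2881004444, 1574001811, 2934090851]
    (by decide +kernel) (by decide) (by decide +kernel)

theorem exists_lift₂_W642_27 : ∃ L : LinearCode R₂ 16, IsSelfDual L ∧
    IsLift L (faceCode M₂) ∧ IsExtremalTypeI64 (grayImage L) ∧ HasW642 (grayImage L) 27 :=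
  exists_lift_hasW642 info_check_bijective₂ faceCode_eq₂
    [1433866305, 2864390274, 1440563220, 2867757096, 1614990637, 2424426014, 2417506183, 1612987211,
     618009051, 417932007, 2172208254, 1119258813, 570143348, 318206392, 2231298257, 1224594658,
     1434366270, 2864542269, 1440474315, 2867321031, 4081612579, 4085562131, 4229094796, 4230082124,
     646422678, 424366185, 2301468777, 1176391830, 3297591146, 3360571285, 824692634, 840683365]
    (by decide +kernel) (by decide) (by decide +kernel)

theorem exists_lift₂_W642_35 : ∃ L : LinearCode R₂ 16, IsSelfDual L ∧
    IsLift L (faceCode M₂) ∧ IsExtremalTypeI64 (grayImage L) ∧ HasW642 (grayImage L) 35 :=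
  exists_lift_hasW642 info_check_bijective₂ faceCode_eq₂
    [2588428013, 1703184862, 1779571127, 2501977723, 1699652750, 2592954445, 2501615915, 1780961815,
     1924519127, 2977622251, 3638915453, 3839537854, 3140803908, 2000219784, 4005656337, 3720526626,
     1450957675, 2847401879, 1507753630, 2800598381, 1869737238, 2679299625, 2681517897, 1877506950,
     3844575434, 3659227333, 3045941306, 2051969077, 149005059, 80892675, 45394956, 24665100]
    (by decide +kernel) (by decide) (by decide +kernel)

/-! ### Lifts of the code of the first graph -/

theorem exists_lift₁_W641_20 : ∃ L : LinearCode R₂ 16, IsSelfDual L ∧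
    IsLift L (faceCode M₁) ∧ IsExtremalTypeI64 (grayImage L) ∧ HasW641 (grayImage L) 20 :=
  exists_lift_hasW641 info_check_bijective₁ faceCode_eq₁
    [3362971934, 3299988013, 853062731, 837056647, 2264073074, 1240662961, 704384216, 385617124,
     1989191528, 3110099860, 3646991762, 3868221025, 1985379390, 3114908733, 3646542795, 3869696967,
     603433671, 335238603, 2365434429, 1291736382, 3166303640, 2088172132, 3823564130, 3554278033,
     2168075764, 1110784760, 617268721, 415615730, 3793819434, 3507628821, 3095678346, 1950912069]
    (by decide +kernel) (by decide) (by decide) (by decide +kernel)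

theorem exists_lift₁_W641_24 : ∃ L : LinearCode R₂ 16, IsSelfDual L ∧
    IsLift L (faceCode M₁) ∧ IsExtremalTypeI64 (grayImage L) ∧ HasW641 (grayImage L) 24 :=
  exists_lift_hasW641 info_check_bijective₁ faceCode_eq₁
    [2497438129, 1760023154, 1635693796, 2461890776, 1135192622, 2203473181, 480684683, 744052039,
     2141844020, 3210146104, 3752261825, 4015649986, 1966439009, 3124409746, 3586513556, 3939165544,
     1246890487, 2241922811, 441976573, 631507454, 1256826619, 2245417463, 448178686, 628709117,
     3002308158, 1911777597, 3908856267, 3573323463, 612509519, 406920079, 2166918431, 1108626991]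
    (by decide +kernel) (by decide) (by decide) (by decide +kernel)

theorem exists_lift₁_W641_26 : ∃ L : LinearCode R₂ 16, IsSelfDual L ∧
    IsLift L (faceCode M₁) ∧ IsExtremalTypeI64 (grayImage L) ∧ HasW641 (grayImage L) 26 :=
  exists_lift_hasW641 info_check_bijective₁ faceCode_eq₁
    [3408415719, 3340011483, 1048714941, 1027681662, 2150679943, 1076939339, 549467437, 281033246,
     3765018056, 3499519684, 2962646834, 1885969201, 330099111, 593286747, 1285797549, 2354280798,
     3490407374, 3758592973, 1880005691, 2953669687, 3656171714, 3873226945, 1991454776, 3111333940,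
     3674550427, 3876204647, 2114306158, 3171598493, 2022602569, 3024993158, 3526090006, 3776441897]
    (by decide +kernel) (by decide) (by decide) (by decide +kernel)

theorem exists_lift₁_W641_30 : ∃ L : LinearCode R₂ 16, IsSelfDual L ∧
    IsLift L (faceCode M₁) ∧ IsExtremalTypeI64 (grayImage L) ∧ HasW641 (grayImage L) 30 :=
  exists_lift_hasW641 info_check_bijective₁ faceCode_eq₁
    [3253657326, 3269324253, 884702139, 947369847, 587229879, 318805371, 2348849901, 1275094494,
     2248387387, 1224955703, 688697038, 369909197, 3761868632, 3493220260, 2965778258, 1892229025,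
     1083445076, 2154303400, 274796369, 546443170, 441398584, 630143540, 1243596226, 2234501825,
     3836343048, 3629576964, 2980510722, 1918499841, 3884010931, 3678572147, 3173259244, 2115513308]
    (by decide +kernel) (by decide) (by decide) (by decide +kernel)

theorem exists_lift₁_W642_26 : ∃ L : LinearCode R₂ 16, IsSelfDual L ∧
    IsLift L (faceCode M₁) ∧ IsExtremalTypeI64 (grayImage L) ∧ HasW642 (grayImage L) 26 :=
  exists_lift_hasW642 info_check_bijective₁ faceCode_eq₁
    [69382513, 135361202, 25748692, 38066408, 741758587, 473541047, 2211011038, 1137092333,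
     3700426801, 3965715506, 1935672004, 3012559304, 3919521192, 3597605460, 3060762018, 2040482385,
     3751633677, 4017001230, 2137496583, 3214633995, 3129293208, 1967797860, 3928344162, 3575302545,
     2120224680, 3180334932, 3683651490, 3881832273, 3958231791, 3621708255, 3199695039, 2105259135]
    (by decide +kernel) (by decide) (by decide +kernel)

/-! ### The main theorem -/

theorem exists_of_lift {D : BinaryCode 16} {P Q : BinaryCode 64 → Prop}
    (h : ∃ L : LinearCode R₂ 16, IsSelfDual L ∧ IsLift L D ∧ P (grayImage L) ∧ Q (grayImage L)) :
    ∃ C, P C ∧ Q C :=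
  let ⟨L, _, _, hL⟩ := h
  ⟨grayImage L, hL⟩

theorem exists_lift_of_mem_newBeta₁ : ∀ β ∈ newBeta₁,
    ∃ L : LinearCode R₂ 16, IsSelfDual L ∧ IsLift L (faceCode M₂) ∧
    IsExtremalTypeI64 (grayImage L) ∧ HasW641 (grayImage L) β := by
  simp only [newBeta₁, Finset.forall_mem_insert, Finset.mem_singleton, forall_eq]
  exact ⟨exists_lift₂_W641_16, exists_lift₂_W641_20, exists_lift₂_W641_24, exists_lift₂_W641_26,
    exists_lift₂_W641_28, exists_lift₂_W641_30, exists_lift₂_W641_34, exists_lift₂_W641_38⟩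

theorem exists_lift_of_mem_newBeta₂ : ∀ β ∈ newBeta₂,
    ∃ L : LinearCode R₂ 16, IsSelfDual L ∧ IsLift L (faceCode M₂) ∧
    IsExtremalTypeI64 (grayImage L) ∧ HasW642 (grayImage L) β := by
  simp only [newBeta₂, Finset.forall_mem_insert, Finset.mem_singleton, forall_eq]
  exact ⟨exists_lift₂_W642_3, exists_lift₂_W642_7, exists_lift₂_W642_11, exists_lift₂_W642_15,
    exists_lift₂_W642_26, exists_lift₂_W642_27, exists_lift₂_W642_35⟩

theorem exists_of_mem_oldBeta₁ : ∀ β ∈ oldBeta₁,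
    ∃ C : BinaryCode 64, IsExtremalTypeI64 C ∧ HasW641 C β := by
  simp only [oldBeta₁, Finset.forall_mem_insert, Finset.mem_singleton, forall_eq]
  exact ⟨exists_W641_14, exists_W641_18, exists_W641_22, exists_W641_25, exists_W641_29,
    exists_W641_32, exists_W641_36, exists_W641_39, exists_W641_44, exists_W641_46, exists_W641_53,
    exists_W641_59, exists_W641_60, exists_W641_64, exists_W641_74⟩

theorem exists_of_mem_oldBeta₂ : ∀ β ∈ oldBeta₂,
    ∃ C : BinaryCode 64, IsExtremalTypeI64 C ∧ HasW642 C β := by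
  simp only [oldBeta₂, Finset.forall_mem_insert, Finset.mem_singleton, forall_eq]
  exact ⟨exists_W642_0, exists_W642_1, exists_W642_2, exists_W642_4, exists_W642_5, exists_W642_6,
    exists_W642_8, exists_W642_9, exists_W642_10, exists_W642_12, exists_W642_13, exists_W642_14,
    exists_W642_16, exists_W642_17, exists_W642_18, exists_W642_20, exists_W642_21, exists_W642_22,
    exists_W642_23, exists_W642_24, exists_W642_25, exists_W642_28, exists_W642_29, exists_W642_30,
    exists_W642_32, exists_W642_33, exists_W642_36, exists_W642_37, exists_W642_38, exists_W642_40,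
    exists_W642_41, exists_W642_44, exists_W642_48, exists_W642_51, exists_W642_52, exists_W642_56,
    exists_W642_58, exists_W642_64, exists_W642_72, exists_W642_80, exists_W642_88, exists_W642_96,
    exists_W642_104, exists_W642_108, exists_W642_112, exists_W642_114, exists_W642_118,
    exists_W642_120, exists_W642_184⟩

theorem exists_of_mem_allBeta₁ : ∀ β ∈ allBeta₁,
    ∃ C : BinaryCode 64, IsExtremalTypeI64 C ∧ HasW641 C β := by
  intro β hβ
  rcases Finset.mem_union.1 hβ with h | h
  · exact exists_of_mem_oldBeta₁ β h
  · exact exists_of_lift (exists_lift_of_mem_newBeta₁ β h)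

theorem exists_of_mem_allBeta₂ : ∀ β ∈ allBeta₂,
    ∃ C : BinaryCode 64, IsExtremalTypeI64 C ∧ HasW642 C β := by
  intro β hβ
  rcases Finset.mem_union.1 hβ with h | h
  · exact exists_of_mem_oldBeta₂ β h
  · exact exists_of_lift (exists_lift_of_mem_newBeta₂ β h)

theorem exists_lift_faceCode₁ : ∀ β ∈ ({20, 24, 26, 30} : Finset ℕ),
    ∃ L : LinearCode R₂ 16, IsSelfDual L ∧ IsLift L (faceCode M₁) ∧
    IsExtremalTypeI64 (grayImage L) ∧ HasW641 (grayImage L) β := by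
  simp only [Finset.forall_mem_insert, Finset.mem_singleton, forall_eq]
  exact ⟨exists_lift₁_W641_20, exists_lift₁_W641_24, exists_lift₁_W641_26, exists_lift₁_W641_30⟩

end GraphCodes

theorem mainTheorem1 :
    -- existence for 23 parameters in the first and 56 parameters in the second family
    allBeta₁.card = 23 ∧ allBeta₂.card = 56 ∧
    (∀ β ∈ allBeta₁, ∃ C : BinaryCode 64, IsExtremalTypeI64 C ∧ HasW641 C β) ∧
    (∀ β ∈ allBeta₂, ∃ C : BinaryCode 64, IsExtremalTypeI64 C ∧ HasW642 C β) ∧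
    -- the two bicubic planar graphs and their self-dual `[16, 8, 4]` codes
    (IsBicubicPlanar M₁ ∧ IsTypeII (faceCode M₁) ∧ HasParameters (faceCode M₁) 8 4) ∧
    (IsBicubicPlanar M₂ ∧ IsTypeI (faceCode M₂) ∧ HasParameters (faceCode M₂) 8 4) ∧
    -- the new codes are Gray images of self-dual lifts of the code of the second graph
    (∀ β ∈ newBeta₁, ∃ L : LinearCode R₂ 16, IsSelfDual L ∧ IsLift L (faceCode M₂) ∧
      IsExtremalTypeI64 (grayImage L) ∧ HasW641 (grayImage L) β) ∧
    (∀ β ∈ newBeta₂, ∃ L : LinearCode R₂ 16, IsSelfDual L ∧ IsLift L (faceCode M₂) ∧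
      IsExtremalTypeI64 (grayImage L) ∧ HasW642 (grayImage L) β) ∧
    -- five of the values are also attained by lifts of the code of the first graph
    (∀ β ∈ ({20, 24, 26, 30} : Finset ℕ), ∃ K : LinearCode R₂ 16,
      IsSelfDual K ∧ IsLift K (faceCode M₁) ∧
      IsExtremalTypeI64 (grayImage K) ∧ HasW641 (grayImage K) β) ∧
    (∃ K : LinearCode R₂ 16, IsSelfDual K ∧ IsLift K (faceCode M₁) ∧
      IsExtremalTypeI64 (grayImage K) ∧ HasW642 (grayImage K) 26) :=
  ⟨by decide +kernel, by decide +kernel, exists_of_mem_allBeta₁, exists_of_mem_allBeta₂,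
    ⟨isBicubicPlanar₁, isTypeII_faceCode₁, hasParameters_faceCode₁⟩,
    ⟨isBicubicPlanar₂, isTypeI_faceCode₂, hasParameters_faceCode₂⟩,
    exists_lift_of_mem_newBeta₁, exists_lift_of_mem_newBeta₂, exists_lift_faceCode₁,
    exists_lift₁_W642_26⟩
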